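/- **Notation.** For a finite group $G$ and a commutative ring $R$, let $\mathrm B_R(G,G)$ be the double Burnside $R$-algebra: the $R$-module freely generated by the isomorphism classes $[M]$ of finite $(G,G)$-bisets $M$ modulo the relations $[M\sqcup N]=[M]+[N]$, with multiplication $[M]\cdot[N]=[M\times_G N]$, where $M\times_G N$ is the set of orbits of $G$ on $M\times N$ under $g(m,n)=(mg^{-1},gn)$, with $h(m\times_G n)p=(hm)\times_G(np)$; its identity element is $[G]$. Let $A$ be the $\mathbf Q$-algebra of all block matrices $$\begin{bmatrix} s&0&0&t\\ 0&u&0&v\\ 0&0&w&0\\ x&y&0&z_1+z_2\eta+z_3\xi\end{bmatrix},\qquad s\in\mathbf Q^{3\times 3},\ t\in\mathbf Q^{3\times 1},\ x\in\mathbf Q^{1\times 3},\ u,v,w,y\in\mathbf Q,\ z_1+z_2\eta+z_3\xi\in\mathbf Q[\eta,\xi]/(\eta^2,\eta\xi,\xi^2),$$ with matrix multiplication, where the products of entries are the obvious ones, except that $t\cdot x:=0$, $v\cdot y:=0$, $x\cdot t:=(\sum_i x_it_i)\,\eta$, $y\cdot v:=yv\,(\xi-12\eta)$, and that $\eta$ and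 $\xi$ act as $0$ on $t,v,x,y$. We write elements of $A$ as $6\times 6$ matrices accordingly. Let $\mathbf Z_{(3)}$ be the localisation of $\mathbf Z$ at $(3)$, and let $\Lambda_{(3)}\subseteq A$ be the $\mathbf Z_{(3)}$-subalgebra of those matrices for which all entries of $s,t,x$ and $u,v,w,y,z_1,z_2,z_3$ lie in $\mathbf Z_{(3)}$, and $x_1,x_2,x_3,z_2\in 3\mathbf Z_{(3)}$. Let $\mathrm e_i$ be the matrix whose only nonzero entry is a $1$ at position $(i,i)$, put $e:=\mathrm e_3+\mathrm e_4+\mathrm e_5+\mathrm e_6$ and $\Lambda'_{(3)}:=e\,\Lambda_{(3)}\,e$, a ring with identity element $e$. Let $\Psi$ be the quiver with vertices $\tilde{\mathrm e}_3,\tilde{\mathrm e}_4,\tilde{\mathrm e}_5,\tilde{\mathrm e}_6$ and arrows $$\tilde\tau_1:\tilde{\mathrm e}_6\to\tilde{\mathrm e}_3,\quad \tilde\tau_2:\tilde{\mathrm e}_3\to\tilde{\mathrm e}_6,\quad \tilde\tau_3:\tilde{\mathrm e}_6\to\tilde{\mathrm e}_4,\quad \tilde\tau_4:\tilde{\mathrm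 e}_4\to\tilde{\mathrm e}_6,$$ so that $\tilde{\mathrm e}_5$ is isolated. In the path algebra $\mathbf F_3\Psi$, paths are composed from left to right. **Corollary.** We have $\mathrm B_{\mathbf Z_{(3)}}(\mathrm S_3,\mathrm S_3)\cong\Lambda_{(3)}$ as $\mathbf Z_{(3)}$-algebras. As $\mathbf F_3$-algebras, we have $$\Lambda'_{(3)}/3\Lambda'_{(3)}\;\cong\;\mathbf F_3\Psi/(\tilde\tau_4\tilde\tau_3,\ \tilde\tau_4\tilde\tau_1,\ \tilde\tau_2\tilde\tau_1,\ \tilde\tau_2\tilde\tau_3).$$ The $\mathbf F_3$-algebra $\mathrm B_{\mathbf F_3}(\mathrm S_3,\mathrm S_3)$ is Morita equivalent to $\Lambda'_{(3)}/3\Lambda'_{(3)}$, and consequently to $\mathbf F_3\Psi/(\tilde\tau_4\tilde\tau_3,\ \tilde\tau_4\tilde\tau_1,\ \tilde\tau_2\tilde\tau_1,\ \tilde\tau_2\tilde\tau_3)$. -/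

import Mathlib

open scoped MulOpposite

noncomputable section

namespace DoubleBurnside

/-! ## Bisets and the double Burnside algebra -/

/-- A finite `(G, G)`-biset: a finite set with a left and a right action of `G` that commute.
As usual in Mathlib, a right action of `G` is a left action of `Gᵐᵒᵖ`, and `x · g` is
`MulOpposite.op g • x`. -/
structure Biset (G : Type) [Group G] : Type 1 where
  carrier : Type
  [finite : Finite carrier]
  [left : MulAction G carrier]
  [right : MulAction Gᵐᵒᵖ carrier]
  [comm : SMulCommClass G Gᵐᵒᵖ carrier]

attribute [instance] Biset.finite Biset.left Biset.right Biset.comm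

namespace Biset

variable {G : Type} [Group G]

/-- Isomorphisms of bisets: bijections compatible with both actions. -/
structure Iso (M N : Biset G) where
  toEquiv : M.carrier ≃ N.carrier
  map_left : ∀ (g : G) (x : M.carrier), toEquiv (g • x) = g • toEquiv x
  map_right : ∀ (g : Gᵐᵒᵖ) (x : M.carrier), toEquiv (g • x) = g • toEquiv x

/-- The identity isomorphism. -/
def Iso.refl (M : Biset G) : Iso M M := ⟨Equiv.refl _, fun _ _ => rfl, fun _ _ => rfl⟩

/-- The inverse isomorphism. -/
def Iso.symm {M N : Biset G} (e : Iso M N) : Iso N M where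
  toEquiv := e.toEquiv.symm
  map_left g x := by rw [Equiv.symm_apply_eq, e.map_left, Equiv.apply_symm_apply]
  map_right g x := by rw [Equiv.symm_apply_eq, e.map_right, Equiv.apply_symm_apply]

/-- The composite isomorphism. -/
def Iso.trans {M N P : Biset G} (e : Iso M N) (f : Iso N P) : Iso M P where
  toEquiv := e.toEquiv.trans f.toEquiv
  map_left g x := by simp [e.map_left, f.map_left]
  map_right g x := by simp [e.map_right, f.map_right]

/-- Being isomorphic, as an equivalence relation on bisets. -/
instance isoSetoid (G : Type) [Group G] : Setoid (Biset G) where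
  r M N := Nonempty (Iso M N)
  iseqv := ⟨fun M => ⟨Iso.refl M⟩, fun ⟨e⟩ => ⟨e.symm⟩, fun ⟨e⟩ ⟨f⟩ => ⟨e.trans f⟩⟩

/-- The disjoint union of two bisets. -/
def disjUnion (M N : Biset G) : Biset G where
  carrier := M.carrier ⊕ N.carrier

/-- The biset `G`, on which `G` acts by left and right multiplication. -/
def regular (G : Type) [Group G] [Finite G] : Biset G where
  carrier := G

/-- The orbit relation of the action `g (m, n) = (m g⁻¹, g n)` of `G` on `M × N`. -/
def tensorSetoid (M N : Biset G) : Setoid (M.carrier × N.carrier) where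
  r p q := ∃ g : G, q = (MulOpposite.op g⁻¹ • p.1, g • p.2)
  iseqv := by
    refine ⟨fun p => ⟨1, by simp⟩, ?_, ?_⟩
    · rintro p q ⟨g, rfl⟩
      exact ⟨g⁻¹, by simp [smul_smul]⟩
    · rintro p q r ⟨g, rfl⟩ ⟨h, rfl⟩
      exact ⟨h * g, by simp [smul_smul]⟩

/-- The set `M ×_G N` of `G`-orbits on `M × N`. -/
def TensorCarrier (M N : Biset G) : Type := Quotient (tensorSetoid M N)

/-- The orbit of `(m, n)` in `M ×_G N`. -/
def tmk {M N : Biset G} (m : M.carrier) (n : N.carrier) : TensorCarrier M N :=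
  Quotient.mk (tensorSetoid M N) (m, n)

lemma tmk_ind {M N : Biset G} {P : TensorCarrier M N → Prop}
    (h : ∀ m n, P (tmk m n)) (x : TensorCarrier M N) : P x :=
  Quotient.ind (fun p => h p.1 p.2) x

lemma tmk_eq_iff {M N : Biset G} {m m' : M.carrier} {n n' : N.carrier} :
    tmk m n = tmk m' n' ↔ ∃ g : G, m' = MulOpposite.op g⁻¹ • m ∧ n' = g • n := by
  have h : tmk m n = tmk m' n' ↔ tensorSetoid M N (m, n) (m', n') :=
    Quotient.eq (r := tensorSetoid M N)
  exact h.trans (exists_congr fun g => Prod.mk_inj)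

lemma tmk_balanced {M N : Biset G} (g : G) (m : M.carrier) (n : N.carrier) :
    tmk (MulOpposite.op g • m) n = tmk m (g • n) :=
  tmk_eq_iff.2 ⟨g, by simp [smul_smul], rfl⟩

/-- Maps out of `M ×_G N`. -/
def tlift {M N : Biset G} {X : Type} (f : M.carrier → N.carrier → X)
    (hf : ∀ (g : G) m n, f (MulOpposite.op g • m) n = f m (g • n)) : TensorCarrier M N → X :=
  Quotient.lift (fun p => f p.1 p.2) (by
    rintro p q ⟨g, rfl⟩
    have := hf g (MulOpposite.op g⁻¹ • p.1) p.2
    simpa [smul_smul] using this)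

@[simp] lemma tlift_tmk {M N : Biset G} {X : Type} (f : M.carrier → N.carrier → X)
    (hf : ∀ (g : G) m n, f (MulOpposite.op g • m) n = f m (g • n)) (m : M.carrier)
    (n : N.carrier) : tlift f hf (tmk m n) = f m n := rfl

instance (M N : Biset G) : Finite (TensorCarrier M N) :=
  inferInstanceAs (Finite (Quotient (tensorSetoid M N)))

instance (M N : Biset G) : MulAction G (TensorCarrier M N) where
  smul h := tlift (fun m n => tmk (h • m) n) (fun g m n => by
    rw [smul_comm, tmk_balanced])
  one_smul x := by
    induction x using tmk_ind with | h m n => exact congrArg (tmk · n) (one_smul G m)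
  mul_smul g h x := by
    induction x using tmk_ind with | h m n => exact congrArg (tmk · n) (mul_smul g h m)

instance (M N : Biset G) : MulAction Gᵐᵒᵖ (TensorCarrier M N) where
  smul h := tlift (fun m n => tmk m (h • n)) (fun g m n => by
    rw [tmk_balanced, smul_comm])
  one_smul x := by
    induction x using tmk_ind with | h m n => exact congrArg (tmk m) (one_smul Gᵐᵒᵖ n)
  mul_smul g h x := by
    induction x using tmk_ind with | h m n => exact congrArg (tmk m) (mul_smul g h n)

@[simp] lemma smul_tmk {M N : Biset G} (h : G) (m : M.carrier) (n : N.carrier) :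
    h • tmk m n = tmk (h • m) n := rfl

@[simp] lemma op_smul_tmk {M N : Biset G} (h : Gᵐᵒᵖ) (m : M.carrier) (n : N.carrier) :
    h • tmk m n = tmk m (h • n) := rfl

instance (M N : Biset G) : SMulCommClass G Gᵐᵒᵖ (TensorCarrier M N) where
  smul_comm g h x := by
    induction x using tmk_ind with | h m n => rfl

/-- The tensor product `M ×_G N` of bisets, with `h (m ×_G n) p = (h m) ×_G (n p)`. -/
def tensor (M N : Biset G) : Biset G where
  carrier := TensorCarrier M N

/-- The tensor product respects isomorphisms. -/
def tensorCongr {M M' N N' : Biset G} (e : Iso M M') (f : Iso N N') :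
    Iso (tensor M N) (tensor M' N') where
  toEquiv :=
    { toFun := tlift (fun m n => tmk (e.toEquiv m) (f.toEquiv n)) (fun g m n => by
        rw [e.map_right, f.map_left, tmk_balanced])
      invFun := tlift (fun m n => tmk (e.toEquiv.symm m) (f.toEquiv.symm n)) (fun g m n => by
        have h1 := e.symm.map_right (MulOpposite.op g) m
        have h2 := f.symm.map_left g n
        simp only [Iso.symm] at h1 h2
        rw [h1, h2, tmk_balanced])
      left_inv := fun x => by
        induction x using tmk_ind with
        | h m n =>
          exact congrArg₂ tmk (e.toEquiv.symm_apply_apply m) (f.toEquiv.symm_apply_apply n)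
      right_inv := fun x => by
        induction x using tmk_ind with
        | h m n =>
          exact congrArg₂ tmk (e.toEquiv.apply_symm_apply m) (f.toEquiv.apply_symm_apply n) }
  map_left g x := by
    induction x using tmk_ind with
    | h m n => exact congrArg (tmk · (f.toEquiv n)) (e.map_left g m)
  map_right g x := by
    induction x using tmk_ind with
    | h m n => exact congrArg (tmk (e.toEquiv m)) (f.map_right g n)

/-- Associativity of the tensor product. -/
def tensorAssoc (M N P : Biset G) :
    Iso (tensor (tensor M N) P) (tensor M (tensor N P)) where
  toEquiv :=
    { toFun := tlift (M := tensor M N) (N := P)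
        (fun x p => tlift (X := TensorCarrier M (tensor N P))
          (fun m n => tmk (M := M) (N := tensor N P) m (tmk n p)) (fun g m n =>
            tmk_balanced (M := M) (N := tensor N P) g m (tmk n p)) x)
        (fun g x p => by
          induction x using tmk_ind with
          | h m n => exact congrArg (tmk (M := M) (N := tensor N P) m) (tmk_balanced g n p))
      invFun := tlift (M := M) (N := tensor N P)
        (fun m x => tlift (X := TensorCarrier (tensor M N) P)
          (fun n p => tmk (M := tensor M N) (N := P) (tmk m n) p) (fun g n p =>
            tmk_balanced (M := tensor M N) (N := P) g (tmk m n) p) x)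
        (fun g m x => by
          induction x using tmk_ind with
          | h n p => exact congrArg (tmk (M := tensor M N) (N := P) · p) (tmk_balanced g m n))
      left_inv := fun x => by
        induction x using tmk_ind with
        | h y p => induction y using tmk_ind with | h m n => rfl
      right_inv := fun x => by
        induction x using tmk_ind with
        | h m y => induction y using tmk_ind with | h n p => rfl }
  map_left g x := by
    induction x using tmk_ind with
    | h y p => induction y using tmk_ind with | h m n => rfl
  map_right g x := by
    induction x using tmk_ind with
    | h y p => induction y using tmk_ind with | h m n => rfl

/-- The biset `G` is a left unit for the tensor product. -/
def regularTensor [Finite G] (M : Biset G) : Iso (tensor (regular G) M) M where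
  toEquiv :=
    { toFun := tlift (M := regular G) (N := M) (fun (g : G) m => g • m)
        (fun g h m => (smul_smul (M := G) h g m).symm)
      invFun := fun m => tmk (M := regular G) (1 : G) m
      left_inv := fun x => by
        induction x using tmk_ind with
        | h g m =>
          refine (tmk_balanced (M := regular G) g (1 : G) m).symm.trans ?_
          exact congrArg (tmk (M := regular G) · m) (one_mul (M := G) g)
      right_inv := fun m => one_smul G m }
  map_left g x := by
    induction x using tmk_ind with | h h m => exact mul_smul (α := G) g h m
  map_right g x := by
    induction x using tmk_ind with | h h m => exact smul_comm (M := G) h g m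

/-- The biset `G` is a right unit for the tensor product. -/
def tensorRegular [Finite G] (M : Biset G) : Iso (tensor M (regular G)) M where
  toEquiv :=
    { toFun := tlift (M := M) (N := regular G) (fun m (g : G) => MulOpposite.op g • m)
        (fun g m h => smul_smul (M := Gᵐᵒᵖ) (MulOpposite.op h) (MulOpposite.op g) m)
      invFun := fun m => tmk (N := regular G) m (1 : G)
      left_inv := fun x => by
        induction x using tmk_ind with
        | h m g =>
          refine (tmk_balanced (N := regular G) g m (1 : G)).trans ?_
          exact congrArg (tmk (N := regular G) m) (mul_one (M := G) g)
      right_inv := fun m => one_smul Gᵐᵒᵖ m }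
  map_left g x := by
    induction x using tmk_ind with
    | h m h => exact (smul_comm (M := G) (N := Gᵐᵒᵖ) g (MulOpposite.op h) m).symm
  map_right g x := by
    induction x using tmk_ind with
    | h m h => exact mul_smul (α := Gᵐᵒᵖ) g (MulOpposite.op h) m

end Biset

/-- Isomorphism classes of finite `(G, G)`-bisets. -/
def BisetClass (G : Type) [Group G] : Type 1 := Quotient (Biset.isoSetoid G)

namespace BisetClass

variable {G : Type} [Group G]

/-- The isomorphism class of a biset. -/
def mk (M : Biset G) : BisetClass G := Quotient.mk _ M

/-- The isomorphism classes of bisets form a monoid under the tensor product over `G`. -/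
instance [Finite G] : Monoid (BisetClass G) where
  mul := Quotient.map₂ Biset.tensor
    (fun _ _ ⟨e⟩ _ _ ⟨f⟩ => ⟨Biset.tensorCongr e f⟩)
  one := mk (Biset.regular G)
  mul_assoc := by
    rintro ⟨M⟩ ⟨N⟩ ⟨P⟩
    exact Quotient.sound ⟨Biset.tensorAssoc M N P⟩
  one_mul := by
    rintro ⟨M⟩
    exact Quotient.sound ⟨Biset.regularTensor M⟩
  mul_one := by
    rintro ⟨M⟩
    exact Quotient.sound ⟨Biset.tensorRegular M⟩

/-- There is only a set of isomorphism classes: every class is represented on some `Fin n`. -/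
instance : Small.{0} (BisetClass G) := by
  let T : Type := Σ n : ℕ, { a : MulAction G (Fin n) × MulAction Gᵐᵒᵖ (Fin n) //
    ∀ (g : G) (h : Gᵐᵒᵖ) (x : Fin n),
      a.1.toSMul.smul g (a.2.toSMul.smul h x) = a.2.toSMul.smul h (a.1.toSMul.smul g x) }
  let f : T → BisetClass G := fun t => mk
    { carrier := Fin t.1
      left := t.2.1.1
      right := t.2.1.2
      comm := @SMulCommClass.mk _ _ _ t.2.1.1.toSMul t.2.1.2.toSMul t.2.2 }
  refine small_of_surjective (f := f) ?_
  rintro ⟨M⟩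
  obtain ⟨n, ⟨e⟩⟩ := Finite.exists_equiv_fin M.carrier
  refine ⟨⟨n, (e.symm.mulAction G, e.symm.mulAction Gᵐᵒᵖ), ?_⟩, ?_⟩
  · intro g h x
    change e (g • e.symm (e (h • e.symm x))) = e (h • e.symm (e (g • e.symm x)))
    simp [smul_comm]
  · refine Quotient.sound ⟨⟨e.symm, ?_, ?_⟩⟩
    · intro g x
      exact e.symm_apply_apply _
    · intro g x
      exact e.symm_apply_apply _

end BisetClass

section BurnsideAlgebra

variable (R : Type) [CommRing R] (G : Type) [Group G] [Finite G]

/-- The basis element `[M]` of the free `R`-module on the isomorphism classes of bisets, with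
the multiplication `[M] [N] = [M ×_G N]`. (`Shrink` only moves the set of isomorphism classes
to `Type`.) -/
def freeClass (M : Biset G) : MonoidAlgebra R (Shrink.{0} (BisetClass G)) :=
  MonoidAlgebra.of R _ (equivShrink _ (BisetClass.mk M))

/-- The relations `[M ⊔ N] = [M] + [N]`. -/
inductive BurnsideRel :
    MonoidAlgebra R (Shrink.{0} (BisetClass G)) →
    MonoidAlgebra R (Shrink.{0} (BisetClass G)) → Prop
  | disjUnion (M N : Biset G) :
      BurnsideRel (freeClass R G (M.disjUnion N)) (freeClass R G M + freeClass R G N)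

/-- The double Burnside `R`-algebra `B_R(G, G)`: the free `R`-module on the isomorphism classes of
finite `(G, G)`-bisets modulo `[M ⊔ N] = [M] + [N]`, with multiplication `[M] [N] = [M ×_G N]`.
As `×_G` distributes over `⊔`, the relations span a two-sided ideal as an `R`-module, so that the
quotient ring by the ideal they generate is the quotient module. -/
def BurnsideAlgebra : Type := RingQuot (BurnsideRel R G)

instance : Ring (BurnsideAlgebra R G) := inferInstanceAs (Ring (RingQuot (BurnsideRel R G)))

instance : Algebra R (BurnsideAlgebra R G) :=
  inferInstanceAs (Algebra R (RingQuot (BurnsideRel R G)))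

end BurnsideAlgebra

/-! ## Path algebras -/

section PathAlgebra

variable (R : Type) [CommRing R] (V : Type) [Quiver.{0} V]

/-- All paths of the quiver, with their source and target. -/
abbrev AnyPath : Type := Σ a b : V, Quiver.Path a b

/-- The path algebra: the free `R`-module on the set of all paths, including the path of length
`0` at each vertex. -/
def PathAlgebra : Type := AnyPath V →₀ R

namespace PathAlgebra

instance : AddCommGroup (PathAlgebra R V) := inferInstanceAs (AddCommGroup (AnyPath V →₀ R))

instance : Module R (PathAlgebra R V) := inferInstanceAs (Module R (AnyPath V →₀ R))

variable {V}

/-- A path, as an element of the path algebra. -/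
def ofPath {a b : V} (p : Quiver.Path a b) : PathAlgebra R V := Finsupp.single ⟨a, b, p⟩ 1

/-- An arrow, as an element of the path algebra. -/
def ofArrow {a b : V} (f : a ⟶ b) : PathAlgebra R V := ofPath R f.toPath

open Classical in
/-- The product of two paths: first `p`, then `q`, if `p` ends where `q` starts, and `0`
otherwise. -/
def pathMul (p q : AnyPath V) : PathAlgebra R V :=
  if h : p.2.1 = q.1 then ofPath R (p.2.2.comp (q.2.2.cast h.symm rfl)) else 0

lemma pathMul_comp {a b c : V} (p : Quiver.Path a b) (q : Quiver.Path b c) :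
    pathMul R ⟨a, b, p⟩ ⟨b, c, q⟩ = ofPath R (p.comp q) := by
  simp [pathMul]

lemma pathMul_of_ne (p q : AnyPath V) (h : p.2.1 ≠ q.1) : pathMul R p q = 0 := dif_neg h

/-- The `R`-linear map out of the path algebra with given values on the paths. -/
def lift {M : Type} [AddCommGroup M] [Module R M] (f : AnyPath V → M) :
    PathAlgebra R V →ₗ[R] M :=
  Finsupp.lift M R (AnyPath V) f

lemma lift_ofPath {M : Type} [AddCommGroup M] [Module R M] (f : AnyPath V → M) {a b : V}
    (p : Quiver.Path a b) : lift R f (ofPath R p) = f ⟨a, b, p⟩ :=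
  ((Finsupp.lift_apply M R (AnyPath V) f _).trans
    (Finsupp.sum_single_index (zero_smul R _))).trans (one_smul R _)

/-- The multiplication of the path algebra, as an `R`-bilinear map. -/
def mulHom : PathAlgebra R V →ₗ[R] PathAlgebra R V →ₗ[R] PathAlgebra R V :=
  lift R fun p => lift R fun q => pathMul R p q

lemma mulHom_ofPath {a b c d : V} (p : Quiver.Path a b) (q : Quiver.Path c d) :
    mulHom R (ofPath R p) (ofPath R q) = pathMul R ⟨a, b, p⟩ ⟨c, d, q⟩ := by
  rw [mulHom, lift_ofPath, lift_ofPath]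

lemma ofPath_induction {P : PathAlgebra R V → Prop} (x : PathAlgebra R V) (h0 : P 0)
    (hadd : ∀ x y, P x → P y → P (x + y))
    (hsmul : ∀ (r : R) {a b : V} (p : Quiver.Path a b), P (r • ofPath R p)) : P x := by
  refine Finsupp.induction_linear (motive := P) x h0 hadd fun p r => ?_
  have := hsmul r p.2.2
  unfold ofPath at this
  erw [Finsupp.smul_single, smul_eq_mul, mul_one] at this
  exact this

lemma mulHom_assoc_ofPath {a b c d e f : V} (p : Quiver.Path a b) (q : Quiver.Path c d)
    (r : Quiver.Path e f) :
    mulHom R (mulHom R (ofPath R p) (ofPath R q)) (ofPath R r) =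
      mulHom R (ofPath R p) (mulHom R (ofPath R q) (ofPath R r)) := by
  by_cases h1 : b = c
  · subst h1
    by_cases h2 : d = e
    · subst h2
      simp [mulHom_ofPath, pathMul_comp]
    · rw [mulHom_ofPath, mulHom_ofPath, pathMul_comp, mulHom_ofPath, pathMul_of_ne _ _ _ h2,
        pathMul_of_ne _ _ _ h2, map_zero]
  · by_cases h2 : d = e
    · subst h2
      rw [mulHom_ofPath, mulHom_ofPath, pathMul_comp, mulHom_ofPath, pathMul_of_ne _ _ _ h1,
        pathMul_of_ne _ _ _ h1, map_zero, LinearMap.zero_apply]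
    · rw [mulHom_ofPath, mulHom_ofPath, pathMul_of_ne _ _ _ h1, pathMul_of_ne _ _ _ h2,
        map_zero, map_zero, LinearMap.zero_apply]

lemma mulHom_assoc (x y z : PathAlgebra R V) :
    mulHom R (mulHom R x y) z = mulHom R x (mulHom R y z) := by
  induction x using ofPath_induction with
  | h0 => simp
  | hadd x x' hx hx' => simp only [map_add, LinearMap.add_apply, hx, hx']
  | hsmul r p =>
    induction y using ofPath_induction with
    | h0 => simp
    | hadd y y' hy hy' => simp only [map_add, LinearMap.add_apply, hy, hy']
    | hsmul r' q =>
      induction z using ofPath_induction with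
      | h0 => simp
      | hadd z z' hz hz' => simp only [map_add, hz, hz']
      | hsmul r'' q' =>
        simp only [map_smul, LinearMap.smul_apply, mulHom_assoc_ofPath]

variable [Fintype V]

/-- The sum of the paths of length `0`. -/
def unit : PathAlgebra R V := ∑ v : V, ofPath R (Quiver.Path.nil : Quiver.Path v v)

lemma unit_mulHom (x : PathAlgebra R V) : mulHom R (unit R) x = x := by
  induction x using ofPath_induction with
  | h0 => simp
  | hadd x y hx hy => rw [map_add, hx, hy]
  | @hsmul r a b p =>
    rw [map_smul, unit, map_sum, LinearMap.sum_apply, Finset.sum_eq_single a]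
    · rw [mulHom_ofPath, pathMul_comp, Quiver.Path.nil_comp]
    · intro v _ hv
      rw [mulHom_ofPath, pathMul_of_ne _ _ _ hv]
    · simp

lemma mulHom_unit (x : PathAlgebra R V) : mulHom R x (unit R) = x := by
  induction x using ofPath_induction with
  | h0 => simp
  | hadd x y hx hy => rw [map_add, LinearMap.add_apply, hx, hy]
  | @hsmul r a b p =>
    rw [map_smul, LinearMap.smul_apply, unit, map_sum, Finset.sum_eq_single b]
    · rw [mulHom_ofPath, pathMul_comp, Quiver.Path.comp_nil]
    · intro v _ hv
      rw [mulHom_ofPath, pathMul_of_ne _ _ _ hv.symm]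
    · simp

/-- Paths are multiplied by concatenation, written from left to right; products of paths that
cannot be concatenated are `0`. -/
instance : Ring (PathAlgebra R V) where
  mul x y := mulHom R x y
  one := unit R
  left_distrib x y z := map_add (mulHom R x) y z
  right_distrib x y z := LinearMap.map_add₂ (mulHom R) x y z
  zero_mul x := LinearMap.map_zero₂ (mulHom R) x
  mul_zero x := map_zero (mulHom R x)
  mul_assoc := mulHom_assoc R
  one_mul := unit_mulHom R
  mul_one := mulHom_unit R
  zsmul := fun n x => n • x
  zsmul_zero' := SubNegMonoid.zsmul_zero'
  zsmul_succ' := SubNegMonoid.zsmul_succ'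
  zsmul_neg' := SubNegMonoid.zsmul_neg'
  neg_add_cancel := neg_add_cancel
  sub_eq_add_neg := sub_eq_add_neg
  nsmul := fun n x => n • x
  nsmul_zero := AddMonoid.nsmul_zero
  nsmul_succ := AddMonoid.nsmul_succ

instance : Algebra R (PathAlgebra R V) :=
  Algebra.ofModule (fun r x y => LinearMap.map_smul₂ (mulHom R) r x y)
    (fun r x y => map_smul (mulHom R x) r y)

end PathAlgebra

end PathAlgebra

/-! ## The quiver and its relations -/

/-- The vertices of the quiver. -/
inductive Vertex : Type
  | e3 | e4 | e5 | e6
  deriving DecidableEq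

instance : Fintype Vertex where
  elems := {.e3, .e4, .e5, .e6}
  complete v := by cases v <;> decide

/-- The arrows of the quiver; the vertex `e5` is isolated. -/
inductive Arrow : Vertex → Vertex → Type
  | τ₁ : Arrow .e6 .e3
  | τ₂ : Arrow .e3 .e6
  | τ₃ : Arrow .e6 .e4
  | τ₄ : Arrow .e4 .e6

instance : Quiver.{0} Vertex where
  Hom := Arrow

section Relations

variable (R : Type) [CommRing R]

/-- The arrow `τ₁ : e6 → e3` in the path algebra. -/
def τ₁ : PathAlgebra R Vertex := PathAlgebra.ofArrow R (a := Vertex.e6) (b := Vertex.e3) Arrow.τ₁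

/-- The arrow `τ₂ : e3 → e6` in the path algebra. -/
def τ₂ : PathAlgebra R Vertex := PathAlgebra.ofArrow R (a := Vertex.e3) (b := Vertex.e6) Arrow.τ₂

/-- The arrow `τ₃ : e6 → e4` in the path algebra. -/
def τ₃ : PathAlgebra R Vertex := PathAlgebra.ofArrow R (a := Vertex.e6) (b := Vertex.e4) Arrow.τ₃

/-- The arrow `τ₄ : e4 → e6` in the path algebra. -/
def τ₄ : PathAlgebra R Vertex := PathAlgebra.ofArrow R (a := Vertex.e4) (b := Vertex.e6) Arrow.τ₄

/-- The generators of the ideal of relations. -/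
inductive QuiverRel : PathAlgebra R Vertex → PathAlgebra R Vertex → Prop
  | τ₄τ₃ : QuiverRel (τ₄ R * τ₃ R) 0
  | τ₄τ₁ : QuiverRel (τ₄ R * τ₁ R) 0
  | τ₂τ₁ : QuiverRel (τ₂ R * τ₁ R) 0
  | τ₂τ₃ : QuiverRel (τ₂ R * τ₃ R) 0

/-- The path algebra of the quiver modulo the two-sided ideal generated by
`τ₄τ₃`, `τ₄τ₁`, `τ₂τ₁`, `τ₂τ₃`. -/
abbrev QuiverAlgebra : Type := RingQuot (QuiverRel R)

end Relations

/-! ## The algebra `A` and the order `Λ₍₃₎` -/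

/-- The localisation `ℤ₍₃₎`, as a subring of `ℚ`. -/
def Z3 : Subring ℚ where
  carrier := {q | ∃ a b : ℤ, ¬ 3 ∣ b ∧ q = a / b}
  zero_mem' := ⟨0, 1, by norm_num, by norm_num⟩
  one_mem' := ⟨1, 1, by norm_num, by norm_num⟩
  neg_mem' := by
    rintro _ ⟨a, b, hb, rfl⟩
    exact ⟨-a, b, hb, by push_cast; ring⟩
  add_mem' := by
    rintro _ _ ⟨a, b, hb, rfl⟩ ⟨c, d, hd, rfl⟩
    have hb0 : (b : ℚ) ≠ 0 := by rintro h; simp_all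
    have hd0 : (d : ℚ) ≠ 0 := by rintro h; simp_all
    exact ⟨a * d + b * c, b * d, fun h => (Int.prime_three.dvd_or_dvd h).elim hb hd,
      by push_cast; field_simp⟩
  mul_mem' := by
    rintro _ _ ⟨a, b, hb, rfl⟩ ⟨c, d, hd, rfl⟩
    exact ⟨a * c, b * d, fun h => (Int.prime_three.dvd_or_dvd h).elim hb hd,
      by push_cast; rw [div_mul_div_comm]⟩

/-- The ideal `3ℤ₍₃₎`, as an additive subgroup of `ℚ`. -/
def threeZ3 : AddSubgroup ℚ where
  carrier := {q | ∃ r ∈ Z3, q = 3 * r}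
  zero_mem' := ⟨0, Z3.zero_mem, by norm_num⟩
  add_mem' := by
    rintro _ _ ⟨a, ha, rfl⟩ ⟨b, hb, rfl⟩
    exact ⟨a + b, Z3.add_mem ha hb, by ring⟩
  neg_mem' := by
    rintro _ ⟨a, ha, rfl⟩
    exact ⟨-a, Z3.neg_mem ha, by ring⟩

lemma mul_mem_threeZ3 {a b : ℚ} (ha : a ∈ Z3) (hb : b ∈ threeZ3) : a * b ∈ threeZ3 := by
  obtain ⟨r, hr, rfl⟩ := hb
  exact ⟨a * r, Z3.mul_mem ha hr, by ring⟩

lemma threeZ3_mul_mem {a b : ℚ} (ha : a ∈ threeZ3) (hb : b ∈ Z3) : a * b ∈ threeZ3 := by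
  rw [mul_comm]
  exact mul_mem_threeZ3 hb ha

/-- The `ℚ`-vector space `A` of block matrices
```
  s   0   0   t
  0   u   0   v
  0   0   w   0
  x   y   0   z₁ + z₂ η + z₃ ξ
```
with `s ∈ ℚ^(3×3)`, a column `t`, a row `x`, and last entry in `ℚ[η, ξ]/(η², ηξ, ξ²)`. -/
@[ext] structure A where
  s : Matrix (Fin 3) (Fin 3) ℚ
  t : Fin 3 → ℚ
  u : ℚ
  v : ℚ
  w : ℚ
  x : Fin 3 → ℚ
  y : ℚ
  z₁ : ℚ
  z₂ : ℚ
  z₃ : ℚ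

namespace A

instance : Zero A := ⟨⟨0, 0, 0, 0, 0, 0, 0, 0, 0, 0⟩⟩

instance : One A := ⟨⟨1, 0, 1, 0, 1, 0, 0, 1, 0, 0⟩⟩

instance : Add A := ⟨fun a b => ⟨a.s + b.s, a.t + b.t, a.u + b.u, a.v + b.v, a.w + b.w, a.x + b.x,
  a.y + b.y, a.z₁ + b.z₁, a.z₂ + b.z₂, a.z₃ + b.z₃⟩⟩

instance : Neg A := ⟨fun a => ⟨-a.s, -a.t, -a.u, -a.v, -a.w, -a.x, -a.y, -a.z₁, -a.z₂, -a.z₃⟩⟩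

instance : SMul ℚ A := ⟨fun q a => ⟨q • a.s, q • a.t, q * a.u, q * a.v, q * a.w, q • a.x, q * a.y,
  q * a.z₁, q * a.z₂, q * a.z₃⟩⟩

/-- Multiplication of block matrices, where the product of a column `t` and a row `x` is
`0` and that of a row `x` and a column `t` is `(∑ xᵢ tᵢ) η`, where the product of the entries
`v` and `y` is `0` and that of `y` and `v` is `y v (ξ - 12 η)`, and where `η` and `ξ` annihilate
all of `t`, `v`, `x`, `y`. -/
instance : Mul A := ⟨fun a b =>
  { s := a.s * b.s
    t := a.s.mulVec b.t + b.z₁ • a.t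
    u := a.u * b.u
    v := a.u * b.v + a.v * b.z₁
    w := a.w * b.w
    x := Matrix.vecMul a.x b.s + a.z₁ • b.x
    y := a.y * b.u + a.z₁ * b.y
    z₁ := a.z₁ * b.z₁
    z₂ := a.x ⬝ᵥ b.t - 12 * (a.y * b.v) + a.z₁ * b.z₂ + a.z₂ * b.z₁
    z₃ := a.y * b.v + a.z₁ * b.z₃ + a.z₃ * b.z₁ }⟩

@[simp] lemma zero_s : (0 : A).s = 0 := rfl
@[simp] lemma zero_t : (0 : A).t = 0 := rfl
@[simp] lemma zero_u : (0 : A).u = 0 := rfl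
@[simp] lemma zero_v : (0 : A).v = 0 := rfl
@[simp] lemma zero_w : (0 : A).w = 0 := rfl
@[simp] lemma zero_x : (0 : A).x = 0 := rfl
@[simp] lemma zero_y : (0 : A).y = 0 := rfl
@[simp] lemma zero_z₁ : (0 : A).z₁ = 0 := rfl
@[simp] lemma zero_z₂ : (0 : A).z₂ = 0 := rfl
@[simp] lemma zero_z₃ : (0 : A).z₃ = 0 := rfl
@[simp] lemma one_s : (1 : A).s = 1 := rfl
@[simp] lemma one_t : (1 : A).t = 0 := rfl
@[simp] lemma one_u : (1 : A).u = 1 := rfl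
@[simp] lemma one_v : (1 : A).v = 0 := rfl
@[simp] lemma one_w : (1 : A).w = 1 := rfl
@[simp] lemma one_x : (1 : A).x = 0 := rfl
@[simp] lemma one_y : (1 : A).y = 0 := rfl
@[simp] lemma one_z₁ : (1 : A).z₁ = 1 := rfl
@[simp] lemma one_z₂ : (1 : A).z₂ = 0 := rfl
@[simp] lemma one_z₃ : (1 : A).z₃ = 0 := rfl
@[simp] lemma add_s (a b : A) : (a + b).s = a.s + b.s := rfl
@[simp] lemma add_t (a b : A) : (a + b).t = a.t + b.t := rfl
@[simp] lemma add_u (a b : A) : (a + b).u = a.u + b.u := rfl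
@[simp] lemma add_v (a b : A) : (a + b).v = a.v + b.v := rfl
@[simp] lemma add_w (a b : A) : (a + b).w = a.w + b.w := rfl
@[simp] lemma add_x (a b : A) : (a + b).x = a.x + b.x := rfl
@[simp] lemma add_y (a b : A) : (a + b).y = a.y + b.y := rfl
@[simp] lemma add_z₁ (a b : A) : (a + b).z₁ = a.z₁ + b.z₁ := rfl
@[simp] lemma add_z₂ (a b : A) : (a + b).z₂ = a.z₂ + b.z₂ := rfl
@[simp] lemma add_z₃ (a b : A) : (a + b).z₃ = a.z₃ + b.z₃ := rfl
@[simp] lemma neg_s (a : A) : (-a).s = -a.s := rfl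
@[simp] lemma neg_t (a : A) : (-a).t = -a.t := rfl
@[simp] lemma neg_u (a : A) : (-a).u = -a.u := rfl
@[simp] lemma neg_v (a : A) : (-a).v = -a.v := rfl
@[simp] lemma neg_w (a : A) : (-a).w = -a.w := rfl
@[simp] lemma neg_x (a : A) : (-a).x = -a.x := rfl
@[simp] lemma neg_y (a : A) : (-a).y = -a.y := rfl
@[simp] lemma neg_z₁ (a : A) : (-a).z₁ = -a.z₁ := rfl
@[simp] lemma neg_z₂ (a : A) : (-a).z₂ = -a.z₂ := rfl
@[simp] lemma neg_z₃ (a : A) : (-a).z₃ = -a.z₃ := rfl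
@[simp] lemma smul_s (q : ℚ) (a : A) : (q • a).s = q • a.s := rfl
@[simp] lemma smul_t (q : ℚ) (a : A) : (q • a).t = q • a.t := rfl
@[simp] lemma smul_u (q : ℚ) (a : A) : (q • a).u = q * a.u := rfl
@[simp] lemma smul_v (q : ℚ) (a : A) : (q • a).v = q * a.v := rfl
@[simp] lemma smul_w (q : ℚ) (a : A) : (q • a).w = q * a.w := rfl
@[simp] lemma smul_x (q : ℚ) (a : A) : (q • a).x = q • a.x := rfl
@[simp] lemma smul_y (q : ℚ) (a : A) : (q • a).y = q * a.y := rfl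
@[simp] lemma smul_z₁ (q : ℚ) (a : A) : (q • a).z₁ = q * a.z₁ := rfl
@[simp] lemma smul_z₂ (q : ℚ) (a : A) : (q • a).z₂ = q * a.z₂ := rfl
@[simp] lemma smul_z₃ (q : ℚ) (a : A) : (q • a).z₃ = q * a.z₃ := rfl
@[simp] lemma mul_s (a b : A) : (a * b).s =
    a.s * b.s := rfl
@[simp] lemma mul_t (a b : A) : (a * b).t =
    a.s.mulVec b.t + b.z₁ • a.t := rfl
@[simp] lemma mul_u (a b : A) : (a * b).u =
    a.u * b.u := rfl
@[simp] lemma mul_v (a b : A) : (a * b).v =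
    a.u * b.v + a.v * b.z₁ := rfl
@[simp] lemma mul_w (a b : A) : (a * b).w =
    a.w * b.w := rfl
@[simp] lemma mul_x (a b : A) : (a * b).x =
    Matrix.vecMul a.x b.s + a.z₁ • b.x := rfl
@[simp] lemma mul_y (a b : A) : (a * b).y =
    a.y * b.u + a.z₁ * b.y := rfl
@[simp] lemma mul_z₁ (a b : A) : (a * b).z₁ =
    a.z₁ * b.z₁ := rfl
@[simp] lemma mul_z₂ (a b : A) : (a * b).z₂ =
    a.x ⬝ᵥ b.t - 12 * (a.y * b.v) + a.z₁ * b.z₂ + a.z₂ * b.z₁ := rfl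
@[simp] lemma mul_z₃ (a b : A) : (a * b).z₃ =
    a.y * b.v + a.z₁ * b.z₃ + a.z₃ * b.z₁ := rfl

instance : Ring A where
  add_assoc a b c := by ext1 <;> simp [add_assoc]
  zero_add a := by ext1 <;> simp
  add_zero a := by ext1 <;> simp
  add_comm a b := by ext1 <;> simp [add_comm]
  neg_add_cancel a := by ext1 <;> simp
  nsmul := nsmulRec
  zsmul := zsmulRec
  zero_mul a := by ext1 <;> simp
  mul_zero a := by ext1 <;> simp
  one_mul a := by ext1 <;> simp
  mul_one a := by ext1 <;> simp
  left_distrib a b c := by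
    ext1 <;> simp [mul_add, Matrix.mulVec_add, Matrix.vecMul_add, dotProduct_add, add_smul] <;> ring
  right_distrib a b c := by
    ext1 <;> simp [add_mul, Matrix.add_mulVec, Matrix.add_vecMul, add_dotProduct, add_smul] <;> ring
  mul_assoc a b c := by
    ext1
    case s => simp [mul_assoc]
    case t =>
      ext i
      simp [Matrix.mulVec_add, Matrix.mulVec_smul]
      ring
    case x =>
      ext i
      simp [Matrix.add_vecMul, Matrix.smul_vecMul]
      ring
    case z₂ =>
      simp [Matrix.dotProduct_mulVec, dotProduct_add, add_dotProduct]
      ring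
    all_goals simp <;> ring

instance : Module ℚ A where
  one_smul a := by ext1 <;> simp
  mul_smul p q a := by ext1 <;> simp [mul_smul, mul_assoc]
  smul_zero q := by ext1 <;> simp
  smul_add q a b := by ext1 <;> simp [mul_add]
  add_smul p q a := by ext1 <;> simp [add_smul, add_mul]
  zero_smul a := by ext1 <;> simp

instance : Algebra ℚ A := Algebra.ofModule
  (fun q a b => by
    ext1 <;> simp [Matrix.smul_mulVec, Matrix.smul_vecMul, smul_smul, mul_comm] <;> ring)
  (fun q a b => by
    ext1 <;> simp [Matrix.mulVec_smul, Matrix.vecMul_smul, smul_smul, mul_comm] <;> ring)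

end A

/-- The order `Λ₍₃₎`: all entries of the block matrix lie in `ℤ₍₃₎`, and those of the row `x` and
the coefficient of `η` are divisible by `3` in `ℤ₍₃₎`. -/
def Lambda3 : Subalgebra Z3 A where
  carrier := {a | (∀ i j, a.s i j ∈ Z3) ∧ (∀ i, a.t i ∈ Z3) ∧ a.u ∈ Z3 ∧ a.v ∈ Z3 ∧ a.w ∈ Z3 ∧
    (∀ i, a.x i ∈ threeZ3) ∧ a.y ∈ Z3 ∧ a.z₁ ∈ Z3 ∧ a.z₂ ∈ threeZ3 ∧ a.z₃ ∈ Z3}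
  add_mem' := by
    rintro a b ⟨h1, h2, h3, h4, h5, h6, h7, h8, h9, h10⟩ ⟨k1, k2, k3, k4, k5, k6, k7, k8, k9, k10⟩
    exact ⟨fun i j => add_mem (h1 i j) (k1 i j), fun i => add_mem (h2 i) (k2 i), add_mem h3 k3,
      add_mem h4 k4, add_mem h5 k5, fun i => add_mem (h6 i) (k6 i), add_mem h7 k7, add_mem h8 k8,
      add_mem h9 k9, add_mem h10 k10⟩
  mul_mem' := by
    rintro a b ⟨h1, h2, h3, h4, h5, h6, h7, h8, h9, h10⟩ ⟨k1, k2, k3, k4, k5, k6, k7, k8, k9, k10⟩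
    refine ⟨fun i j => ?_, fun i => ?_, mul_mem h3 k3, add_mem (mul_mem h3 k4) (mul_mem h4 k8),
      mul_mem h5 k5, fun i => ?_, add_mem (mul_mem h7 k3) (mul_mem h8 k7), mul_mem h8 k8,
      add_mem (add_mem (sub_mem ?_ ?_) (mul_mem_threeZ3 h8 k9)) (threeZ3_mul_mem h9 k8),
      add_mem (add_mem (mul_mem h7 k4) (mul_mem h8 k10)) (mul_mem h10 k8)⟩
    · rw [A.mul_s, Matrix.mul_apply]
      exact sum_mem fun l _ => mul_mem (h1 i l) (k1 l j)
    · have h : a.s.mulVec b.t i ∈ Z3 := by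
        rw [Matrix.mulVec, dotProduct]
        exact sum_mem fun l _ => mul_mem (h1 i l) (k2 l)
      exact add_mem h (mul_mem k8 (h2 i))
    · have h : Matrix.vecMul a.x b.s i ∈ threeZ3 := by
        rw [Matrix.vecMul, dotProduct]
        exact sum_mem fun l _ => threeZ3_mul_mem (h6 l) (k1 l i)
      exact add_mem h (mul_mem_threeZ3 h8 (k6 i))
    · exact sum_mem fun l _ => threeZ3_mul_mem (h6 l) (k2 l)
    · exact ⟨4 * (a.y * b.v), mul_mem (ofNat_mem Z3 4) (mul_mem h7 k4), by ring⟩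
  algebraMap_mem' := by
    rintro ⟨q, hq⟩
    have hval : algebraMap Z3 A ⟨q, hq⟩ = q • (1 : A) := Algebra.algebraMap_eq_smul_one (A := A) q
    rw [hval]
    refine ⟨fun i j => ?_, fun i => ?_, ?_, ?_, ?_, fun i => ?_, ?_, ?_, ?_, ?_⟩ <;>
      simp [hq, zero_mem]
    rw [Matrix.one_apply]
    split_ifs
    · simpa using hq
    · simp [zero_mem]

/-- The idempotent `e = e₃ + e₄ + e₅ + e₆` of `Λ₍₃₎`: the block matrix with diagonal entries
`0, 0, 1, 1, 1, 1` and all other entries `0`. -/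
def idem : Lambda3 :=
  ⟨⟨Matrix.diagonal ![0, 0, 1], 0, 1, 0, 1, 0, 0, 1, 0, 0⟩, by
    refine ⟨fun i j => ?_, fun i => zero_mem _, one_mem _, zero_mem _, one_mem _,
      fun i => zero_mem _, zero_mem _, one_mem _, zero_mem _, zero_mem _⟩
    fin_cases i <;> fin_cases j <;> simp [Matrix.diagonal, zero_mem, one_mem]⟩

lemma idem_isIdempotentElem : IsIdempotentElem idem := by
  refine Subtype.ext (A.ext ?_ ?_ ?_ ?_ ?_ ?_ ?_ ?_ ?_ ?_) <;> simp [idem]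
  intro i
  fin_cases i <;> simp

/-- `Λ'₍₃₎ = e Λ₍₃₎ e`, a ring with identity element `e`. -/
abbrev LambdaPrime3 : Type := idem_isIdempotentElem.Corner

section ModThree

variable (S : Type) [Ring S]

/-- The ideal `3S` of a ring `S`. -/
def threeIdeal : Ideal S := Ideal.span {3}

instance : (threeIdeal S).IsTwoSided where
  mul_mem_of_left {a} b ha := by
    obtain ⟨c, rfl⟩ := Ideal.mem_span_singleton'.1 ha
    refine Ideal.mem_span_singleton'.2 ⟨c * b, ?_⟩
    rw [mul_assoc, mul_assoc]
    exact congrArg (c * ·) (Nat.cast_commute 3 b).eq.symm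

/-- The ring `S/3S`. -/
abbrev ModThree : Type := S ⧸ threeIdeal S

lemma three_nsmul_eq_zero (x : ModThree S) : 3 • x = 0 := by
  obtain ⟨a, rfl⟩ := Ideal.Quotient.mk_surjective x
  rw [← map_nsmul, Ideal.Quotient.eq_zero_iff_mem]
  exact Ideal.mem_span_singleton'.2 ⟨a, by
    rw [nsmul_eq_mul]
    exact (Nat.cast_commute 3 a).eq.symm⟩

/-- The structure of `S/3S` as a vector space over `𝔽₃`. -/
instance : Module (ZMod 3) (ModThree S) := AddCommGroup.zmodModule (three_nsmul_eq_zero S)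

/-- The structure of `S/3S` as an algebra over `𝔽₃`. -/
instance : Algebra (ZMod 3) (ModThree S) := Algebra.ofModule
  (fun r x y => by
    obtain ⟨n, rfl⟩ := ZMod.natCast_zmod_surjective r
    rw [Nat.cast_smul_eq_nsmul, Nat.cast_smul_eq_nsmul, smul_mul_assoc])
  (fun r x y => by
    obtain ⟨n, rfl⟩ := ZMod.natCast_zmod_surjective r
    rw [Nat.cast_smul_eq_nsmul, Nat.cast_smul_eq_nsmul, mul_smul_comm])

end ModThree

end DoubleBurnside

end

namespace DoubleBurnside

/-! ### Stabilisers, marks and products of bisets -/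

namespace Biset

variable {G : Type} [Group G]

/-! A finite (G, G)-biset is a finite set with an action of G × G, so its class is a sum of classes
of transitive bisets (G × G)/L. For G = S₃ there are 22 conjugacy classes of subgroups L, and 22 is
also the dimension of A. The isomorphism is given by a table (`reps`) that assigns to each class a
matrix in Λ₍₃₎. What remains is that the assignment respects products and the unit, and that the 22
matrices form a ℤ₍₃₎-basis of Λ₍₃₎.

Products: let W(L) be |L| times the matrix of (G × G)/L. The value on a biset M is then |G|⁻² ∑
W(stab x) over x in M (`Biset.mark`), which is additive and isomorphism invariant. The stabiliser of
an orbit m ×_G n is the composition of stab m and stab n as relations on G (`stab_tpair`). Orbit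
counting therefore reduces multiplicativity to an averaged Mackey formula, a sum over g in G instead
of over double cosets (`mark_tensor`). It suffices to check that formula on representatives
(`isMultiplicative_of_reps`), which leaves 22 · 22 identities between integer vectors, evaluated on
subgroups encoded as bit masks (`weightSum_rep`). An exhaustive search certifies that no subgroup is
missing (`code_mem_allMasks`, `allMasks_subset`).

Basis: the coordinate matrix of the 22 images is integral, its inverse has entries in ¼ℤ
(`dot_rep_dual`), and 4 is a unit of ℤ₍₃₎. The 22 transitive bisets span the double Burnside algebra
over every coefficient ring (`span_cosets`), so a map that sends them to a basis is bijective. The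
same argument modulo 3 identifies the algebra over 𝔽₃ with Λ₍₃₎/3Λ₍₃₎
(`burnsideModThree_bijective`).

Morita equivalence: the full 3 × 3 matrix block makes e₁ and e₂ equivalent to e₃, so e generates the
unit ideal (`sum_mul_idem_mul`), and M ↦ eM is an equivalence for every such full corner
(`FullCorner.isMoritaEquivalent`).

Quiver: the arrows go to the off-diagonal generators of Λ'₍₃₎. The relations kill exactly the paths
with e6 in their interior, so ten paths span the quotient (`pathClass_mem_span`). Their images form
a basis of Λ'₍₃₎ over ℤ₍₃₎, hence of the reduction over 𝔽₃ (`quiverToPrime_bijective`). -/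

noncomputable instance (M : Biset G) : Fintype M.carrier := Fintype.ofFinite _

/-- The action `(g, h) • x = g x h⁻¹` of `G × G` on a `(G, G)`-biset. -/
instance prodAction (M : Biset G) : MulAction (G × G) M.carrier where
  smul p x := p.1 • MulOpposite.op p.2⁻¹ • x
  one_smul x := by
    change (1 : G) • MulOpposite.op (1 : G)⁻¹ • x = x
    simp
  mul_smul p q x := by
    change (p.1 * q.1) • MulOpposite.op (p.2 * q.2)⁻¹ • x =
      p.1 • MulOpposite.op p.2⁻¹ • q.1 • MulOpposite.op q.2⁻¹ • x
    rw [mul_inv_rev, MulOpposite.op_mul, mul_smul, mul_smul,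
      ← smul_comm q.1 (MulOpposite.op p.2⁻¹)]

lemma prod_smul_def {M : Biset G} (p : G × G) (x : M.carrier) :
    p • x = p.1 • MulOpposite.op p.2⁻¹ • x := rfl

/-- The stabiliser of `x` in `G × G`: the pairs `(g, h)` with `g x = x h`. -/
def stab {M : Biset G} (x : M.carrier) : Subgroup (G × G) := MulAction.stabilizer (G × G) x

lemma mem_stab {M : Biset G} {x : M.carrier} {p : G × G} :
    p ∈ stab x ↔ p.1 • x = MulOpposite.op p.2 • x := by
  rw [stab, MulAction.mem_stabilizer_iff, prod_smul_def, smul_comm, MulOpposite.op_inv,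
    inv_smul_eq_iff]

/-- Conjugation of subgroups of `G × G`. -/
def conj (p : G × G) (L : Subgroup (G × G)) : Subgroup (G × G) :=
  L.map (MulAut.conj p).toMonoidHom

lemma mem_conj {p q : G × G} {L : Subgroup (G × G)} : q ∈ conj p L ↔ p⁻¹ * q * p ∈ L := by
  rw [conj, Subgroup.mem_map]
  constructor
  · rintro ⟨x, hx, rfl⟩
    simpa [mul_assoc] using hx
  · intro h
    exact ⟨_, h, by simp [mul_assoc]⟩

lemma conj_mul (p q : G × G) (L : Subgroup (G × G)) : conj (p * q) L = conj p (conj q L) := by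
  ext x
  simp [mem_conj, mul_assoc]

lemma stab_smul {M : Biset G} (p : G × G) (x : M.carrier) : stab (p • x) = conj p (stab x) :=
  MulAction.stabilizer_smul_eq_stabilizer_map_conj p x

/-- The composition of two subgroups of `G × G` as relations on `G`. -/
def comp (L M : Subgroup (G × G)) : Subgroup (G × G) where
  carrier := {p | ∃ k, (p.1, k) ∈ L ∧ (k, p.2) ∈ M}
  one_mem' := ⟨1, L.one_mem, M.one_mem⟩
  mul_mem' := by
    rintro p q ⟨k, hk, hk'⟩ ⟨l, hl, hl'⟩
    exact ⟨k * l, L.mul_mem hk hl, M.mul_mem hk' hl'⟩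
  inv_mem' := by
    rintro p ⟨k, hk, hk'⟩
    exact ⟨k⁻¹, L.inv_mem hk, M.inv_mem hk'⟩

lemma mem_comp {L M : Subgroup (G × G)} {p : G × G} :
    p ∈ comp L M ↔ ∃ k, (p.1, k) ∈ L ∧ (k, p.2) ∈ M := Iff.rfl

/-- The number of `k` with `(1, k) ∈ L` and `(k, 1) ∈ M`. -/
noncomputable def overlap (L M : Subgroup (G × G)) : ℕ :=
  Nat.card {k : G // (1, k) ∈ L ∧ (k, 1) ∈ M}

/-- The orbit of `(m, n)`, as an element of the biset `M ×_G N`. -/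
def tpair {M N : Biset G} (m : M.carrier) (n : N.carrier) : (tensor M N).carrier := tmk m n

lemma tpair_eq_iff {M N : Biset G} {m m' : M.carrier} {n n' : N.carrier} :
    tpair m n = tpair m' n' ↔ ∃ g : G, m' = MulOpposite.op g⁻¹ • m ∧ n' = g • n :=
  tmk_eq_iff

lemma exists_tpair {M N : Biset G} (q : (tensor M N).carrier) : ∃ m n, q = tpair m n :=
  tmk_ind (P := fun q => ∃ m n, q = tpair m n) (fun m n => ⟨m, n, rfl⟩) q

lemma smul_tpair {M N : Biset G} (g : G) (m : M.carrier) (n : N.carrier) :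
    g • tpair m n = tpair (g • m) n := rfl

lemma op_smul_tpair {M N : Biset G} (g : Gᵐᵒᵖ) (m : M.carrier) (n : N.carrier) :
    g • tpair m n = tpair m (g • n) := rfl

/-- An element k that carries (gm, n) to (m, nh) satisfies gm = mk and kn = nh, so it is precisely
the middle term of the composed relation. -/
lemma stab_tpair {M N : Biset G} (m : M.carrier) (n : N.carrier) :
    stab (tpair m n) = comp (stab m) (stab n) := by
  ext ⟨g, h⟩
  rw [mem_stab, mem_comp, smul_tpair, op_smul_tpair, tpair_eq_iff]
  refine exists_congr fun k => and_congr ?_ ?_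
  · rw [mem_stab, MulOpposite.op_inv, eq_inv_smul_iff]
    exact eq_comm
  · rw [mem_stab]
    exact eq_comm

section Sum

/-- The elements that move (m, n) to a given point of its orbit form a coset of the stabiliser of
that point in G, and the overlap is the order of this stabiliser. -/
lemma card_fiber_tpair {M N : Biset G} (m : M.carrier) (n : N.carrier) (g : G) :
    Nat.card {a : G // MulOpposite.op a⁻¹ • m = MulOpposite.op g⁻¹ • m ∧ a • n = g • n} =
      overlap (stab (MulOpposite.op g⁻¹ • m)) (stab (g • n)) := by
  refine (Nat.card_congr (Equiv.subtypeEquiv (Equiv.mulRight g) fun k => and_congr ?_ ?_)).symm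
  · rw [mem_stab, Equiv.coe_mulRight, mul_inv_rev, MulOpposite.op_mul, mul_smul, one_smul,
      MulOpposite.op_inv k, inv_smul_eq_iff]
  · rw [mem_stab, Equiv.coe_mulRight, mul_smul, MulOpposite.op_one, one_smul]

/-- Orbit counting: the overlap of stab m and stab n is the order of the stabiliser of (m, n) in G,
so the overlaps along one orbit add up to |G|. -/
lemma sum_overlap_nsmul [Finite G] {X : Type} [AddCommGroup X] (M N : Biset G)
    (f : (tensor M N).carrier → X) :
    ∑ m : M.carrier, ∑ n : N.carrier, overlap (stab m) (stab n) • f (tpair m n) =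
      Nat.card G • ∑ q, f q := by
  classical
  let _ := Fintype.ofFinite G
  let π : M.carrier × N.carrier → (tensor M N).carrier := fun p => tpair p.1 p.2
  rw [← Fintype.sum_prod_type' (f := fun m n => overlap (stab m) (stab n) • f (tpair m n)),
    ← Finset.sum_fiberwise (s := Finset.univ) (g := π), Finset.smul_sum]
  refine Finset.sum_congr rfl fun q _ => ?_
  have h1 : ∑ p with π p = q, overlap (stab p.1) (stab p.2) • f (tpair p.1 p.2) =
      ∑ p with π p = q, overlap (stab p.1) (stab p.2) • f q := by
    refine Finset.sum_congr rfl fun p hp => ?_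
    rw [← (Finset.mem_filter.1 hp).2]
  rw [h1, ← Finset.sum_smul]
  congr 1
  obtain ⟨m, n, rfl⟩ := exists_tpair q
  rw [Nat.card_eq_fintype_card, ← Finset.card_univ]
  rw [Finset.card_eq_sum_card_fiberwise (s := Finset.univ)
    (t := Finset.univ.filter fun p => π p = tpair m n)
    (f := fun g : G => ((MulOpposite.op g⁻¹ • m, g • n) : M.carrier × N.carrier))]
  · refine Finset.sum_congr rfl ?_
    rintro ⟨m', n'⟩ hp
    obtain ⟨g, rfl, rfl⟩ := tpair_eq_iff.1 (Finset.mem_filter.1 hp).2.symm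
    rw [← card_fiber_tpair, Nat.card_eq_fintype_card, Fintype.card_subtype]
    simp only [Prod.mk.injEq]
  · intro g _
    simp only [Finset.coe_filter, Finset.mem_univ, true_and, Set.mem_ofPred_eq]
    exact (tpair_eq_iff.2 ⟨g, rfl, rfl⟩).symm

/-- For a function `W` on the subgroups of `G × G`, the sum of `W` over the stabilisers of the
elements of a biset, divided by `|G|²`. -/
noncomputable def mark {X : Type} [AddCommGroup X] [Module ℚ X] (W : Subgroup (G × G) → X)
    (M : Biset G) : X :=
  ((Nat.card G : ℚ) ^ 2)⁻¹ • ∑ x : M.carrier, W (stab x)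

/-- The compatibility of `W` with the multiplication of bisets. -/
def IsMultiplicative {X : Type} [Ring X] [Fintype G] (W : Subgroup (G × G) → X) : Prop :=
  ∀ L M, ∑ g : G, overlap L (conj (g, 1) M) • W (comp L (conj (g, 1) M)) = W L * W M

/-- Orbit counting turns the sum over M ×_G N into one over M × N; averaging over g then produces
the left-hand side of the Mackey identity for each pair (m, n). -/
lemma mark_tensor {X : Type} [Ring X] [Algebra ℚ X] [Fintype G] {W : Subgroup (G × G) → X}
    (hW : IsMultiplicative W) (M N : Biset G) :
    mark W (tensor M N) = mark W M * mark W N := by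
  have hG : (Nat.card G : ℚ) ≠ 0 := by exact_mod_cast Nat.card_pos.ne'
  have key : Nat.card G • Nat.card G • ∑ q : (tensor M N).carrier, W (stab q) =
      (∑ m : M.carrier, W (stab m)) * ∑ n : N.carrier, W (stab n) := by
    rw [← sum_overlap_nsmul M N fun q => W (stab q), Finset.sum_mul_sum, Finset.smul_sum]
    refine Finset.sum_congr rfl fun m _ => ?_
    -- For fixed g, the map n ↦ (g, 1)n permutes N and conjugates the stabilisers, so each g
    -- contributes the same sum.
    have h (g : G) : ∑ n : N.carrier, overlap (stab m) (stab n) • W (stab (tpair m n)) =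
        ∑ n : N.carrier, overlap (stab m) (conj (g, 1) (stab n)) •
          W (comp (stab m) (conj (g, 1) (stab n))) := by
      refine (Fintype.sum_equiv (MulAction.toPerm ((g, 1) : G × G)) _ _ fun n => ?_).symm
      rw [MulAction.toPerm_apply, stab_tpair, stab_smul]
    rw [← Finset.sum_congr rfl fun n _ => hW (stab m) (stab n), Finset.sum_comm,
      ← Finset.sum_congr rfl fun g _ => h g, Finset.sum_const,
      Finset.card_univ, Nat.card_eq_fintype_card]
  simp only [mark]
  rw [smul_mul_smul_comm, ← key, ← Nat.cast_smul_eq_nsmul ℚ, ← Nat.cast_smul_eq_nsmul ℚ, smul_smul,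
    smul_smul]
  congr 1
  field_simp

variable {X : Type} [AddCommGroup X] [Module ℚ X] (W : Subgroup (G × G) → X)

lemma mark_iso {M N : Biset G} (e : Iso M N) : mark W M = mark W N := by
  rw [mark, mark]
  congr 1
  refine Fintype.sum_equiv e.toEquiv _ _ fun x => congrArg W ?_
  ext p
  rw [mem_stab, mem_stab, ← e.map_left, ← e.map_right, e.toEquiv.apply_eq_iff_eq]

lemma mark_disjUnion (M N : Biset G) : mark W (M.disjUnion N) = mark W M + mark W N := by
  rw [mark, mark, mark, ← smul_add]
  congr 1
  let e : M.carrier ⊕ N.carrier ≃ (M.disjUnion N).carrier := Equiv.refl _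
  rw [← Fintype.sum_equiv e (fun x => W (stab (e x))) _ fun x => rfl, Fintype.sum_sum_type]
  congr 1
  · refine Finset.sum_congr rfl fun x _ => congrArg W ?_
    ext p
    rw [mem_stab, mem_stab]
    exact Sum.inl_injective.eq_iff (f := (Sum.inl : M.carrier → M.carrier ⊕ N.carrier))
  · refine Finset.sum_congr rfl fun x _ => congrArg W ?_
    ext p
    rw [mem_stab, mem_stab]
    exact Sum.inr_injective.eq_iff (f := (Sum.inr : N.carrier → M.carrier ⊕ N.carrier))

lemma mark_of_transitive [Finite G] (hW : ∀ p L, W (conj p L) = W L) {M : Biset G} (x : M.carrier)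
    (hx : ∀ y, ∃ p : G × G, y = p • x) :
    mark W M = ((Nat.card G : ℚ) ^ 2)⁻¹ • Nat.card M.carrier • W (stab x) := by
  have h (y : M.carrier) : W (stab y) = W (stab x) := by
    obtain ⟨p, rfl⟩ := hx y
    rw [stab_smul, hW]
  rw [mark, Finset.sum_congr rfl fun y _ => h y, Finset.sum_const, Finset.card_univ,
    ← Nat.card_eq_fintype_card]

end Sum

/-! ### Transitive bisets and the decomposition into orbits -/

section Cosets

variable (L : Subgroup (G × G))

/-- The set `(G × G)/L`. -/
def CosetCarrier (L : Subgroup (G × G)) : Type := (G × G) ⧸ L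

instance [Finite G] : Finite (CosetCarrier L) := inferInstanceAs (Finite ((G × G) ⧸ L))

instance : MulAction G (CosetCarrier L) :=
  MulAction.compHom ((G × G) ⧸ L) (MonoidHom.inl G G)

instance : MulAction Gᵐᵒᵖ (CosetCarrier L) :=
  MulAction.compHom ((G × G) ⧸ L) ((MonoidHom.inr G G).comp (MulEquiv.inv' G).symm.toMonoidHom)

/-- The coset of an element. -/
def CosetCarrier.mk (q : G × G) : CosetCarrier L := (QuotientGroup.mk q : (G × G) ⧸ L)

lemma CosetCarrier.exists_mk (y : CosetCarrier L) : ∃ q, CosetCarrier.mk L q = y :=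
  QuotientGroup.mk_surjective (s := L) y

lemma CosetCarrier.smul_mk (g : G) (q : G × G) :
    g • CosetCarrier.mk L q = CosetCarrier.mk L ((g, 1) * q) := rfl

lemma CosetCarrier.op_smul_mk (g : Gᵐᵒᵖ) (q : G × G) :
    g • CosetCarrier.mk L q = CosetCarrier.mk L ((1, (MulOpposite.unop g)⁻¹) * q) := rfl

instance : SMulCommClass G Gᵐᵒᵖ (CosetCarrier L) := ⟨fun g h x => by
  obtain ⟨q, rfl⟩ := CosetCarrier.exists_mk L x
  simp only [CosetCarrier.smul_mk, CosetCarrier.op_smul_mk, ← mul_assoc, Prod.mk_mul_mk, mul_one,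
    one_mul]⟩

/-- The transitive biset `(G × G)/L` with `g (a, b)L h = (g a, h⁻¹ b)L`. -/
def cosets [Finite G] : Biset G where
  carrier := CosetCarrier L

/-- The coset of an element. -/
def cosetMk [Finite G] (q : G × G) : (cosets L).carrier := CosetCarrier.mk L q

lemma prod_smul_cosetMk [Finite G] (p q : G × G) : p • cosetMk L q = cosetMk L (p * q) := by
  refine congrArg (CosetCarrier.mk L) ?_
  ext <;> simp

lemma exists_smul_cosetMk [Finite G] (y : (cosets L).carrier) :
    ∃ p : G × G, y = p • cosetMk L 1 := by
  obtain ⟨q, hq⟩ := CosetCarrier.exists_mk L y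
  exact ⟨q, by rw [prod_smul_cosetMk, mul_one]; exact hq.symm⟩

lemma stab_cosetMk [Finite G] : stab (cosetMk L 1) = L := by
  ext p
  rw [stab, MulAction.mem_stabilizer_iff, prod_smul_cosetMk, mul_one]
  refine QuotientGroup.eq.trans ?_
  simp

/-- By |G|² = |(G × G)/L| · |L|. This is why W has to carry the factor |L|. -/
lemma mark_cosets [Finite G] {X : Type} [AddCommGroup X] [Module ℚ X] {W : Subgroup (G × G) → X}
    (hW : ∀ p L, W (conj p L) = W L) : mark W (cosets L) = (Nat.card L : ℚ)⁻¹ • W L := by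
  have hG : (Nat.card G : ℚ) ≠ 0 := by exact_mod_cast Nat.card_pos.ne'
  have hL : (Nat.card L : ℚ) ≠ 0 := by exact_mod_cast Nat.card_pos.ne'
  have h : ((Nat.card G : ℚ) ^ 2) = Nat.card (cosets L).carrier * Nat.card L := by
    rw [sq, ← Nat.cast_mul, ← Nat.card_prod]
    exact_mod_cast L.card_eq_card_quotient_mul_card_subgroup
  have hQ : (Nat.card (cosets L).carrier : ℚ) ≠ 0 := by
    rintro h0
    rw [h0, zero_mul] at h
    exact pow_ne_zero 2 hG h
  rw [mark_of_transitive W hW (cosetMk L 1) (exists_smul_cosetMk L), stab_cosetMk, h,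
    ← Nat.cast_smul_eq_nsmul ℚ, smul_smul]
  congr 1
  field_simp

/-- The diagonal subgroup of `G × G`. -/
def diagonal (G : Type) [Group G] : Subgroup (G × G) where
  carrier := {p | p.1 = p.2}
  one_mem' := rfl
  mul_mem' := by
    rintro p q hp hq
    exact congrArg₂ (· * ·) hp hq
  inv_mem' := by
    rintro p hp
    exact congrArg (·⁻¹) hp

lemma mark_regular [Finite G] {X : Type} [AddCommGroup X] [Module ℚ X] {W : Subgroup (G × G) → X}
    (hW : ∀ p L, W (conj p L) = W L) :
    mark W (regular G) = (Nat.card G : ℚ)⁻¹ • W (diagonal G) := by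
  have hG : (Nat.card G : ℚ) ≠ 0 := by exact_mod_cast Nat.card_pos.ne'
  let o : (regular G).carrier := (1 : G)
  have hs : stab o = diagonal G := by
    ext p
    rw [mem_stab]
    change p.1 * 1 = 1 * p.2 ↔ p.1 = p.2
    rw [mul_one, one_mul]
  have ht (y : (regular G).carrier) : ∃ p : G × G, y = p • o := by
    let y' : G := y
    refine ⟨(y', 1), ?_⟩
    change y' = y' * (1 * 1⁻¹)
    simp
  have hc : (Nat.card (regular G).carrier : ℚ) = Nat.card G := rfl
  rw [mark_of_transitive W hW o ht, hs, ← Nat.cast_smul_eq_nsmul ℚ, smul_smul, hc]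
  congr 1
  field_simp

/-- The complement of an orbit of `G × G`. -/
def ComplCarrier (M : Biset G) (x : M.carrier) : Type :=
  {y : M.carrier // y ∉ MulAction.orbit (G × G) x}

section

variable (M : Biset G) (x : M.carrier)

instance : Finite (ComplCarrier M x) :=
  inferInstanceAs (Finite {y : M.carrier // y ∉ MulAction.orbit (G × G) x})

lemma smul_notMem_orbit (p : G × G) {y : M.carrier} (hy : y ∉ MulAction.orbit (G × G) x) :
    p • y ∉ MulAction.orbit (G × G) x := by
  rwa [← MulAction.orbit_eq_iff, MulAction.orbit_smul, MulAction.orbit_eq_iff]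

lemma smul_eq_prod_smul (g : G) (y : M.carrier) : g • y = ((g, 1) : G × G) • y := by
  rw [prod_smul_def]
  simp

lemma op_smul_eq_prod_smul (g : Gᵐᵒᵖ) (y : M.carrier) :
    g • y = ((1, (MulOpposite.unop g)⁻¹) : G × G) • y := by
  rw [prod_smul_def]
  simp

instance : MulAction G (ComplCarrier M x) where
  smul g y := ⟨g • y.1, by rw [smul_eq_prod_smul]; exact smul_notMem_orbit M x _ y.2⟩
  one_smul y := Subtype.ext (one_smul G y.1)
  mul_smul g h y := Subtype.ext (mul_smul g h y.1)

instance : MulAction Gᵐᵒᵖ (ComplCarrier M x) where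
  smul g y := ⟨g • y.1, by rw [op_smul_eq_prod_smul]; exact smul_notMem_orbit M x _ y.2⟩
  one_smul y := Subtype.ext (one_smul Gᵐᵒᵖ y.1)
  mul_smul g h y := Subtype.ext (mul_smul g h y.1)

instance : SMulCommClass G Gᵐᵒᵖ (ComplCarrier M x) :=
  ⟨fun g h y => Subtype.ext (smul_comm g h y.1)⟩

/-- The complement of an orbit of `G × G` in a biset. -/
def orbitCompl : Biset G where
  carrier := ComplCarrier M x

open Classical in
/-- A biset is the disjoint union of an orbit and its complement. -/
noncomputable def orbitEquiv : CosetCarrier (stab x) ⊕ ComplCarrier M x ≃ M.carrier :=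
  (Equiv.sumCongr (MulAction.orbitEquivQuotientStabilizer (G × G) x).symm
    (Equiv.refl _)).trans (Equiv.Set.sumCompl (MulAction.orbit (G × G) x))

lemma orbitEquiv_inl (q : G × G) :
    orbitEquiv M x (Sum.inl (CosetCarrier.mk (stab x) q)) = q • x :=
  MulAction.orbitEquivQuotientStabilizer_symm_apply (G × G) x q

/-- A biset is the disjoint union of an orbit and its complement. -/
noncomputable def orbitDecomposition [Finite G] :
    Iso ((cosets (stab x)).disjUnion (orbitCompl M x)) M where
  toEquiv := orbitEquiv M x
  map_left g y := by
    rcases y with y | y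
    · obtain ⟨q, rfl⟩ := CosetCarrier.exists_mk (stab x) y
      refine (orbitEquiv_inl M x ((g, 1) * q)).trans ?_
      rw [mul_smul, ← smul_eq_prod_smul]
      exact congrArg (g • ·) (orbitEquiv_inl M x q).symm
    · rfl
  map_right g y := by
    rcases y with y | y
    · obtain ⟨q, rfl⟩ := CosetCarrier.exists_mk (stab x) y
      refine (orbitEquiv_inl M x ((1, (MulOpposite.unop g)⁻¹) * q)).trans ?_
      rw [mul_smul, ← op_smul_eq_prod_smul]
      exact congrArg (g • ·) (orbitEquiv_inl M x q).symm
    · rfl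

lemma card_orbitCompl_lt [Finite G] : Nat.card (orbitCompl M x).carrier < Nat.card M.carrier := by
  have h := Nat.card_congr (orbitEquiv M x)
  rw [Nat.card_sum] at h
  have : 0 < Nat.card (CosetCarrier (stab x)) :=
    have : Nonempty (CosetCarrier (stab x)) := ⟨CosetCarrier.mk (stab x) 1⟩
    Nat.card_pos
  change Nat.card (ComplCarrier M x) < _
  omega

end

end Cosets

end Biset

end DoubleBurnside

namespace DoubleBurnside

/-! ### Generators and universal property of the double Burnside algebra -/

namespace BurnsideAlgebra

section

variable (R : Type) [CommRing R] {G : Type} [Group G] [Finite G]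

/-- The quotient map onto the double Burnside algebra. -/
noncomputable def quot (G : Type) [Group G] [Finite G] :
    MonoidAlgebra R (Shrink.{0} (BisetClass G)) →ₐ[R] BurnsideAlgebra R G :=
  RingQuot.mkAlgHom R (BurnsideRel R G)

/-- The class of a biset in the double Burnside algebra. -/
noncomputable def cls (M : Biset G) : BurnsideAlgebra R G := quot R G (freeClass R G M)

lemma cls_iso {M N : Biset G} (e : Biset.Iso M N) : cls R M = cls R N := by
  have h : BisetClass.mk M = BisetClass.mk N := Quotient.sound ⟨e⟩
  rw [cls, cls, freeClass, freeClass, h]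

lemma cls_disjUnion (M N : Biset G) : cls R (M.disjUnion N) = cls R M + cls R N :=
  (RingQuot.mkAlgHom_rel R (BurnsideRel.disjUnion M N)).trans (map_add (quot R G) _ _)

/-- An empty biset satisfies M ⊔ M ≅ M, hence [M] = 2[M]. -/
lemma cls_of_isEmpty {M : Biset G} (h : IsEmpty M.carrier) : cls R M = 0 := by
  have e : Biset.Iso (M.disjUnion M) M :=
    { toEquiv := Equiv.sumEmpty M.carrier M.carrier
      map_left := fun g x => by rcases x with x | x <;> exact (h.false x).elim
      map_right := fun g x => by rcases x with x | x <;> exact (h.false x).elim }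
  have h1 := cls_disjUnion R M M
  rwa [cls_iso R e, left_eq_add] at h1

lemma span_cls : Submodule.span R (Set.range (cls R (G := G))) = ⊤ := by
  have hq : Function.Surjective (quot R G) := RingQuot.mkAlgHom_surjective R _
  rw [eq_top_iff]
  rintro x -
  obtain ⟨x, rfl⟩ := hq x
  induction x using MonoidAlgebra.induction_on with
  | of c =>
    obtain ⟨c, rfl⟩ := (equivShrink (BisetClass G)).surjective c
    obtain ⟨M, rfl⟩ := Quotient.exists_rep c
    exact Submodule.subset_span ⟨M, rfl⟩
  | add x y hx hy =>
    rw [map_add]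
    exact add_mem hx hy
  | smul r x hx =>
    rw [map_smul]
    exact Submodule.smul_mem _ r hx

/-- The double Burnside algebra is spanned by any family of transitive bisets which contains
all of them up to isomorphism. -/
lemma span_cosets {ι : Type} (H : ι → Subgroup (G × G))
    (hH : ∀ L, ∃ p i, Biset.conj p L = H i) :
    Submodule.span R (Set.range fun i => cls R (Biset.cosets (H i))) = ⊤ := by
  rw [eq_top_iff, ← span_cls, Submodule.span_le]
  suffices h : ∀ (n : ℕ) (M : Biset G), Nat.card M.carrier = n →
      cls R M ∈ Submodule.span R (Set.range fun i => cls R (Biset.cosets (H i))) by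
    rintro _ ⟨M, rfl⟩
    exact h _ M rfl
  intro n
  induction n using Nat.strong_induction_on with
  | _ n ih =>
    intro M hM
    rcases isEmpty_or_nonempty M.carrier with hE | ⟨⟨x⟩⟩
    · rw [cls_of_isEmpty R hE]
      exact zero_mem _
    · obtain ⟨p, i, hi⟩ := hH (Biset.stab x)
      -- Moving the base point from x to p • x makes its stabiliser equal to `H i`, so the split-off
      -- orbit is `cosets (H i)` itself and conjugate coset bisets need not be compared.
      rw [← Biset.stab_smul] at hi
      rw [← cls_iso R (Biset.orbitDecomposition M (p • x)), cls_disjUnion]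
      refine add_mem ?_ (ih _ (hM ▸ Biset.card_orbitCompl_lt M (p • x)) _ rfl)
      rw [hi]
      exact Submodule.subset_span ⟨i, rfl⟩

end

section Lift

variable (R : Type) [CommRing R] {G : Type} [Group G] [Finite G] {X : Type} [Ring X] [Algebra R X]
  (f : Biset G → X) (hiso : ∀ {M N : Biset G}, Biset.Iso M N → f M = f N)
  (hone : f (Biset.regular G) = 1) (hmul : ∀ M N, f (M.tensor N) = f M * f N)
  (hadd : ∀ M N, f (M.disjUnion N) = f M + f N)

/-- A multiplicative isomorphism invariant of bisets, on isomorphism classes. -/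
def classHom : BisetClass G →* X where
  toFun := Quotient.lift f fun _ _ ⟨e⟩ => hiso e
  map_one' := hone
  map_mul' := by
    rintro ⟨M⟩ ⟨N⟩
    exact hmul M N

/-- A multiplicative isomorphism invariant of bisets, on the small model of isomorphism classes. -/
noncomputable def shrinkHom : Shrink.{0} (BisetClass G) →* X where
  toFun c := classHom f hiso hone hmul ((equivShrink _).symm c)
  map_one' := by rw [equivShrink_symm_one, map_one]
  map_mul' c d := by rw [equivShrink_symm_mul, map_mul]

/-- The algebra homomorphism on the free module on the isomorphism classes of bisets. -/
noncomputable def freeLift : MonoidAlgebra R (Shrink.{0} (BisetClass G)) →ₐ[R] X :=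
  MonoidAlgebra.lift R X _ (shrinkHom f hiso hone hmul)

lemma freeLift_freeClass (M : Biset G) :
    freeLift R f hiso hone hmul (freeClass R G M) = f M := by
  rw [freeLift, freeClass, MonoidAlgebra.lift_of]
  exact congrArg (classHom f hiso hone hmul) ((equivShrink _).symm_apply_apply _)

/-- The algebra homomorphism out of the double Burnside algebra given by an additive and
multiplicative isomorphism invariant of bisets. -/
noncomputable def lift : BurnsideAlgebra R G →ₐ[R] X :=
  RingQuot.liftAlgHom R ⟨freeLift R f hiso hone hmul, by
    rintro _ _ ⟨M, N⟩
    rw [map_add, freeLift_freeClass, freeLift_freeClass, freeLift_freeClass, hadd]⟩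

lemma lift_cls (M : Biset G) : lift R f hiso hone hmul hadd (cls R M) = f M :=
  (RingQuot.liftAlgHom_mkAlgHom_apply R _ _ _).trans (freeLift_freeClass R f hiso hone hmul M)

end Lift

lemma cls_tensor (R : Type) [CommRing R] {G : Type} [Group G] [Finite G] (M N : Biset G) :
    cls R (M.tensor N) = cls R M * cls R N := by
  rw [cls, cls, cls, ← map_mul, freeClass, freeClass, freeClass, ← map_mul, ← equivShrink_mul]
  rfl

lemma cls_regular (R : Type) [CommRing R] {G : Type} [Group G] [Finite G] :
    cls R (Biset.regular G) = 1 := by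
  have h : equivShrink _ (BisetClass.mk (Biset.regular G)) = (1 : Shrink.{0} (BisetClass G)) :=
    (equivShrink _).symm.injective
      (((equivShrink _).symm_apply_apply _).trans (equivShrink_symm_one (α := BisetClass G)).symm)
  rw [cls, freeClass, h, map_one, map_one]

end BurnsideAlgebra

end DoubleBurnside

namespace DoubleBurnside

/-! ## Integral points of the order -/

/-- Integral coordinates on the order `Λ₍₃₎`; the entries of `x` and of `z₂` are divided
by `3`. -/
structure IntA where
  s00 : ℤ
  s01 : ℤ
  s02 : ℤ
  s10 : ℤ
  s11 : ℤ
  s12 : ℤ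
  s20 : ℤ
  s21 : ℤ
  s22 : ℤ
  t0 : ℤ
  t1 : ℤ
  t2 : ℤ
  u : ℤ
  v : ℤ
  w : ℤ
  x0 : ℤ
  x1 : ℤ
  x2 : ℤ
  y : ℤ
  z1 : ℤ
  z2 : ℤ
  z3 : ℤ
  deriving DecidableEq

namespace IntA

/-- The zero element. -/
def zero : IntA := ⟨0, 0, 0, 0, 0, 0, 0, 0, 0, 0, 0, 0, 0, 0, 0, 0, 0, 0, 0, 0, 0, 0⟩

/-- The element `a + n b`. -/
def addSMul (n : ℕ) : IntA → IntA → IntA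
  | ⟨a0, a1, a2, a3, a4, a5, a6, a7, a8, a9, a10, a11, a12, a13, a14, a15, a16, a17, a18, a19,
      a20, a21⟩,
    ⟨b0, b1, b2, b3, b4, b5, b6, b7, b8, b9, b10, b11, b12, b13, b14, b15, b16, b17, b18, b19,
      b20, b21⟩ =>
    ⟨a0 + n * b0, a1 + n * b1, a2 + n * b2, a3 + n * b3, a4 + n * b4, a5 + n * b5, a6 + n * b6,
      a7 + n * b7, a8 + n * b8, a9 + n * b9, a10 + n * b10, a11 + n * b11, a12 + n * b12,
      a13 + n * b13, a14 + n * b14, a15 + n * b15, a16 + n * b16, a17 + n * b17, a18 + n * b18,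
      a19 + n * b19, a20 + n * b20, a21 + n * b21⟩

/-- The multiplication of `Λ₍₃₎` in coordinates. -/
def mul : IntA → IntA → IntA
  | ⟨a00, a01, a02, a10, a11, a12, a20, a21, a22, t0, t1, t2, u, v, w, x0, x1, x2, y, z1, z2, z3⟩,
    ⟨b00, b01, b02, b10, b11, b12, b20, b21, b22, t0', t1', t2', u', v', w', x0', x1', x2', y',
      z1', z2', z3'⟩ =>
    { s00 := a00 * b00 + a01 * b10 + a02 * b20
      s01 := a00 * b01 + a01 * b11 + a02 * b21
      s02 := a00 * b02 + a01 * b12 + a02 * b22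
      s10 := a10 * b00 + a11 * b10 + a12 * b20
      s11 := a10 * b01 + a11 * b11 + a12 * b21
      s12 := a10 * b02 + a11 * b12 + a12 * b22
      s20 := a20 * b00 + a21 * b10 + a22 * b20
      s21 := a20 * b01 + a21 * b11 + a22 * b21
      s22 := a20 * b02 + a21 * b12 + a22 * b22
      t0 := a00 * t0' + a01 * t1' + a02 * t2' + t0 * z1'
      t1 := a10 * t0' + a11 * t1' + a12 * t2' + t1 * z1'
      t2 := a20 * t0' + a21 * t1' + a22 * t2' + t2 * z1'
      u := u * u'
      v := u * v' + v * z1'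
      w := w * w'
      x0 := x0 * b00 + x1 * b10 + x2 * b20 + z1 * x0'
      x1 := x0 * b01 + x1 * b11 + x2 * b21 + z1 * x1'
      x2 := x0 * b02 + x1 * b12 + x2 * b22 + z1 * x2'
      y := y * u' + z1 * y'
      z1 := z1 * z1'
      z2 := x0 * t0' + x1 * t1' + x2 * t2' - 4 * (y * v') + z1 * z2' + z2 * z1'
      z3 := y * v' + z1 * z3' + z3 * z1' }

/-- The element of `A` with given coordinates. -/
def toA (a : IntA) : A where
  s := !![(a.s00 : ℚ), a.s01, a.s02; a.s10, a.s11, a.s12; a.s20, a.s21, a.s22]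
  t := ![(a.t0 : ℚ), a.t1, a.t2]
  u := a.u
  v := a.v
  w := a.w
  x := ![3 * (a.x0 : ℚ), 3 * a.x1, 3 * a.x2]
  y := a.y
  z₁ := a.z1
  z₂ := 3 * a.z2
  z₃ := a.z3

lemma toA_zero : toA zero = 0 := by
  refine A.ext ?_ ?_ ?_ ?_ ?_ ?_ ?_ ?_ ?_ ?_ <;> simp [toA, zero]
  · ext i j
    fin_cases i <;> fin_cases j <;> rfl

lemma toA_addSMul (n : ℕ) (a b : IntA) : toA (addSMul n a b) = toA a + n • toA b := by
  rw [← Nat.cast_smul_eq_nsmul ℚ]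
  refine A.ext ?_ ?_ ?_ ?_ ?_ ?_ ?_ ?_ ?_ ?_
  · ext i j
    fin_cases i <;> fin_cases j <;> simp [toA, addSMul]
  · ext i
    fin_cases i <;> simp [toA, addSMul]
  · simp [toA, addSMul]
  · simp [toA, addSMul]
  · simp [toA, addSMul]
  · ext i
    fin_cases i <;> simp [toA, addSMul] <;> ring
  · simp [toA, addSMul]
  · simp [toA, addSMul]
  · simp [toA, addSMul]
    ring
  · simp [toA, addSMul]

/-- Dividing both x and z₂ by 3 is consistent, because x · t contributes to z₂; the constant 12 in y
· v becomes 4. -/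
lemma toA_mul (a b : IntA) : toA (mul a b) = toA a * toA b := by
  refine A.ext ?_ ?_ ?_ ?_ ?_ ?_ ?_ ?_ ?_ ?_
  · ext i j
    fin_cases i <;> fin_cases j <;> simp [toA, mul, Matrix.mul_apply, Fin.sum_univ_three]
  · ext i
    fin_cases i <;> simp [toA, mul] <;> ring
  · simp [toA, mul]
  · simp [toA, mul]
  · simp [toA, mul]
  · ext i
    fin_cases i <;> simp [toA, mul] <;> ring
  · simp [toA, mul]
  · simp [toA, mul]
  · simp [toA, mul, dotProduct, Fin.sum_univ_three]
    ring
  · simp [toA, mul]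

end IntA

end DoubleBurnside

namespace DoubleBurnside

namespace SymThree

/-! ## Subgroups of `S₃ × S₃` as bit masks

The elements of `S₃` are numbered from `0` to `5`. A subset of `S₃ × S₃` is encoded by the number
whose bit at position `6 i + j` tells whether `(i, j)` belongs to the subset. -/

/-- The multiplication of `S₃` on numbers. -/
def mulIdx (i j : ℕ) : ℕ := (11128003707083744395924230030984 >>> (3 * (6 * i + j))) % 8

/-- The inversion of `S₃` on numbers. -/
def invIdx (i : ℕ) : ℕ := (181840 >>> (3 * i)) % 8

/-- The number of `g⁻¹ k g`. -/
def conjIdx (g k : ℕ) : ℕ := (220670793711428686115948206409352 >>> (3 * (6 * g + k))) % 8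

/-- The multiplication of `S₃ × S₃` on positions. -/
def mulPos (p q : ℕ) : ℕ := 6 * mulIdx (p / 6) (q / 6) + mulIdx (p % 6) (q % 6)

/-- The `k`-th row of a mask. -/
def row (b k : ℕ) : ℕ := (b >>> (6 * k)) % 64

/-- The union of six masks. -/
def unionSix (f : ℕ → ℕ) : ℕ := f 0 ||| f 1 ||| f 2 ||| f 3 ||| f 4 ||| f 5

/-- The mask with given rows. -/
def ofRows (f : ℕ → ℕ) : ℕ := unionSix fun i => f i <<< (6 * i)

/-- The mask of the composition of `a` and the conjugate of `b` by `(g, 1)`. -/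
def compMask (g a b : ℕ) : ℕ :=
  ofRows fun i => unionSix fun k => bif a.testBit (6 * i + k) then row b (conjIdx g k) else 0

/-- The number of `k` with `(1, k)` in `a` and `(k, 1)` in the conjugate of `b` by `(g, 1)`. -/
def overlapMask (g a b : ℕ) : ℕ :=
  (fun f : ℕ → ℕ => f 0 + f 1 + f 2 + f 3 + f 4 + f 5)
    fun k => bif a.testBit k && b.testBit (6 * conjIdx g k) then 1 else 0

/-- The mask of the conjugate of `a` by `(g, h)`. -/
def conjMask (g h a : ℕ) : ℕ :=
  ofRows fun i => unionSix fun j =>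
    bif a.testBit (6 * conjIdx g i + conjIdx h j) then 1 <<< j else 0

/-- The mask of the right translate of `a` by `p`. -/
def translate (a p : ℕ) : ℕ :=
  (List.range 36).foldr (fun q m => (bif a.testBit q then 1 <<< mulPos q p else 0) ||| m) 0

/-- The value `f n`; the case distinction makes the kernel evaluate `n` before it unfolds `f`. -/
def force {α : Type} (f : ℕ → α) (n : ℕ) : α := Nat.rec (f 0) (fun k _ => f (k + 1)) n

/-- The union of `a` and its right translates. -/
def closeStep (gens : List ℕ) (a : ℕ) : ℕ :=
  gens.foldr (fun p m => translate a p ||| m) a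

/-- The masks of the subgroups which contain the mask `a`, generated by `gens`, and do not meet the
mask `b`, where all positions outside `l` belong to `a` or to `b`. -/
def subgroupMasks : List ℕ → List ℕ → ℕ → ℕ → List ℕ
  | [], _, a, _ => [a]
  | p :: l, gens, a, b =>
    bif a.testBit p then subgroupMasks l gens a b
    else force (subgroupMasks l gens a) (b ||| 1 <<< p) ++
      force (fun c : ℕ => bif c &&& b == 0 then subgroupMasks l (p :: gens) c b else [])
        ((force (closeStep (p :: gens)))^[6] (a ||| 1 <<< p))

/-- The masks of all subgroups of `S₃ × S₃`. -/
def allMasks : List ℕ := subgroupMasks (List.range 36) [] 1 0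

/-- Representatives of the conjugacy classes of subgroups of `S₃ × S₃`: their masks, their orders,
and the images of the corresponding transitive bisets in `Λ₍₃₎`. -/
def reps : List (ℕ × ℕ × IntA) :=
  [(1, 1, ⟨6, 3, -6, 4, 2, -4, 2, 1, -2, 6, 4, 2, 0, 0, 0, 2, 1, -2, 0, 0, 2, 0⟩),
   (9, 2, ⟨3, 0, 0, 2, 0, 0, 1, 0, 0, 0, 0, 0, 0, 0, 0, 1, 0, 0, 0, 0, 0, 0⟩),
   (262145, 2, ⟨4, 2, -4, 2, 1, -2, 2, 1, -2, 4, 2, 2, 0, 0, 0, 0, 0, 0, 0, 0, 0, 0⟩),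
   (7, 3, ⟨0, 3, 0, 0, 2, 0, 0, 1, 0, 0, 0, 0, 0, 0, 0, 0, 1, 0, 0, 0, 0, 0⟩),
   (4161, 3, ⟨2, 1, -2, 4, 2, -4, 2, 1, -2, 2, 4, 2, 0, 0, 0, 0, 0, 0, 0, 0, 0, 0⟩),
   (2359305, 4, ⟨2, 0, 0, 1, 0, 0, 1, 0, 0, 0, 0, 0, 0, 0, 0, 0, 0, 0, 0, 0, 0, 0⟩),
   (63, 6, ⟨0, 0, 3, 0, 0, 2, 0, 0, 1, 0, 0, 0, 0, 0, 0, 0, 0, 1, 0, 0, 0, 0⟩),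
   (37449, 6, ⟨1, 0, 0, 2, 0, 0, 1, 0, 0, 0, 0, 0, 0, 0, 0, 0, 0, 0, 0, 0, 0, 0⟩),
   (1835015, 6, ⟨0, 2, 0, 0, 1, 0, 0, 1, 0, 0, 0, 0, 0, 0, 0, 0, 0, 0, 0, 0, 0, 0⟩),
   (1090785345, 6, ⟨2, 1, -2, 2, 1, -2, 2, 1, -2, 2, 2, 2, 0, 0, 0, 0, 0, 0, 0, 0, 0, 0⟩),
   (29127, 9, ⟨0, 1, 0, 0, 2, 0, 0, 1, 0, 0, 0, 0, 0, 0, 0, 0, 0, 0, 0, 0, 0, 0⟩),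
   (16515135, 12, ⟨0, 0, 2, 0, 0, 1, 0, 0, 1, 0, 0, 0, 0, 0, 0, 0, 0, 0, 0, 0, 0, 0⟩),
   (9817068105, 12, ⟨1, 0, 0, 1, 0, 0, 1, 0, 0, 0, 0, 0, 0, 0, 0, 0, 0, 0, 0, 0, 0, 0⟩),
   (262143, 18, ⟨0, 0, 1, 0, 0, 2, 0, 0, 1, 0, 0, 0, 0, 0, 0, 0, 0, 0, 0, 0, 0, 0⟩),
   (7635497415, 18, ⟨0, 1, 0, 0, 1, 0, 0, 1, 0, 0, 0, 0, 0, 0, 0, 0, 0, 0, 0, 0, 0, 0⟩),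
   (68719476735, 36, ⟨0, 0, 1, 0, 0, 1, 0, 0, 1, 0, 0, 0, 0, 0, 0, 0, 0, 0, 0, 0, 0, 0⟩),
   (2097153, 2, ⟨3, 1, -2, 2, 1, -2, 1, 0, 0, 2, 2, 0, 1, 0, 0, 1, 1, -2, 0, 0, 2, 0⟩),
   (8449, 3, ⟨2, 1, -2, 0, 2, 0, 0, 1, 0, 2, 0, 0, 0, 0, 2, 1, 0, -1, 0, 0, 1, 0⟩),
   (14680071, 6, ⟨0, 1, 1, 0, 1, 0, 0, 0, 1, 0, 0, 0, 1, 1, 0, 0, 1, -1, 0, 0, 0, 0⟩),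
   (8726253633, 6, ⟨1, 0, 0, 2, 1, -2, 1, 0, 0, 0, 2, 0, 1, 0, 0, 0, 0, 0, 1, 0, 0, 0⟩),
   (8866767105, 6, ⟨1, 0, 0, 0, 1, 0, 0, 0, 1, 0, 0, 0, 1, 0, 1, 0, 0, 0, 0, 1, 0, 0⟩),
   (61083775431, 18, ⟨0, 0, 1, 0, 1, 0, 0, 0, 1, 0, 0, 0, 1, 1, 0, 0, 0, 0, 1, 0, -4, 1⟩)]

/-- The number of the conjugacy class of each subgroup of `S₃ × S₃`. -/
def classTable : List (ℕ × ℕ) :=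
  [(1, 0), (7, 3), (9, 1), (17, 1), (33, 1), (63, 6), (4161, 4), (8449, 17), (16513, 17), (29127,
    10), (37449, 7), (70737, 7), (137313, 7), (262143, 13), (262145, 2), (1835015, 8), (2097153,
    16), (2359305, 5), (4194305, 16), (4456465, 5), (8388609, 16), (8650785, 5), (14680071, 18),
    (16515135, 11), (16777217, 2), (117440519, 8), (134217729, 16), (150994953, 5), (268435457,
    16), (285212689, 5), (536870913, 16), (553648161, 5), (939524103, 18), (1056964671, 11),
    (1073741825, 2), (1090785345, 9), (7516192775, 8), (7635497415, 14), (8589934593, 16),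
    (8726253633, 19), (8866767105, 20), (9131016321, 20), (9663676425, 5), (9817068105, 12),
    (17179869185, 16), (17322492033, 20), (17452503105, 19), (17718845697, 20), (18253611025, 5),
    (18543350865, 12), (34359738369, 16), (34498158849, 20), (34630287489, 20), (34905002049, 19),
    (35433480225, 5), (35995916385, 12), (60129542151, 18), (61083775431, 21), (67645734975, 11),
    (68719476735, 15)]

/-- The mask, the order, and the image in `Λ₍₃₎` of the `i`-th representative. -/
def rep (i : ℕ) : ℕ × ℕ × IntA := reps.getD i (0, 0, IntA.zero)

/-- The number of the conjugacy class of a subgroup. -/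
def classOf (a : ℕ) : ℕ := (classTable.lookup a).getD 22

/-- The order of a subgroup times the image of the corresponding transitive biset. -/
def weight (a : ℕ) : IntA := IntA.addSMul (rep (classOf a)).2.1 IntA.zero (rep (classOf a)).2.2

/-- The sum over `g` of the weights of the compositions, multiplied with the overlaps. -/
def weightSum (a b : ℕ) : IntA :=
  (List.range 6).foldr
    (fun g m => IntA.addSMul (overlapMask g a b) m (weight (compMask g a b))) IntA.zero

end SymThree

end DoubleBurnside

namespace DoubleBurnside

/-! ### Numbering S₃ and S₃ × S₃ -/

namespace SymThree

/-- The elements of `S₃`. -/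
def perm : ℕ → Equiv.Perm (Fin 3)
  | 0 => 1
  | 1 => finRotate 3
  | 2 => finRotate 3 * finRotate 3
  | 3 => Equiv.swap 0 1
  | 4 => Equiv.swap 1 2
  | _ => Equiv.swap 0 2

/-- The number of an element of `S₃`. -/
def idx (g : Equiv.Perm (Fin 3)) : ℕ :=
  if g 0 = 0 then if g 1 = 1 then 0 else 4
  else if g 0 = 1 then if g 1 = 2 then 1 else 3
  else if g 1 = 0 then 2 else 5

lemma idx_lt (g : Equiv.Perm (Fin 3)) : idx g < 6 := by
  unfold idx
  split_ifs <;> norm_num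

lemma perm_idx : ∀ g : Equiv.Perm (Fin 3), perm (idx g) = g := by decide +kernel

lemma idx_perm : ∀ i < 6, idx (perm i) = i := by decide +kernel

lemma idx_one : idx 1 = 0 := idx_perm 0 (by norm_num)

/-- The numeral in `mulIdx` is the multiplication table of S₃ with three bits per entry. Its
correctness rests on this check alone, as that of `invIdx` and `conjIdx` does on the next two. -/
lemma idx_mul : ∀ g h : Equiv.Perm (Fin 3), idx (g * h) = mulIdx (idx g) (idx h) := by
  decide +kernel

lemma idx_inv : ∀ g : Equiv.Perm (Fin 3), idx g⁻¹ = invIdx (idx g) := by decide +kernel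

lemma idx_conj : ∀ g k : Equiv.Perm (Fin 3), idx (g⁻¹ * k * g) = conjIdx (idx g) (idx k) := by
  decide +kernel

lemma sum_perm {X : Type} [AddCommMonoid X] (f : Equiv.Perm (Fin 3) → X) :
    ∑ g, f g = ∑ i ∈ Finset.range 6, f (perm i) := by
  refine Finset.sum_bij' (fun g _ => idx g) (fun i _ => perm i)
    (fun g _ => Finset.mem_range.2 (idx_lt g)) (fun _ _ => Finset.mem_univ _)
    (fun g _ => perm_idx g) (fun i hi => idx_perm i (Finset.mem_range.1 hi)) fun g _ => ?_
  rw [perm_idx]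

/-- The position of an element of `S₃ × S₃`. -/
def pos (p : Equiv.Perm (Fin 3) × Equiv.Perm (Fin 3)) : ℕ := 6 * idx p.1 + idx p.2

lemma pos_lt (p : Equiv.Perm (Fin 3) × Equiv.Perm (Fin 3)) : pos p < 36 := by
  have h1 := idx_lt p.1
  have h2 := idx_lt p.2
  unfold pos
  omega

lemma pos_div (p : Equiv.Perm (Fin 3) × Equiv.Perm (Fin 3)) : pos p / 6 = idx p.1 := by
  have h2 := idx_lt p.2
  unfold pos
  omega

lemma pos_mod (p : Equiv.Perm (Fin 3) × Equiv.Perm (Fin 3)) : pos p % 6 = idx p.2 := by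
  have h2 := idx_lt p.2
  unfold pos
  omega

/-- The element of `S₃ × S₃` at a given position. -/
def elt (n : ℕ) : Equiv.Perm (Fin 3) × Equiv.Perm (Fin 3) := (perm (n / 6), perm (n % 6))

lemma elt_pos (p : Equiv.Perm (Fin 3) × Equiv.Perm (Fin 3)) : elt (pos p) = p := by
  rw [elt, pos_div, pos_mod, perm_idx, perm_idx]

lemma pos_elt {n : ℕ} (hn : n < 36) : pos (elt n) = n := by
  rw [pos, elt, idx_perm _ (by omega), idx_perm _ (by omega)]
  omega

lemma pos_mul (p q : Equiv.Perm (Fin 3) × Equiv.Perm (Fin 3)) :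
    pos (p * q) = mulPos (pos p) (pos q) := by
  rw [mulPos, pos_div, pos_div, pos_mod, pos_mod, pos, Prod.fst_mul, Prod.snd_mul, idx_mul, idx_mul]

/-! ### Bits of masks -/

lemma testBit_unionSix (f : ℕ → ℕ) (n : ℕ) :
    (unionSix f).testBit n = true ↔ ∃ i < 6, (f i).testBit n = true := by
  simp only [unionSix, Nat.testBit_or, Bool.or_eq_true]
  constructor
  · rintro (((((h | h) | h) | h) | h) | h)
    exacts [⟨0, by norm_num, h⟩, ⟨1, by norm_num, h⟩, ⟨2, by norm_num, h⟩, ⟨3, by norm_num, h⟩,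
      ⟨4, by norm_num, h⟩, ⟨5, by norm_num, h⟩]
  · rintro ⟨i, hi, h⟩
    interval_cases i <;> simp [h]

/-- The hypothesis keeps every row within six bits, so that shifted rows do not run into each other.
-/
lemma testBit_ofRows {f : ℕ → ℕ} (hf : ∀ i, ∀ j, (f i).testBit j = true → j < 6) (n : ℕ) :
    (ofRows f).testBit n = true ↔ n < 36 ∧ (f (n / 6)).testBit (n % 6) = true := by
  rw [ofRows, testBit_unionSix]
  simp only [Nat.testBit_shiftLeft, Bool.and_eq_true, decide_eq_true_eq]
  constructor
  · rintro ⟨i, hi, h1, h2⟩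
    have h3 := hf _ _ h2
    have h4 : n / 6 = i := by omega
    have h5 : n % 6 = n - 6 * i := by omega
    rw [h4, h5]
    exact ⟨by omega, h2⟩
  · rintro ⟨hn, h⟩
    have h5 : n - 6 * (n / 6) = n % 6 := by omega
    exact ⟨n / 6, by omega, by omega, h5 ▸ h⟩

lemma testBit_row (b k j : ℕ) :
    (row b k).testBit j = true ↔ j < 6 ∧ b.testBit (6 * k + j) = true := by
  rw [row, show 64 = 2 ^ 6 by norm_num, Nat.testBit_mod_two_pow, Nat.testBit_shiftRight]
  simp

lemma testBit_compMask (g a b n : ℕ) : (compMask g a b).testBit n = true ↔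
    n < 36 ∧ ∃ k < 6, a.testBit (6 * (n / 6) + k) = true ∧
      b.testBit (6 * conjIdx g k + n % 6) = true := by
  have h (i j : ℕ) : (unionSix fun k => bif a.testBit (6 * i + k) then
      row b (conjIdx g k) else 0).testBit j = true ↔
      j < 6 ∧ ∃ k < 6, a.testBit (6 * i + k) = true ∧ b.testBit (6 * conjIdx g k + j) = true := by
    rw [testBit_unionSix]
    constructor
    · rintro ⟨k, hk, h⟩
      cases ha : a.testBit (6 * i + k)
      · simp [ha] at h
      · rw [ha, cond_true, testBit_row] at h
        exact ⟨h.1, k, hk, ha, h.2⟩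
    · rintro ⟨hj, k, hk, ha, hb⟩
      exact ⟨k, hk, by rw [ha, cond_true, testBit_row]; exact ⟨hj, hb⟩⟩
  rw [compMask, testBit_ofRows fun i j hj => ((h i j).1 hj).1, h]
  refine and_congr_right fun _ => and_iff_right (by omega)

lemma testBit_conjMask (g h a n : ℕ) : (conjMask g h a).testBit n = true ↔
    n < 36 ∧ a.testBit (6 * conjIdx g (n / 6) + conjIdx h (n % 6)) = true := by
  have h (i j : ℕ) : (unionSix fun j => bif a.testBit (6 * conjIdx g i + conjIdx h j) then
      1 <<< j else 0).testBit j = true ↔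
      j < 6 ∧ a.testBit (6 * conjIdx g i + conjIdx h j) = true := by
    rw [testBit_unionSix]
    constructor
    · rintro ⟨k, hk, h1⟩
      cases ha : a.testBit (6 * conjIdx g i + conjIdx h k)
      · simp [ha] at h1
      · rw [ha, cond_true, Nat.one_shiftLeft, Nat.testBit_two_pow, decide_eq_true_eq] at h1
        exact h1 ▸ ⟨hk, ha⟩
    · rintro ⟨hj, ha⟩
      exact ⟨j, hj, by rw [ha, cond_true, Nat.one_shiftLeft, Nat.testBit_two_pow_self]⟩
  rw [conjMask, testBit_ofRows fun i j hj => ((h i j).1 hj).1, h]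
  refine and_congr_right fun _ => and_iff_right (by omega)

/-! ### Masks of subgroups -/

open Classical in
/-- The mask of a subgroup. -/
noncomputable def code (L : Subgroup (Equiv.Perm (Fin 3) × Equiv.Perm (Fin 3))) : ℕ :=
  Nat.ofBits fun n : Fin 36 => decide (elt n ∈ L)

variable {L M : Subgroup (Equiv.Perm (Fin 3) × Equiv.Perm (Fin 3))}

lemma testBit_code (n : ℕ) : (code L).testBit n = true ↔ n < 36 ∧ elt n ∈ L := by
  classical
  by_cases hn : n < 36
  · rw [code, Nat.testBit_ofBits_lt _ _ hn]
    simp [hn]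
  · rw [code, Nat.testBit_ofBits_ge _ _ (not_lt.1 hn)]
    simp [hn]

lemma testBit_code_pos (p : Equiv.Perm (Fin 3) × Equiv.Perm (Fin 3)) :
    (code L).testBit (pos p) = true ↔ p ∈ L := by
  rw [testBit_code, elt_pos]
  exact and_iff_right (pos_lt p)

lemma code_eq_of_testBit {a : ℕ} (h : ∀ n, a.testBit n = true ↔ n < 36 ∧ elt n ∈ L) :
    code L = a :=
  Nat.eq_of_testBit_eq fun n => Bool.eq_iff_iff.2 ((testBit_code n).trans (h n).symm)

lemma code_injective (h : code L = code M) : L = M := by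
  ext p
  rw [← testBit_code_pos, h, testBit_code_pos]

/-- Since (k, j) lies in the conjugate of M by (g, 1) exactly when (g⁻¹kg, j) lies in M, conjugation
only permutes the rows of the mask. -/
lemma code_comp (g : Equiv.Perm (Fin 3)) :
    code (Biset.comp L (Biset.conj (g, 1) M)) = compMask (idx g) (code L) (code M) := by
  refine code_eq_of_testBit fun n => ?_
  rw [testBit_compMask]
  refine and_congr_right fun hn => ?_
  have h1 : idx (elt n).1 = n / 6 := by rw [elt, idx_perm _ (by omega)]
  have h2 : idx (elt n).2 = n % 6 := by rw [elt, idx_perm _ (by omega)]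
  rw [Biset.mem_comp]
  constructor
  · rintro ⟨k, hk, ha, hb⟩
    refine ⟨perm k, ?_, ?_⟩
    · rw [← testBit_code_pos, pos, h1, idx_perm k hk]
      exact ha
    · rw [Biset.mem_conj, ← testBit_code_pos, pos]
      simp only [Prod.fst_mul, Prod.snd_mul, Prod.fst_inv, Prod.snd_inv, inv_one, one_mul, mul_one,
        idx_conj, idx_perm k hk, h2]
      exact hb
  · rintro ⟨k, ha, hb⟩
    refine ⟨idx k, idx_lt k, ?_, ?_⟩
    · rw [← testBit_code_pos, pos, h1] at ha
      exact ha
    · rw [Biset.mem_conj, ← testBit_code_pos, pos] at hb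
      simpa only [Prod.fst_mul, Prod.snd_mul, Prod.fst_inv, Prod.snd_inv, inv_one, one_mul, mul_one,
        idx_conj, h2] using hb

lemma code_conj (p : Equiv.Perm (Fin 3) × Equiv.Perm (Fin 3)) :
    code (Biset.conj p L) = conjMask (idx p.1) (idx p.2) (code L) := by
  refine code_eq_of_testBit fun n => ?_
  rw [testBit_conjMask]
  refine and_congr_right fun hn => ?_
  have h1 : idx (elt n).1 = n / 6 := by rw [elt, idx_perm _ (by omega)]
  have h2 : idx (elt n).2 = n % 6 := by rw [elt, idx_perm _ (by omega)]
  rw [Biset.mem_conj, ← testBit_code_pos, pos]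
  simp only [Prod.fst_mul, Prod.snd_mul, Prod.fst_inv, Prod.snd_inv, idx_conj, h1, h2]

/-- The identity has number 0, so (1, k) sits at position k and (k, 1) at position 6k. -/
lemma overlap_eq (g : Equiv.Perm (Fin 3)) :
    Biset.overlap L (Biset.conj (g, 1) M) = overlapMask (idx g) (code L) (code M) := by
  classical
  have h (k : Equiv.Perm (Fin 3)) : (bif (code L).testBit (idx k) &&
      (code M).testBit (6 * conjIdx (idx g) (idx k)) then 1 else 0) =
      if (1, k) ∈ L ∧ (k, 1) ∈ Biset.conj (g, 1) M then 1 else 0 := by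
    have h1 : (code L).testBit (idx k) = true ↔ (1, k) ∈ L := by
      rw [← testBit_code_pos, pos, idx_one, mul_zero, zero_add]
    have h2 : (code M).testBit (6 * conjIdx (idx g) (idx k)) = true ↔
        (k, 1) ∈ Biset.conj (g, 1) M := by
      rw [Biset.mem_conj, ← testBit_code_pos, pos, ← idx_conj]
      simp only [Prod.fst_mul, Prod.snd_mul, Prod.fst_inv, Prod.snd_inv, inv_one, one_mul, idx_one,
        add_zero]
    rw [cond_eq_ite]
    refine if_congr ?_ rfl rfl
    rw [← h1, ← h2, Bool.and_eq_true]
  rw [Biset.overlap, Nat.card_eq_fintype_card, Fintype.card_subtype, Finset.card_filter,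
    ← Finset.sum_congr rfl fun k _ => h k, sum_perm]
  simp only [Finset.sum_range_succ, Finset.sum_range_zero, zero_add, overlapMask,
    idx_perm 0 (by norm_num), idx_perm 1 (by norm_num), idx_perm 2 (by norm_num),
    idx_perm 3 (by norm_num), idx_perm 4 (by norm_num), idx_perm 5 (by norm_num)]

end SymThree

end DoubleBurnside

namespace DoubleBurnside

namespace SymThree

/-! ### Enumeration of the subgroups -/

lemma force_eq {α : Type} (f : ℕ → α) (n : ℕ) : force f n = f n := by
  cases n <;> rfl

lemma testBit_foldr_or {α : Type} (l : List α) (f : α → ℕ) (a n : ℕ) :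
    (l.foldr (fun q m => f q ||| m) a).testBit n = true ↔
      (∃ q ∈ l, (f q).testBit n = true) ∨ a.testBit n = true := by
  induction l with
  | nil => simp
  | cons q l ih =>
    rw [List.foldr_cons, Nat.testBit_or, Bool.or_eq_true, ih]
    simp [or_assoc]

lemma testBit_translate {a p n : ℕ} (h : (translate a p).testBit n = true) :
    ∃ q < 36, a.testBit q = true ∧ n = mulPos q p := by
  rw [translate, testBit_foldr_or (f := fun q => bif a.testBit q then 1 <<< mulPos q p else 0)] at h
  rcases h with ⟨q, hq, h⟩ | h
  · cases ha : a.testBit q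
    · simp [ha] at h
    · rw [ha, cond_true, Nat.one_shiftLeft, Nat.testBit_two_pow, decide_eq_true_eq] at h
      exact ⟨q, List.mem_range.1 hq, ha, h.symm⟩
  · simp at h

variable {H : Subgroup (Equiv.Perm (Fin 3) × Equiv.Perm (Fin 3))}

lemma testBit_code_mulPos {p q : ℕ} (hp : (code H).testBit p = true)
    (hq : (code H).testBit q = true) : (code H).testBit (mulPos p q) = true := by
  rw [testBit_code] at hp hq
  rw [← pos_elt hp.1, ← pos_elt hq.1, ← pos_mul, testBit_code_pos]
  exact H.mul_mem hp.2 hq.2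

lemma closeStep_le {gens : List ℕ} {a : ℕ} (hg : ∀ p ∈ gens, (code H).testBit p = true)
    (ha : ∀ n, a.testBit n = true → (code H).testBit n = true) (n : ℕ)
    (h : (closeStep gens a).testBit n = true) : (code H).testBit n = true := by
  rw [closeStep, testBit_foldr_or (f := translate a)] at h
  rcases h with ⟨p, hp, h⟩ | h
  · obtain ⟨q, -, hq, rfl⟩ := testBit_translate h
    exact testBit_code_mulPos (ha q hq) (hg p hp)
  · exact ha n h

/-- Only this inclusion is needed, not that the iteration reaches the generated subgroup: an
incomplete closure could at worst add candidates to the list, and every candidate is tested in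
`allMasks_subset`. -/
lemma iterate_closeStep_le {gens : List ℕ} (hg : ∀ p ∈ gens, (code H).testBit p = true) (k : ℕ) :
    ∀ a : ℕ, (∀ n, a.testBit n = true → (code H).testBit n = true) → ∀ n,
      ((force (closeStep gens))^[k] a).testBit n = true → (code H).testBit n = true := by
  induction k with
  | zero => exact fun a ha => ha
  | succ k ih =>
    intro a ha n h
    rw [Function.iterate_succ_apply, force_eq] at h
    exact ih _ (closeStep_le hg ha) n h

lemma le_closeStep (gens : List ℕ) {a n : ℕ} (h : a.testBit n = true) :
    (closeStep gens a).testBit n = true := by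
  rw [closeStep, testBit_foldr_or (f := translate a)]
  exact Or.inr h

lemma le_iterate_closeStep (gens : List ℕ) (k : ℕ) : ∀ {a n : ℕ}, a.testBit n = true →
    ((force (closeStep gens))^[k] a).testBit n = true := by
  induction k with
  | zero => exact fun h => h
  | succ k ih =>
    intro a n h
    rw [Function.iterate_succ_apply, force_eq]
    exact ih (le_closeStep gens h)

/-- Follow the branch of the search that decides each position p as H does. The invariant is that a
lies in H, b is disjoint from H, and all undecided positions are in l; at a leaf nothing is
undecided and a is the mask of H. -/
lemma code_mem_subgroupMasks (l : List ℕ) : ∀ (gens : List ℕ) (a b : ℕ),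
    (∀ n, a.testBit n = true → (code H).testBit n = true) →
    (∀ p ∈ gens, (code H).testBit p = true) →
    (∀ n, b.testBit n = true → (code H).testBit n = false) →
    (∀ n < 36, n ∉ l → a.testBit n = true ∨ b.testBit n = true) →
    code H ∈ subgroupMasks l gens a b := by
  induction l with
  | nil =>
    intro gens a b ha _ hb hab
    rw [subgroupMasks, List.mem_singleton]
    refine Nat.eq_of_testBit_eq fun n => Bool.eq_iff_iff.2 ⟨fun h => ?_, ha n⟩
    refine (hab n ((testBit_code n).1 h).1 List.not_mem_nil).resolve_right fun h' => ?_
    simp [hb n h'] at h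
  | cons p l ih =>
    intro gens a b ha hg hb hab
    rw [subgroupMasks]
    cases hp : a.testBit p
    · rw [cond_false, force_eq, force_eq, List.mem_append]
      cases hH : (code H).testBit p
      · refine Or.inl (ih gens a _ ha hg (fun n h => ?_) fun n hn hl => ?_)
        · rw [Nat.testBit_or, Bool.or_eq_true, Nat.one_shiftLeft, Nat.testBit_two_pow,
            decide_eq_true_eq] at h
          rcases h with h | rfl
          exacts [hb n h, hH]
        · rw [Nat.testBit_or, Bool.or_eq_true, Nat.one_shiftLeft, Nat.testBit_two_pow,
            decide_eq_true_eq]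
          by_cases hnp : p = n
          · exact Or.inr (Or.inr hnp)
          · rcases hab n hn (by simp [hl, Ne.symm hnp]) with h | h
            exacts [Or.inl h, Or.inr (Or.inl h)]
      · have hg' : ∀ q ∈ p :: gens, (code H).testBit q = true := by
          simpa [hH] using hg
        have ha' (n : ℕ) (h : (a ||| 1 <<< p).testBit n = true) :
            (code H).testBit n = true := by
          rw [Nat.testBit_or, Bool.or_eq_true, Nat.one_shiftLeft, Nat.testBit_two_pow,
            decide_eq_true_eq] at h
          rcases h with h | rfl
          exacts [ha n h, hH]
        have hc := iterate_closeStep_le hg' 6 _ ha'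
        have hc' := fun n => le_iterate_closeStep (p :: gens) 6 (a := a ||| 1 <<< p) (n := n)
        generalize (force (closeStep (p :: gens)))^[6] (a ||| 1 <<< p) = c at hc hc' ⊢
        -- The branch is not pruned, since the closure c stays inside H while b avoids H.
        have hcb : c &&& b = 0 := by
          refine Nat.eq_of_testBit_eq fun n => ?_
          rw [Nat.testBit_and, Nat.zero_testBit]
          cases h1 : c.testBit n
          · rfl
          · cases h2 : b.testBit n
            · rfl
            · exact (hc n h1).symm.trans (hb n h2)
        rw [hcb, beq_self_eq_true, cond_true]
        refine Or.inr (ih (p :: gens) c b hc hg' hb fun n hn hl => ?_)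
        by_cases hnp : n = p
        · refine Or.inl (hc' n ?_)
          rw [hnp, Nat.testBit_or, Bool.or_eq_true, Nat.one_shiftLeft, Nat.testBit_two_pow_self]
          exact Or.inr rfl
        · rcases hab n hn (by simp [hl, hnp]) with h | h
          · exact Or.inl (hc' n (by rw [Nat.testBit_or, h, Bool.true_or]))
          · exact Or.inr h
    · rw [cond_true]
      refine ih gens a b ha hg hb fun n hn hl => ?_
      by_cases hnp : n = p
      · exact Or.inl (hnp ▸ hp)
      · exact hab n hn (by simp [hl, hnp])

lemma code_mem_allMasks : code H ∈ allMasks := by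
  refine code_mem_subgroupMasks _ _ _ _ (fun n h => ?_) (by simp) (by simp) fun n hn h => ?_
  · have h0 : n = 0 := by
      rw [show 1 = 2 ^ 0 by norm_num, Nat.testBit_two_pow, decide_eq_true_eq] at h
      exact h.symm
    rw [h0, testBit_code]
    exact ⟨by norm_num, H.one_mem⟩
  · exact absurd (List.mem_range.2 hn) h

set_option maxRecDepth 10000 in
-- The kernel runs the whole search here; it follows that the table misses no subgroup.
lemma allMasks_subset :
    (allMasks.all fun a => (classTable.map Prod.fst).contains a) = true := by decide +kernel

lemma code_mem_classTable : code H ∈ classTable.map Prod.fst := by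
  have h := List.all_eq_true.1 allMasks_subset _ (code_mem_allMasks (H := H))
  exact List.contains_iff_mem.1 h

/-- Makes the weight a class function. Conjugation by all 36 elements of S₃ × S₃ is tested. -/
lemma classOf_conjMask : ((classTable.map Prod.fst).all fun a => (List.range 6).all fun g =>
    (List.range 6).all fun h => classOf (conjMask g h a) == classOf a) = true := by
  decide +kernel

lemma exists_conjMask : ((classTable.map Prod.fst).all fun a => (List.range 6).any fun g =>
    (List.range 6).any fun h => conjMask g h a == (rep (classOf a)).1) = true := by
  decide +kernel

/-- The number 22 is the default value of `classOf` for masks outside the table, so this excludes it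
for listed masks. -/
lemma classOf_lt : ((classTable.map Prod.fst).all fun a => Nat.blt (classOf a) 22) = true := by
  decide +kernel

/-- The computational core of multiplicativity: the averaged Mackey identity for every pair of
representatives, as an exact identity of integer vectors. -/
lemma weightSum_rep : ((List.range 22).all fun i => (List.range 22).all fun j =>
    decide (weightSum (rep i).1 (rep j).1 = IntA.mul (weight (rep i).1) (weight (rep j).1))) =
    true := by
  decide +kernel

lemma rep_closed : ((List.range 22).all fun i => (rep i).1.testBit 0 &&
    (List.range 36).all fun p => bif (rep i).1.testBit p then
      (rep i).1.testBit (6 * invIdx (p / 6) + invIdx (p % 6)) &&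
      ((List.range 36).all fun q => bif (rep i).1.testBit q then (rep i).1.testBit (mulPos p q)
        else true) else true) = true := by
  decide +kernel

lemma rep_lt : ((List.range 22).all fun i => Nat.blt (rep i).1 (2 ^ 36)) = true := by
  decide +kernel

lemma rep_card : ((List.range 22).all fun i =>
    ((List.range 36).filter (rep i).1.testBit).length == (rep i).2.1) = true := by
  decide +kernel

lemma classOf_rep : ((List.range 22).all fun i => classOf (rep i).1 == i) = true := by
  decide +kernel

end SymThree

end DoubleBurnside

namespace DoubleBurnside

/-! ### Representatives of the conjugacy classes and their weights -/

namespace SymThree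

/-- The subgroup of `S₃ × S₃` which represents the `i`-th conjugacy class. -/
def repSub (i : Fin 22) : Subgroup (Equiv.Perm (Fin 3) × Equiv.Perm (Fin 3)) :=
  have key := List.all_eq_true.1 rep_closed i (List.mem_range.2 i.2)
  have key1 := (Bool.and_eq_true _ _ ▸ key).1
  have key2 (p : Equiv.Perm (Fin 3) × Equiv.Perm (Fin 3))
      (hp : (rep i).1.testBit (pos p) = true) : (rep i).1.testBit (pos p⁻¹) = true ∧
      ∀ q, (rep i).1.testBit (pos q) = true → (rep i).1.testBit (pos (p * q)) = true := by
    have h := List.all_eq_true.1 (Bool.and_eq_true _ _ ▸ key).2 (pos p)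
      (List.mem_range.2 (pos_lt p))
    rw [hp, cond_true, Bool.and_eq_true, pos_div, pos_mod, ← idx_inv, ← idx_inv] at h
    refine ⟨h.1, fun q hq => ?_⟩
    have h' := List.all_eq_true.1 h.2 (pos q) (List.mem_range.2 (pos_lt q))
    rwa [hq, cond_true, ← pos_mul] at h'
  { carrier := {p | (rep i).1.testBit (pos p) = true}
    one_mem' := key1
    mul_mem' := fun {p q} hp hq => (key2 p hp).2 q hq
    inv_mem' := fun {p} hp => (key2 p hp).1 }

lemma mem_repSub {i : Fin 22} {p : Equiv.Perm (Fin 3) × Equiv.Perm (Fin 3)} :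
    p ∈ repSub i ↔ (rep i).1.testBit (pos p) = true := Iff.rfl

lemma code_repSub (i : Fin 22) : code (repSub i) = (rep i).1 := by
  refine code_eq_of_testBit fun n => ?_
  have h : (rep i).1 < 2 ^ 36 :=
    Nat.blt_eq.mp (List.all_eq_true.1 rep_lt i (List.mem_range.2 i.2))
  constructor
  · intro hn
    have h36 : n < 36 := by
      by_contra hlt
      rw [Nat.testBit_lt_two_pow (h.trans_le (Nat.pow_le_pow_right (by norm_num)
        (not_lt.1 hlt)))] at hn
      exact Bool.false_ne_true hn
    exact ⟨h36, by rw [mem_repSub, pos_elt h36]; exact hn⟩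
  · rintro ⟨h36, hn⟩
    rwa [mem_repSub, pos_elt h36] at hn

open Classical in
lemma card_repSub (i : Fin 22) : Nat.card (repSub i) = (rep i).2.1 := by
  have h := List.all_eq_true.1 rep_card i (List.mem_range.2 i.2)
  rw [← beq_iff_eq.1 h]
  have hl : ((List.range 36).filter (rep i).1.testBit).Nodup := List.nodup_range.filter _
  rw [← List.toFinset_card_of_nodup hl, Nat.card_eq_fintype_card, Fintype.card_subtype]
  refine Finset.card_bij' (fun p _ => pos p) (fun n _ => elt n) (fun p hp => ?_) (fun n hn => ?_)
    (fun p _ => elt_pos p) fun n hn => ?_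
  · rw [List.mem_toFinset, List.mem_filter, List.mem_range]
    exact ⟨pos_lt p, (Finset.mem_filter.1 hp).2⟩
  · rw [List.mem_toFinset, List.mem_filter, List.mem_range] at hn
    rw [Finset.mem_filter, mem_repSub, pos_elt hn.1]
    exact ⟨Finset.mem_univ _, hn.2⟩
  · rw [List.mem_toFinset, List.mem_filter, List.mem_range] at hn
    exact pos_elt hn.1

lemma card_repSub_ne_zero (i : Fin 22) : ((rep i).2.1 : ℚ) ≠ 0 := by
  rw [← card_repSub]
  exact_mod_cast Nat.card_pos.ne'

/-- The completeness of the list of representatives, read off from the table of all subgroups. -/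
lemma exists_conj_eq_repSub (L : Subgroup (Equiv.Perm (Fin 3) × Equiv.Perm (Fin 3))) :
    ∃ p i, Biset.conj p L = repSub i := by
  have hL := code_mem_classTable (H := L)
  have h := List.all_eq_true.1 exists_conjMask _ hL
  have hlt := Nat.blt_eq.mp (List.all_eq_true.1 classOf_lt _ hL)
  obtain ⟨g, hg, h⟩ := List.any_eq_true.1 h
  obtain ⟨k, hk, h⟩ := List.any_eq_true.1 h
  refine ⟨(perm g, perm k), ⟨classOf (code L), hlt⟩, code_injective ?_⟩
  rw [code_conj, code_repSub, idx_perm g (List.mem_range.1 hg), idx_perm k (List.mem_range.1 hk)]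
  exact beq_iff_eq.1 h

/-- The weights of the subgroups of `S₃ × S₃`. -/
noncomputable def subWeight (L : Subgroup (Equiv.Perm (Fin 3) × Equiv.Perm (Fin 3))) : A :=
  (weight (code L)).toA

lemma subWeight_conj (p : Equiv.Perm (Fin 3) × Equiv.Perm (Fin 3))
    (L : Subgroup (Equiv.Perm (Fin 3) × Equiv.Perm (Fin 3))) :
    subWeight (Biset.conj p L) = subWeight L := by
  have h := List.all_eq_true.1 classOf_conjMask _ (code_mem_classTable (H := L))
  have h := List.all_eq_true.1 h (idx p.1) (List.mem_range.2 (idx_lt _))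
  have h := List.all_eq_true.1 h (idx p.2) (List.mem_range.2 (idx_lt _))
  rw [subWeight, subWeight, weight, code_conj, beq_iff_eq.1 h]
  rfl

lemma toA_foldr_addSMul (l : List ℕ) (c : ℕ → ℕ) (w : ℕ → IntA) :
    (l.foldr (fun g m => IntA.addSMul (c g) m (w g)) IntA.zero).toA =
      (l.map fun g => c g • (w g).toA).sum := by
  induction l with
  | nil => exact IntA.toA_zero
  | cons g l ih =>
    rw [List.foldr_cons, IntA.toA_addSMul, ih, List.map_cons, List.sum_cons, add_comm]

lemma toA_weightSum (L M : Subgroup (Equiv.Perm (Fin 3) × Equiv.Perm (Fin 3))) :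
    ∑ g, Biset.overlap L (Biset.conj (g, 1) M) • subWeight (Biset.comp L (Biset.conj (g, 1) M)) =
      (weightSum (code L) (code M)).toA := by
  simp only [subWeight, code_comp, overlap_eq]
  rw [sum_perm, Finset.sum_congr rfl fun i hi => by rw [idx_perm i (Finset.mem_range.1 hi)],
    weightSum, toA_foldr_addSMul (c := fun g => overlapMask g (code L) (code M))
      (w := fun g => weight (compMask g (code L) (code M))), ← List.sum_toFinset _ List.nodup_range,
    List.toFinset_range]

lemma isMultiplicative_repSub (i j : Fin 22) :
    ∑ g, Biset.overlap (repSub i) (Biset.conj (g, 1) (repSub j)) •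
      subWeight (Biset.comp (repSub i) (Biset.conj (g, 1) (repSub j))) =
      subWeight (repSub i) * subWeight (repSub j) := by
  have h := List.all_eq_true.1 weightSum_rep i (List.mem_range.2 i.2)
  have h := of_decide_eq_true (List.all_eq_true.1 h j (List.mem_range.2 j.2))
  rw [toA_weightSum, code_repSub, code_repSub, h, IntA.toA_mul, subWeight, subWeight, code_repSub,
    code_repSub]

end SymThree

/-! ### Reduction of multiplicativity to class representatives -/

namespace Biset

variable {G : Type} [Group G]

/-- The inner component b passes through the middle variable to the other factor as b⁻¹; the outer
component a conjugates the result. -/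
lemma comp_conj_left (a b : G) (L M : Subgroup (G × G)) :
    comp (conj (a, b) L) M = conj (a, 1) (comp L (conj (b⁻¹, 1) M)) := by
  ext ⟨x, y⟩
  simp only [mem_comp, mem_conj, Prod.mk_mul_mk, Prod.inv_mk, inv_one, one_mul, mul_one, inv_inv]
  refine ⟨fun ⟨k, h1, h2⟩ => ⟨b⁻¹ * k * b, h1, ?_⟩, fun ⟨k, h1, h2⟩ => ⟨b * k * b⁻¹, ?_, h2⟩⟩
  · simpa [mul_assoc] using h2
  · simpa [mul_assoc] using h1

lemma comp_conj_right (a b : G) (L M : Subgroup (G × G)) :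
    comp L (conj (a, b) M) = conj (1, b) (comp L (conj (a, 1) M)) := by
  ext ⟨x, y⟩
  simp only [mem_comp, mem_conj, Prod.mk_mul_mk, Prod.inv_mk, inv_one, one_mul, mul_one]

/-- Conjugating k by b⁻¹ matches the two sets; the component a acts only on the entry 1 and has no
effect. -/
lemma overlap_conj_left (a b : G) (L M : Subgroup (G × G)) :
    overlap (conj (a, b) L) M = overlap L (conj (b⁻¹, 1) M) := by
  refine Nat.card_congr (Equiv.subtypeEquiv (MulAut.conj b⁻¹).toEquiv fun k => and_congr ?_ ?_)
  · simp [mem_conj]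
  · simp [mem_conj, mul_assoc]

lemma overlap_conj_right (a b : G) (L M : Subgroup (G × G)) :
    overlap L (conj (a, b) M) = overlap L (conj (a, 1) M) := by
  refine Nat.card_congr (Equiv.subtypeEquiv (Equiv.refl _) fun k => and_congr Iff.rfl ?_)
  simp [mem_conj]

/-- For a conjugation invariant function it suffices to check the compatibility with the
multiplication of bisets on representatives of the conjugacy classes. -/
lemma isMultiplicative_of_reps [Fintype G] {X : Type} [Ring X] {W : Subgroup (G × G) → X}
    (hW : ∀ p L, W (conj p L) = W L) {ι : Type} (H : ι → Subgroup (G × G))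
    (hH : ∀ L, ∃ p i, conj p L = H i)
    (h : ∀ i j, ∑ g : G, overlap (H i) (conj (g, 1) (H j)) • W (comp (H i) (conj (g, 1) (H j))) =
      W (H i) * W (H j)) : IsMultiplicative W := by
  have hL (p : G × G) (L M : Subgroup (G × G)) :
      ∑ g : G, overlap (conj p L) (conj (g, 1) M) • W (comp (conj p L) (conj (g, 1) M)) =
        ∑ g : G, overlap L (conj (g, 1) M) • W (comp L (conj (g, 1) M)) := by
    obtain ⟨a, b⟩ := p
    -- The substitution g ↦ b⁻¹g absorbs the inner component, and W does not see the conjugation by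
    -- (a, 1).
    refine Fintype.sum_equiv (Equiv.mulLeft b⁻¹) _ _ fun g => ?_
    rw [comp_conj_left, overlap_conj_left, hW, ← conj_mul, Prod.mk_mul_mk, one_mul,
      Equiv.coe_mulLeft]
  have hM (p : G × G) (L M : Subgroup (G × G)) :
      ∑ g : G, overlap L (conj (g, 1) (conj p M)) • W (comp L (conj (g, 1) (conj p M))) =
        ∑ g : G, overlap L (conj (g, 1) M) • W (comp L (conj (g, 1) M)) := by
    obtain ⟨a, b⟩ := p
    -- Here the inner component is a, absorbed by g ↦ ga; W does not see the conjugation by (1, b).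
    refine Fintype.sum_equiv (Equiv.mulRight a) _ _ fun g => ?_
    rw [← conj_mul, Prod.mk_mul_mk, comp_conj_right, overlap_conj_right, hW, Equiv.coe_mulRight]
  intro L M
  obtain ⟨p, i, hi⟩ := hH L
  obtain ⟨q, j, hj⟩ := hH M
  rw [← hL p, ← hM q, hi, hj, h, ← hi, ← hj, hW, hW]

end Biset

/-! ### The invariant of bisets with values in A -/

namespace SymThree

lemma isMultiplicative_subWeight : Biset.IsMultiplicative subWeight :=
  Biset.isMultiplicative_of_reps subWeight_conj repSub exists_conj_eq_repSub
    isMultiplicative_repSub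

/-- The image of the `i`-th transitive biset in `A`. -/
noncomputable def repImage (i : Fin 22) : A := (rep i).2.2.toA

lemma subWeight_repSub (i : Fin 22) :
    subWeight (repSub i) = ((rep i).2.1 : ℚ) • repImage i := by
  have h := List.all_eq_true.1 classOf_rep i (List.mem_range.2 i.2)
  rw [subWeight, code_repSub, weight, beq_iff_eq.1 h, IntA.toA_addSMul, IntA.toA_zero, zero_add,
    Nat.cast_smul_eq_nsmul]
  rfl

lemma mark_cosets_repSub (i : Fin 22) :
    Biset.mark subWeight (Biset.cosets (repSub i)) = repImage i := by
  rw [Biset.mark_cosets _ subWeight_conj, card_repSub, subWeight_repSub, smul_smul,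
    inv_mul_cancel₀ (card_repSub_ne_zero i), one_smul]

/-- The pair (i, i) has position 7i, so the mask is ∑ 2^(7i) over i < 6. -/
lemma code_diagonal : code (Biset.diagonal (Equiv.Perm (Fin 3))) = 34630287489 := by
  have key : ∀ n < 36, Nat.testBit 34630287489 n = true ↔ n / 6 = n % 6 := by decide +kernel
  refine code_eq_of_testBit fun n => ⟨fun h => ?_, ?_⟩
  · have h36 : n < 36 := by
      by_contra hlt
      rw [Nat.testBit_lt_two_pow (lt_of_lt_of_le (by norm_num) (Nat.pow_le_pow_right
        (by norm_num : 0 < 2) (not_lt.1 hlt)))] at h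
      exact Bool.false_ne_true h
    exact ⟨h36, congrArg perm ((key n h36).1 h)⟩
  · rintro ⟨h36, h⟩
    have h' : idx (perm (n / 6)) = idx (perm (n % 6)) := congrArg idx h
    rw [idx_perm _ (by omega), idx_perm _ (by omega)] at h'
    exact (key n h36).2 h'

lemma mark_regular : Biset.mark subWeight (Biset.regular (Equiv.Perm (Fin 3))) = 1 := by
  -- The diagonal is not itself a representative; it belongs to class 20, whose image is the
  -- identity matrix.
  have h : weight 34630287489 = IntA.addSMul 6 IntA.zero (rep 20).2.2 := by decide +kernel
  have h1 : (rep 20).2.2.toA = 1 := by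
    have h2 : (rep 20).2.2 =
        ⟨1, 0, 0, 0, 1, 0, 0, 0, 1, 0, 0, 0, 1, 0, 1, 0, 0, 0, 0, 1, 0, 0⟩ := by decide +kernel
    rw [h2]
    refine A.ext ?_ ?_ ?_ ?_ ?_ ?_ ?_ ?_ ?_ ?_
    · ext i j
      fin_cases i <;> fin_cases j <;> simp [IntA.toA]
    · ext i
      fin_cases i <;> simp [IntA.toA]
    all_goals simp [IntA.toA]
  rw [Biset.mark_regular subWeight_conj, subWeight, code_diagonal, h, IntA.toA_addSMul,
    IntA.toA_zero, zero_add, h1, ← Nat.cast_smul_eq_nsmul ℚ, smul_smul, Nat.card_perm]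
  norm_num [Nat.factorial]

end SymThree

end DoubleBurnside

namespace DoubleBurnside

/-! ### The images of the transitive bisets as a ℤ₍₃₎-basis of Λ₍₃₎ -/

namespace IntA

/-- The standard scalar product of coordinate vectors. -/
def dot (a b : IntA) : ℤ :=
    a.s00 * b.s00 + a.s01 * b.s01 + a.s02 * b.s02 + a.s10 * b.s10 + a.s11 * b.s11 + a.s12 * b.s12 +
    a.s20 * b.s20 + a.s21 * b.s21 + a.s22 * b.s22 + a.t0 * b.t0 + a.t1 * b.t1 + a.t2 * b.t2 +
    a.u * b.u + a.v * b.v + a.w * b.w + a.x0 * b.x0 + a.x1 * b.x1 + a.x2 * b.x2 +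
    a.y * b.y + a.z1 * b.z1 + a.z2 * b.z2 + a.z3 * b.z3

/-- The coordinate vector. -/
def coord (a : IntA) : Fin 22 → ℤ :=
  ![a.s00, a.s01, a.s02, a.s10, a.s11, a.s12, a.s20, a.s21, a.s22, a.t0, a.t1, a.t2, a.u, a.v,
    a.w, a.x0, a.x1, a.x2, a.y, a.z1, a.z2, a.z3]

lemma dot_eq_sum (a b : IntA) : dot a b = ∑ k, a.coord k * b.coord k := by
  simp only [Fin.sum_univ_succ, coord, Matrix.cons_val_zero, Matrix.cons_val_succ,
    Finset.univ_eq_empty, Finset.sum_empty, dot]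
  ring

end IntA

namespace A

/-- The coordinates of an element of `A` with respect to a basis of `Λ₍₃₎`. -/
def coord : A →ₗ[ℚ] Fin 22 → ℚ where
  toFun a := ![a.s 0 0, a.s 0 1, a.s 0 2, a.s 1 0, a.s 1 1, a.s 1 2, a.s 2 0, a.s 2 1, a.s 2 2,
    a.t 0, a.t 1, a.t 2, a.u, a.v, a.w, a.x 0 / 3, a.x 1 / 3, a.x 2 / 3, a.y, a.z₁, a.z₂ / 3, a.z₃]
  map_add' a b := by
    simp [add_div]
  map_smul' q a := by
    simp [mul_div_assoc]

lemma coord_injective : Function.Injective coord := by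
  intro a b h
  simp only [coord, LinearMap.coe_mk, AddHom.coe_mk, Matrix.vecCons_inj] at h
  obtain ⟨h1, h2, h3, h4, h5, h6, h7, h8, h9, h10, h11, h12, h13, h14, h15, h16, h17, h18, h19, h20,
    h21, h22, -⟩ := h
  refine A.ext ?_ ?_ h13 h14 h15 ?_ h19 h20 ((div_left_inj' three_ne_zero).1 h21) h22
  · ext i j
    fin_cases i <;> fin_cases j <;> assumption
  · ext i
    fin_cases i <;> assumption
  · ext i
    fin_cases i
    exacts [(div_left_inj' three_ne_zero).1 h16, (div_left_inj' three_ne_zero).1 h17,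
      (div_left_inj' three_ne_zero).1 h18]

lemma coord_toA (a : IntA) (k : Fin 22) : coord a.toA k = a.coord k := by
  have h : coord a.toA = fun k => (a.coord k : ℚ) := by
    simp only [coord, LinearMap.coe_mk, AddHom.coe_mk, IntA.toA, IntA.coord]
    ext k
    fin_cases k <;> simp
  rw [h]

end A

lemma mem_threeZ3_iff {q : ℚ} : q ∈ threeZ3 ↔ q / 3 ∈ Z3 := by
  constructor
  · rintro ⟨r, hr, rfl⟩
    simpa using hr
  · exact fun h => ⟨q / 3, h, by ring⟩

lemma mem_Lambda3_iff {a : A} : a ∈ Lambda3 ↔ ∀ k, A.coord a k ∈ Z3 := by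
  have h : a ∈ Lambda3 ↔ (∀ i j, a.s i j ∈ Z3) ∧ (∀ i, a.t i ∈ Z3) ∧ a.u ∈ Z3 ∧ a.v ∈ Z3 ∧
    a.w ∈ Z3 ∧ (∀ i, a.x i ∈ threeZ3) ∧ a.y ∈ Z3 ∧ a.z₁ ∈ Z3 ∧ a.z₂ ∈ threeZ3 ∧ a.z₃ ∈ Z3 := Iff.rfl
  rw [h]
  simp only [mem_threeZ3_iff]
  simp only [A.coord, LinearMap.coe_mk, AddHom.coe_mk, Fin.forall_fin_succ, Matrix.cons_val_zero,
    Matrix.cons_val_succ, IsEmpty.forall_iff, and_true, Fin.succ_zero_eq_one, Fin.succ_one_eq_two,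
    and_assoc]

namespace SymThree

/-- Four times the columns of the matrix which expresses a basis of `Λ₍₃₎` by the images of the
transitive bisets. -/
def dualTable : List IntA :=
  [⟨0, 0, 0, 0, 0, 0, 0, 0, 0, 0, 0, 0, -4, 4, -1, 0, 0, 0, 4, 5, 2, 4⟩,
   ⟨0, 0, 0, 0, 0, 0, 0, 0, 0, 0, 0, 0, 4, -4, 0, 4, 0, 0, -4, -4, -4, -12⟩,
   ⟨0, 0, 0, 0, 0, 0, 0, 0, 0, 2, 0, -2, 4, -4, 0, 0, 0, 0, -4, -4, -4, -12⟩,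
   ⟨0, 0, 0, 0, 0, 0, 0, 0, 0, 0, 0, 0, 0, -4, 1, 0, 4, 0, 0, -1, -2, -4⟩,
   ⟨0, 0, 0, 0, 0, 0, 0, 0, 0, 0, 2, -2, 0, 0, 1, 0, 0, 0, -4, -1, -2, -4⟩,
   ⟨4, 0, 0, 0, 0, 0, -4, 0, 0, -4, 0, 4, -8, 8, 0, -8, 0, 0, 8, 4, 8, 24⟩,
   ⟨0, 0, 0, 0, 0, 0, 0, 0, 0, 0, 0, 0, 0, 4, 0, 0, 0, 4, 0, 0, 4, 12⟩,
   ⟨0, 0, 0, 4, 0, 0, -4, 0, 0, 0, -4, 4, 0, 0, 0, -4, 0, 0, 4, 0, 4, 12⟩,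
   ⟨0, 4, 0, 0, 0, 0, 0, -4, 0, -2, 0, 2, 0, 4, 0, 0, -8, 0, 0, 0, 4, 12⟩,
   ⟨0, 0, 0, 0, 0, 0, 0, 0, 0, -2, -2, 6, 0, 0, 0, 0, 0, 0, 4, 0, 4, 12⟩,
   ⟨0, 0, 0, 0, 4, 0, 0, -4, 0, 0, -2, 2, 0, 0, -3, 0, -4, 0, 0, -1, 2, 4⟩,
   ⟨0, 0, 4, 0, 0, 0, 0, 0, -4, 4, 0, -4, 0, -8, 0, 0, 0, -8, 0, 4, -8, -24⟩,
   ⟨-4, 0, 0, -4, 0, 0, 12, 0, 0, 4, 4, -12, 0, 0, 0, 8, 0, 0, -8, 4, -8, -24⟩,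
   ⟨0, 0, 0, 0, 0, 4, 0, 0, -4, 0, 4, -4, 0, 0, 0, 0, 0, -4, 0, 4, -4, -12⟩,
   ⟨0, -4, 0, 0, -4, 0, 0, 12, 0, 2, 2, -6, 0, 0, 0, 0, 8, 0, 0, 4, -4, -12⟩,
   ⟨0, 0, -4, 0, 0, -4, 0, 0, 12, -4, -4, 12, 0, 0, 0, 0, 0, 8, 0, -12, 8, 24⟩,
   ⟨0, 0, 0, 0, 0, 0, 0, 0, 0, 0, 0, 0, 4, -4, 0, 0, 0, 0, -4, -4, 0, 4⟩,
   ⟨0, 0, 0, 0, 0, 0, 0, 0, 0, 0, 0, 0, 0, 0, 2, 0, 0, 0, 0, -2, 0, 0⟩,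
   ⟨0, 0, 0, 0, 0, 0, 0, 0, 0, 0, 0, 0, 0, 4, 0, 0, 0, 0, 0, 0, 0, -4⟩,
   ⟨0, 0, 0, 0, 0, 0, 0, 0, 0, 0, 0, 0, 0, 0, 0, 0, 0, 0, 4, 0, 0, -4⟩,
   ⟨0, 0, 0, 0, 0, 0, 0, 0, 0, 0, 0, 0, 0, 0, 0, 0, 0, 0, 0, 4, 0, 0⟩,
   ⟨0, 0, 0, 0, 0, 0, 0, 0, 0, 0, 0, 0, 0, 0, 0, 0, 0, 0, 0, 0, 0, 4⟩]

/-- The `j`-th column of the inverse matrix, multiplied by `4`. -/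
def dual (j : ℕ) : IntA := dualTable.getD j IntA.zero

/-- Certifies the inverse of the 22 × 22 coordinate matrix, with 4 as a common denominator. Since 4
is a unit of ℤ₍₃₎, the 22 images generate all of Λ₍₃₎. -/
lemma dot_rep_dual : ((List.range 22).all fun i => (List.range 22).all fun j =>
    decide (IntA.dot (rep i).2.2 (dual j) = bif i == j then 4 else 0)) = true := by
  decide +kernel

/-- The coordinates of the images of the transitive bisets. -/
def repMatrix : Matrix (Fin 22) (Fin 22) ℚ := fun i k => (rep i).2.2.coord k

/-- The inverse of the matrix of coordinates. -/
def dualMatrix : Matrix (Fin 22) (Fin 22) ℚ := fun k j => (dual j).coord k / 4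

lemma repMatrix_mul_dualMatrix : repMatrix * dualMatrix = 1 := by
  ext i j
  have h := List.all_eq_true.1 dot_rep_dual i (List.mem_range.2 i.2)
  have h := of_decide_eq_true (List.all_eq_true.1 h j (List.mem_range.2 j.2))
  rw [IntA.dot_eq_sum] at h
  have h' := congrArg (fun n : ℤ => (n : ℚ) / 4) h
  simp only [Int.cast_sum, Int.cast_mul, Finset.sum_div, mul_div_assoc] at h'
  rw [Matrix.mul_apply]
  refine h'.trans ?_
  rw [Matrix.one_apply]
  by_cases hij : i = j
  · simp [hij]
  · have : ((i : ℕ) == j) = false := by simpa using fun h => hij (Fin.ext h)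
    simp [hij, this]

lemma dualMatrix_mul_repMatrix : dualMatrix * repMatrix = 1 :=
  mul_eq_one_comm.1 repMatrix_mul_dualMatrix

/-- The coordinates of an element of `A` with respect to the images of the transitive bisets. -/
noncomputable def repCoord : A →ₗ[ℚ] Fin 22 → ℚ := dualMatrix.vecMulLinear ∘ₗ A.coord

lemma repCoord_apply (a : A) : repCoord a = Matrix.vecMul (A.coord a) dualMatrix := rfl

lemma coord_sum_repImage (c : Fin 22 → ℚ) :
    A.coord (∑ i, c i • repImage i) = Matrix.vecMul c repMatrix := by
  ext k
  rw [map_sum, Finset.sum_apply, Matrix.vecMul, dotProduct]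
  refine Finset.sum_congr rfl fun i _ => ?_
  rw [map_smul, Pi.smul_apply, repImage, A.coord_toA]
  rfl

lemma repCoord_sum (c : Fin 22 → ℚ) : repCoord (∑ i, c i • repImage i) = c := by
  rw [repCoord_apply, coord_sum_repImage, Matrix.vecMul_vecMul, repMatrix_mul_dualMatrix,
    Matrix.vecMul_one]

lemma sum_repCoord (a : A) : ∑ i, repCoord a i • repImage i = a := by
  refine A.coord_injective ?_
  rw [coord_sum_repImage, repCoord_apply, Matrix.vecMul_vecMul, dualMatrix_mul_repMatrix,
    Matrix.vecMul_one]

lemma intCast_div_four_mem (n : ℤ) : (n : ℚ) / 4 ∈ Z3 := ⟨n, 4, by norm_num, by norm_num⟩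

/-- The entries of the inverse matrix are quarters of integers, which lie in ℤ₍₃₎. -/
lemma repCoord_mem {a : A} (ha : a ∈ Lambda3) (i : Fin 22) : repCoord a i ∈ Z3 := by
  rw [repCoord_apply, Matrix.vecMul, dotProduct]
  exact sum_mem fun k _ => mul_mem (mem_Lambda3_iff.1 ha k) (intCast_div_four_mem _)

lemma repImage_mem (i : Fin 22) : repImage i ∈ Lambda3 := by
  rw [mem_Lambda3_iff]
  intro k
  rw [repImage, A.coord_toA]
  exact intCast_mem Z3 _

/-- The homomorphism from the double Burnside algebra to `A`. -/
noncomputable def burnsideToA : BurnsideAlgebra Z3 (Equiv.Perm (Fin 3)) →ₐ[Z3] A :=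
  BurnsideAlgebra.lift Z3 (Biset.mark subWeight) (Biset.mark_iso subWeight) mark_regular
    (Biset.mark_tensor isMultiplicative_subWeight) (Biset.mark_disjUnion subWeight)

/-- The `i`-th transitive biset, in the double Burnside algebra. -/
noncomputable def basisElt (R : Type) [CommRing R] (i : Fin 22) :
    BurnsideAlgebra R (Equiv.Perm (Fin 3)) :=
  BurnsideAlgebra.cls R (Biset.cosets (repSub i))

/-- Only generation is shown. Linear independence is never proved inside the Burnside algebra; it
comes from the independence of the images. -/
lemma exists_eq_sum (R : Type) [CommRing R] (x : BurnsideAlgebra R (Equiv.Perm (Fin 3))) :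
    ∃ c : Fin 22 → R, ∑ i, c i • basisElt R i = x := by
  rw [← Submodule.mem_span_range_iff_exists_fun]
  have h := BurnsideAlgebra.span_cosets R repSub exists_conj_eq_repSub
  exact h ▸ Submodule.mem_top

lemma burnsideToA_basisElt (i : Fin 22) : burnsideToA (basisElt Z3 i) = repImage i :=
  (BurnsideAlgebra.lift_cls Z3 (Biset.mark subWeight) (Biset.mark_iso subWeight) mark_regular
    (Biset.mark_tensor isMultiplicative_subWeight) (Biset.mark_disjUnion subWeight) _).trans
    (mark_cosets_repSub i)

lemma burnsideToA_sum (c : Fin 22 → Z3) :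
    burnsideToA (∑ i, c i • basisElt Z3 i) = ∑ i, (c i : ℚ) • repImage i := by
  rw [map_sum]
  refine Finset.sum_congr rfl fun i _ => ?_
  rw [map_smul, burnsideToA_basisElt]
  rfl

lemma burnsideToA_mem (x : BurnsideAlgebra Z3 (Equiv.Perm (Fin 3))) :
    burnsideToA x ∈ Lambda3 := by
  obtain ⟨c, rfl⟩ := exists_eq_sum Z3 x
  rw [burnsideToA_sum]
  exact sum_mem fun i _ => Lambda3.smul_mem (repImage_mem i) (c i)

/-- The homomorphism from the double Burnside algebra to `Λ₍₃₎`. -/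
noncomputable def burnsideToLambda : BurnsideAlgebra Z3 (Equiv.Perm (Fin 3)) →ₐ[Z3] Lambda3 :=
  burnsideToA.codRestrict Lambda3 burnsideToA_mem

/-- A generating family is sent to a basis: the coordinates of the image recover the coefficients,
and every element of Λ₍₃₎ has coordinates in ℤ₍₃₎. -/
lemma burnsideToLambda_bijective : Function.Bijective burnsideToLambda := by
  constructor
  · rw [injective_iff_map_eq_zero]
    intro x hx
    obtain ⟨c, rfl⟩ := exists_eq_sum Z3 x
    have h : burnsideToA (∑ i, c i • basisElt Z3 i) = 0 := congrArg Subtype.val hx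
    rw [burnsideToA_sum] at h
    have hc := repCoord_sum fun i => (c i : ℚ)
    rw [h, map_zero] at hc
    refine Finset.sum_eq_zero fun i _ => ?_
    have : c i = 0 := Subtype.ext (congrFun hc i).symm
    rw [this, zero_smul]
  · rintro ⟨a, ha⟩
    refine ⟨∑ i, (⟨repCoord a i, repCoord_mem ha i⟩ : Z3) • basisElt Z3 i, Subtype.ext ?_⟩
    exact (burnsideToA_sum _).trans (sum_repCoord a)

/-- The double Burnside algebra of `S₃` over `ℤ₍₃₎` is isomorphic to `Λ₍₃₎`. -/
noncomputable def burnsideEquiv : BurnsideAlgebra Z3 (Equiv.Perm (Fin 3)) ≃ₐ[Z3] Lambda3 :=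
  AlgEquiv.ofBijective burnsideToLambda burnsideToLambda_bijective

end SymThree

end DoubleBurnside

namespace DoubleBurnside

/-! ## Reduction modulo `3` -/

lemma mk_threeIdeal_eq_zero_iff {S : Type} [Ring S] (a : S) :
    Ideal.Quotient.mk (threeIdeal S) a = 0 ↔ ∃ b, a = 3 * b := by
  rw [Ideal.Quotient.eq_zero_iff_mem, threeIdeal, Ideal.mem_span_singleton']
  have h (b : S) : b * 3 = 3 * b := (Nat.cast_commute 3 b).eq.symm
  exact exists_congr fun b => by rw [h, eq_comm]

/-- ℤ₍₃₎ = ℤ + 3ℤ₍₃₎. With `three_dvd_of_div_mem`, which says ℤ ∩ 3ℤ₍₃₎ = 3ℤ, this identifies ℤ₍₃₎/3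
with 𝔽₃ without constructing a map. -/
lemma exists_int_of_mem_Z3 {q : ℚ} (hq : q ∈ Z3) : ∃ n : ℤ, ∃ r ∈ Z3, q = n + 3 * r := by
  obtain ⟨a, b, hb, rfl⟩ := hq
  obtain ⟨u, v, huv⟩ := (Int.prime_three.coprime_iff_not_dvd.2 hb)
  have hb0 : (b : ℚ) ≠ 0 := by
    rintro h
    rw [Int.cast_eq_zero.1 h] at hb
    exact hb (dvd_zero 3)
  -- From 3u + vb = 1 one gets a/b = av + 3 · (au/b).
  refine ⟨a * v, a * u / b, ⟨a * u, b, hb, by push_cast; rfl⟩, ?_⟩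
  have h : (u : ℚ) * 3 + v * b = 1 := by exact_mod_cast huv
  field_simp
  push_cast
  linear_combination -(a : ℚ) * h

lemma three_dvd_of_div_mem {n : ℤ} {r : ℚ} (hr : r ∈ Z3) (h : (n : ℚ) = 3 * r) : 3 ∣ n := by
  obtain ⟨a, b, hb, rfl⟩ := hr
  have hb0 : (b : ℚ) ≠ 0 := by
    rintro h
    rw [Int.cast_eq_zero.1 h] at hb
    exact hb (dvd_zero 3)
  have h1 : n * b = 3 * a := by
    field_simp at h
    exact_mod_cast h
  exact (Int.prime_three.dvd_or_dvd ⟨a, h1⟩).resolve_right hb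

lemma A.three_mul (a : A) : 3 * a = (3 : ℚ) • a := by
  rw [Algebra.smul_def, map_ofNat]

namespace SymThree

/-- The image of the `i`-th transitive biset in `Λ₍₃₎`. -/
noncomputable def repLambda (i : Fin 22) : Lambda3 := ⟨repImage i, repImage_mem i⟩

lemma burnsideEquiv_basisElt (i : Fin 22) : burnsideEquiv (basisElt Z3 i) = repLambda i :=
  Subtype.ext (burnsideToA_basisElt i)

/-- The class of a biset in `Λ₍₃₎/3Λ₍₃₎`. -/
noncomputable def bisetModThree (M : Biset (Equiv.Perm (Fin 3))) : ModThree Lambda3 :=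
  Ideal.Quotient.mk (threeIdeal Lambda3) (burnsideEquiv (BurnsideAlgebra.cls Z3 M))

lemma bisetModThree_iso {M N : Biset (Equiv.Perm (Fin 3))} (e : Biset.Iso M N) :
    bisetModThree M = bisetModThree N := by
  rw [bisetModThree, BurnsideAlgebra.cls_iso Z3 e, bisetModThree]

lemma bisetModThree_regular : bisetModThree (Biset.regular _) = 1 := by
  rw [bisetModThree, BurnsideAlgebra.cls_regular, map_one, map_one]

lemma bisetModThree_tensor (M N : Biset (Equiv.Perm (Fin 3))) :
    bisetModThree (M.tensor N) = bisetModThree M * bisetModThree N := by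
  rw [bisetModThree, BurnsideAlgebra.cls_tensor, map_mul, map_mul, bisetModThree, bisetModThree]

lemma bisetModThree_disjUnion (M N : Biset (Equiv.Perm (Fin 3))) :
    bisetModThree (M.disjUnion N) = bisetModThree M + bisetModThree N := by
  rw [bisetModThree, BurnsideAlgebra.cls_disjUnion, map_add, map_add, bisetModThree, bisetModThree]

/-- The homomorphism from the double Burnside algebra over `𝔽₃` to `Λ₍₃₎/3Λ₍₃₎`. -/
noncomputable def burnsideModThree :
    BurnsideAlgebra (ZMod 3) (Equiv.Perm (Fin 3)) →ₐ[ZMod 3] ModThree Lambda3 :=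
  BurnsideAlgebra.lift (ZMod 3) bisetModThree bisetModThree_iso bisetModThree_regular
    bisetModThree_tensor bisetModThree_disjUnion

lemma burnsideModThree_sum (n : Fin 22 → ℤ) :
    burnsideModThree (∑ i, (n i : ZMod 3) • basisElt (ZMod 3) i) =
      Ideal.Quotient.mk (threeIdeal Lambda3) (∑ i, n i • repLambda i) := by
  rw [map_sum, map_sum]
  refine Finset.sum_congr rfl fun i _ => ?_
  have h : burnsideModThree (basisElt (ZMod 3) i) =
      Ideal.Quotient.mk (threeIdeal Lambda3) (repLambda i) :=
    (BurnsideAlgebra.lift_cls (ZMod 3) bisetModThree bisetModThree_iso bisetModThree_regular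
      bisetModThree_tensor bisetModThree_disjUnion _).trans
      (congrArg (Ideal.Quotient.mk (threeIdeal Lambda3)) (burnsideEquiv_basisElt i))
  rw [map_smul, h, Int.cast_smul_eq_zsmul, map_zsmul]

lemma coe_sum_repLambda (n : Fin 22 → ℤ) :
    ((∑ i, n i • repLambda i : Lambda3) : A) = ∑ i, (n i : ℚ) • repImage i := by
  rw [AddSubmonoidClass.coe_finsetSum]
  refine Finset.sum_congr rfl fun i _ => ?_
  rw [Int.cast_smul_eq_zsmul]
  rfl

/-- The argument over ℤ₍₃₎ again, with coefficients in 𝔽₃ lifted to integers: an integral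
combination of the basis lies in 3Λ₍₃₎ only if 3 divides all its coefficients. -/
lemma burnsideModThree_bijective : Function.Bijective burnsideModThree := by
  constructor
  · rw [injective_iff_map_eq_zero]
    intro x hx
    obtain ⟨c, rfl⟩ := exists_eq_sum (ZMod 3) x
    choose n hn using fun i => ZMod.intCast_surjective (c i)
    simp only [← hn] at hx ⊢
    rw [burnsideModThree_sum, mk_threeIdeal_eq_zero_iff] at hx
    obtain ⟨b, hb⟩ := hx
    have hb' : ∑ i, (n i : ℚ) • repImage i = (3 : ℚ) • (b : A) := by
      rw [← coe_sum_repLambda, hb]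
      exact A.three_mul b
    have hc := repCoord_sum fun i => (n i : ℚ)
    rw [hb', map_smul] at hc
    refine Finset.sum_eq_zero fun i _ => ?_
    have h3 : (n i : ℚ) = 3 * repCoord b i := (congrFun hc i).symm
    rw [(ZMod.intCast_zmod_eq_zero_iff_dvd (n i) 3).2
      (three_dvd_of_div_mem (repCoord_mem b.2 i) h3), zero_smul]
  · intro y
    obtain ⟨⟨a, ha⟩, rfl⟩ := Ideal.Quotient.mk_surjective y
    choose n r hr hn using fun i => exists_int_of_mem_Z3 (repCoord_mem ha i)
    refine ⟨∑ i, (n i : ZMod 3) • basisElt (ZMod 3) i, ?_⟩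
    rw [burnsideModThree_sum, eq_comm, ← sub_eq_zero, ← map_sub, mk_threeIdeal_eq_zero_iff]
    refine ⟨∑ i, (⟨r i, hr i⟩ : Z3) • repLambda i, Subtype.ext ?_⟩
    have h1 : ((∑ i, (⟨r i, hr i⟩ : Z3) • repLambda i : Lambda3) : A) =
        ∑ i, r i • repImage i := AddSubmonoidClass.coe_finsetSum _ _
    change a - ((∑ i, n i • repLambda i : Lambda3) : A) = (3 : A) * _
    rw [h1, coe_sum_repLambda, A.three_mul, Finset.smul_sum]
    nth_rewrite 1 [← sum_repCoord a]
    rw [← Finset.sum_sub_distrib]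
    refine Finset.sum_congr rfl fun i _ => ?_
    rw [← sub_smul, smul_smul, hn]
    congr 1
    ring

/-- The double Burnside algebra of `S₃` over `𝔽₃` is isomorphic to `Λ₍₃₎/3Λ₍₃₎`. -/
noncomputable def burnsideModThreeEquiv :
    BurnsideAlgebra (ZMod 3) (Equiv.Perm (Fin 3)) ≃ₐ[ZMod 3] ModThree Lambda3 :=
  AlgEquiv.ofBijective burnsideModThree burnsideModThree_bijective

end SymThree

end DoubleBurnside

namespace DoubleBurnside

/-! ## Morita equivalence with a full corner -/

section Corner

variable {S T : Type} [Ring S] [Ring T]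

/-- An embedding of a ring `T` onto a corner `e S e` of a ring `S`, where `e` is an idempotent with
`S e S = S`. -/
structure FullCorner (S T : Type) [Ring S] [Ring T] where
  ι : T →ₙ+* S
  injective : Function.Injective ι
  exists_eq : ∀ s, ∃ t, ι t = ι 1 * s * ι 1
  κ : Type
  [fintype : Fintype κ]
  left : κ → S
  right : κ → S
  sum_eq : ∑ k, left k * ι 1 * right k = 1

namespace FullCorner

attribute [instance] FullCorner.fintype

variable (c : FullCorner S T)

lemma ι_one_mul (t : T) : c.ι 1 * c.ι t = c.ι t := by rw [← map_mul, one_mul]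

lemma ι_mul_one (t : T) : c.ι t * c.ι 1 = c.ι t := by rw [← map_mul, mul_one]

section Fixed

variable (M : Type) [AddCommGroup M] [Module S M]

/-- The subgroup `e M` of an `S`-module `M`. -/
def fixed : AddSubgroup M where
  carrier := {m | c.ι 1 • m = m}
  zero_mem' := smul_zero _
  add_mem' := by
    intro a b ha hb
    exact (smul_add _ a b).trans (congrArg₂ (· + ·) ha hb)
  neg_mem' := by
    intro a ha
    exact (smul_neg (c.ι 1) (a : M)).trans (congrArg Neg.neg ha)

variable {M}

lemma smul_fixed (m : c.fixed M) : c.ι 1 • m.1 = m.1 := m.2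

lemma smul_mem_fixed (t : T) (m : M) : c.ι t • m ∈ c.fixed M := by
  change c.ι 1 • c.ι t • m = c.ι t • m
  rw [smul_smul, ι_one_mul]

/-- The action of `T` on `e M`. -/
instance : Module T (c.fixed M) where
  smul t m := ⟨c.ι t • (m : M), c.smul_mem_fixed t m.1⟩
  one_smul m := Subtype.ext m.2
  mul_smul t t' m := Subtype.ext (by
    change c.ι (t * t') • (m : M) = c.ι t • c.ι t' • (m : M)
    rw [map_mul, mul_smul])
  smul_zero t := Subtype.ext (smul_zero _)
  smul_add t m m' := Subtype.ext (smul_add _ _ _)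
  add_smul t t' m := Subtype.ext (by
    change c.ι (t + t') • (m : M) = c.ι t • (m : M) + c.ι t' • (m : M)
    rw [map_add, add_smul])
  zero_smul m := Subtype.ext (by
    change c.ι 0 • (m : M) = 0
    rw [map_zero, zero_smul])

lemma coe_smul_fixed (t : T) (m : c.fixed M) : ((t • m : c.fixed M) : M) = c.ι t • (m : M) := rfl

variable {N : Type} [AddCommGroup N] [Module S N]

/-- The restriction of a linear map `M → N` to `e M → e N`. -/
def fixedMap (f : M →ₗ[S] N) : c.fixed M →ₗ[T] c.fixed N where
  toFun m := ⟨f m, by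
    change c.ι 1 • f m = f m
    rw [← map_smul, m.2]⟩
  map_add' m m' := Subtype.ext (map_add f _ _)
  map_smul' t m := Subtype.ext (map_smul f _ _)

lemma coe_fixedMap (f : M →ₗ[S] N) (m : c.fixed M) : (c.fixedMap f m : N) = f m := rfl

/-- The element `e m` of `e M`. -/
def toFixed (m : M) : c.fixed M := ⟨c.ι 1 • m, c.smul_mem_fixed 1 m⟩

lemma toFixed_add (m m' : M) : c.toFixed (m + m') = c.toFixed m + c.toFixed m' :=
  Subtype.ext (smul_add _ _ _)

lemma coe_toFixed (m : M) : (c.toFixed m : M) = c.ι 1 • m := rfl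

lemma sum_left_smul (m : M) : ∑ k, c.left k • c.ι 1 • c.right k • m = m := by
  simp only [smul_smul, ← mul_assoc]
  rw [← Finset.sum_smul, c.sum_eq, one_smul]

/-- A T-linear map commutes with the elements ese of the corner, because ese = ι t for some t. -/
lemma toFixed_smul (g : c.fixed M →ₗ[T] c.fixed N) (s : S) (m : M) :
    (g (c.toFixed (s • c.ι 1 • m)) : N) = c.ι 1 • s • (g (c.toFixed m) : N) := by
  obtain ⟨t, ht⟩ := c.exists_eq s
  have h : c.toFixed (s • c.ι 1 • m) = t • c.toFixed m := by
    refine Subtype.ext ?_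
    rw [coe_smul_fixed, coe_toFixed, coe_toFixed, ht]
    simp only [smul_smul, mul_assoc, ι_one_mul]
  rw [h, map_smul, coe_smul_fixed, ht, mul_smul, mul_smul, smul_fixed]

/-- The extension of a `T`-linear map `e M → e N` to an `S`-linear map `M → N`. -/
def extend (g : c.fixed M →ₗ[T] c.fixed N) : M →ₗ[S] N where
  toFun m := ∑ k, c.left k • (g (c.toFixed (c.right k • m)) : N)
  map_add' m m' := by
    simp only [smul_add, toFixed_add, map_add, AddSubgroup.coe_add, Finset.sum_add_distrib]
  map_smul' s m := by
    have h (k : c.κ) : (g (c.toFixed (c.right k • s • m)) : N) =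
        c.ι 1 • c.right k • s • ∑ l, c.left l • (g (c.toFixed (c.right l • m)) : N) := by
      -- Inserting 1 = ∑ left · e · right between s and m brings each summand into the form treated
      -- by `toFixed_smul`.
      have h1 : c.toFixed (c.right k • s • m) =
          ∑ l, c.toFixed ((c.right k * s * c.left l) • c.ι 1 • c.right l • m) := by
        refine Subtype.ext ?_
        rw [AddSubgroup.val_finsetSum]
        simp only [coe_toFixed]
        rw [← Finset.smul_sum]
        simp only [mul_smul]
        rw [← Finset.smul_sum, ← Finset.smul_sum, sum_left_smul]
      rw [h1, map_sum, AddSubgroup.val_finsetSum]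
      simp only [toFixed_smul, Finset.smul_sum]
      simp only [mul_smul]
    simp only [h, RingHom.id_apply]
    exact c.sum_left_smul _

lemma fixedMap_extend (g : c.fixed M →ₗ[T] c.fixed N) : c.fixedMap (c.extend g) = g := by
  ext m
  rw [coe_fixedMap]
  change ∑ k, c.left k • (g (c.toFixed (c.right k • (m : M))) : N) = _
  have hm : c.toFixed (m : M) = m := Subtype.ext m.2
  have h (k : c.κ) : (g (c.toFixed (c.right k • (m : M))) : N) =
      c.ι 1 • c.right k • (g m : N) := by
    have := c.toFixed_smul g (c.right k) (m : M)
    rwa [smul_fixed, hm] at this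
  simp only [h]
  exact c.sum_left_smul _

/-- As SeS = S, the module M is generated by eM. -/
lemma fixedMap_injective : Function.Injective (c.fixedMap (M := M) (N := N)) := by
  intro f f' h
  ext m
  have h1 (k : c.κ) : f (c.ι 1 • c.right k • m) = f' (c.ι 1 • c.right k • m) :=
    congrArg Subtype.val (LinearMap.congr_fun h (c.toFixed (c.right k • m)))
  rw [← c.sum_left_smul m]
  simp only [map_sum, map_smul f (c.left _), map_smul f' (c.left _), h1]

end Fixed

section Coinduced

variable (N : Type) [AddCommGroup N] [Module T N]

/-- The `S`-module `Hom_T(e S, N)`. -/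
def Coinduced : Type := c.fixed S →ₗ[T] N

instance : AddCommGroup (c.Coinduced N) := inferInstanceAs (AddCommGroup (c.fixed S →ₗ[T] N))

/-- Right multiplication on `e S`. -/
def mulRight (s : S) : c.fixed S →ₗ[T] c.fixed S where
  toFun x := ⟨x * s, by
    change c.ι 1 * (x * s) = x * s
    rw [← mul_assoc]
    exact congrArg (· * s) x.2⟩
  map_add' x y := Subtype.ext (add_mul _ _ _)
  map_smul' t x := Subtype.ext (mul_assoc _ _ _)

instance : Module S (c.Coinduced N) where
  smul s f := LinearMap.comp (show c.fixed S →ₗ[T] N from f) (c.mulRight s)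
  one_smul f := LinearMap.ext fun x => congrArg (show c.fixed S →ₗ[T] N from f)
    (Subtype.ext (mul_one (x : S)))
  mul_smul s s' f := LinearMap.ext fun x => congrArg (show c.fixed S →ₗ[T] N from f)
    (Subtype.ext (mul_assoc (x : S) s s').symm)
  smul_zero _ := LinearMap.zero_comp _
  smul_add _ _ _ := LinearMap.add_comp _ _ _
  add_smul s s' f := LinearMap.ext fun x =>
    (congrArg (show c.fixed S →ₗ[T] N from f) (Subtype.ext (mul_add (x : S) s s'))).trans
      (map_add (show c.fixed S →ₗ[T] N from f) _ _)
  zero_smul f := LinearMap.ext fun x =>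
    (congrArg (show c.fixed S →ₗ[T] N from f) (Subtype.ext (mul_zero (x : S)))).trans
      (map_zero (show c.fixed S →ₗ[T] N from f))

variable {N}

/-- Evaluation of an element of `Hom_T(e S, N)`. -/
def eval (f : c.Coinduced N) (x : c.fixed S) : N := (show c.fixed S →ₗ[T] N from f) x

lemma eval_smul (s : S) (f : c.Coinduced N) (x : c.fixed S) :
    c.eval (s • f) x = c.eval f (c.mulRight s x) := rfl

lemma eval_map_smul (t : T) (f : c.Coinduced N) (x : c.fixed S) :
    c.eval f (t • x) = t • c.eval f x := map_smul (show c.fixed S →ₗ[T] N from f) t x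

/-- The idempotent `e`, as an element of `e S`. -/
def unit : c.fixed S := ⟨c.ι 1, c.ι_one_mul 1⟩

/-- For x in eS one has xe = exe, an element of the corner. -/
lemma exists_smul_unit (x : c.fixed S) : ∃ t : T, c.mulRight (c.ι 1) x = t • c.unit := by
  obtain ⟨t, ht⟩ := c.exists_eq x
  refine ⟨t, Subtype.ext ?_⟩
  change (x : S) * c.ι 1 = c.ι t * c.ι 1
  rw [ι_mul_one, ht]
  exact congrArg (· * c.ι 1) x.2.symm

/-- The element `x e` of `e S e`, as an element of `T`. -/
noncomputable def coeff (x : c.fixed S) : T := (c.exists_smul_unit x).choose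

lemma ι_coeff (x : c.fixed S) : c.ι (c.coeff x) = x * c.ι 1 := by
  have h := congrArg Subtype.val (c.exists_smul_unit x).choose_spec
  exact (c.ι_mul_one _).symm.trans h.symm

/-- The isomorphism `e Hom_T(e S, N) → N`. -/
noncomputable def fixedCoinduced : c.fixed (c.Coinduced N) ≃ₗ[T] N := by
  refine LinearEquiv.ofBijective
    { toFun := fun f => c.eval f.1 c.unit
      map_add' := fun f f' => rfl
      map_smul' := fun t f => ?_ } ⟨?_, ?_⟩
  · rw [coe_smul_fixed, eval_smul, RingHom.id_apply, ← eval_map_smul]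
    refine congrArg (c.eval f.1) (Subtype.ext ?_)
    exact (c.ι_one_mul t).trans (c.ι_mul_one t).symm
  · rw [injective_iff_map_eq_zero]
    intro f hf
    refine Subtype.ext (LinearMap.ext fun x => ?_)
    obtain ⟨t, ht⟩ := c.exists_smul_unit x
    -- Because f = ef, f(x) = f(xe) = t f(e): the value at e determines f.
    have h1 : c.eval f.1 x = c.eval (c.ι 1 • f.1) x := by rw [c.smul_fixed f]
    rw [eval_smul, ht, eval_map_smul] at h1
    refine h1.trans ?_
    exact (congrArg (t • ·) hf).trans (smul_zero t)
  · intro n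
    -- The preimage of n is x ↦ (xe)n, with xe regarded as an element of T.
    let f : c.fixed S →ₗ[T] N :=
      { toFun := fun x => c.coeff x • n
        map_add' := fun x y => by
          rw [← add_smul]
          congr 1
          refine c.injective ?_
          rw [map_add, ι_coeff, ι_coeff, ι_coeff, ← add_mul]
          rfl
        map_smul' := fun t x => by
          rw [RingHom.id_apply, smul_smul]
          congr 1
          refine c.injective ?_
          rw [map_mul, ι_coeff, ι_coeff, ← mul_assoc]
          rfl }
    refine ⟨⟨f, LinearMap.ext fun x => ?_⟩, ?_⟩
    · change c.coeff (c.mulRight (c.ι 1) x) • n = c.coeff x • n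
      congr 1
      refine c.injective ?_
      rw [ι_coeff, ι_coeff]
      change (x : S) * c.ι 1 * c.ι 1 = _
      rw [mul_assoc, ι_one_mul]
    · change c.coeff c.unit • n = n
      have h : c.coeff c.unit = 1 := by
        refine c.injective ?_
        rw [ι_coeff]
        exact c.ι_one_mul 1
      rw [h, one_smul]

end Coinduced

open CategoryTheory

/-- The functor `M ↦ e M`. -/
def functor : ModuleCat.{0} S ⥤ ModuleCat.{0} T where
  obj M := ModuleCat.of T (c.fixed M)
  map f := ModuleCat.ofHom (c.fixedMap f.hom)

instance : c.functor.Faithful where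
  map_injective h := by
    refine ModuleCat.hom_ext (c.fixedMap_injective ?_)
    exact congrArg ModuleCat.Hom.hom h

instance : c.functor.Full where
  map_surjective g :=
    ⟨ModuleCat.ofHom (c.extend g.hom), ModuleCat.hom_ext (c.fixedMap_extend g.hom)⟩

instance : c.functor.EssSurj where
  mem_essImage N := ⟨ModuleCat.of S (c.Coinduced N), ⟨c.fixedCoinduced.toModuleIso⟩⟩

instance : c.functor.IsEquivalence where

open scoped ModuleCat.Algebra

/-- A ring is Morita equivalent to its full corners. -/
lemma isMoritaEquivalent (R : Type) [CommRing R] [Algebra R S] [Algebra R T]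
    (h : ∀ (r : R) (t : T), c.ι (r • t) = r • c.ι t) : IsMoritaEquivalent R S T := by
  refine ⟨⟨⟨c.functor.asEquivalence, ⟨fun {M N} f r => ?_⟩⟩⟩⟩
  ext (m : c.fixed M)
  refine Subtype.ext ?_
  change algebraMap R S r • f.hom m.1 = c.ι (algebraMap R T r) • f.hom m.1
  rw [Algebra.algebraMap_eq_smul_one (A := T), h, ← one_mul (c.ι 1), ← smul_mul_assoc,
    ← Algebra.algebraMap_eq_smul_one, mul_smul, ← map_smul f.hom (c.ι 1) m.1, c.smul_fixed m]

end FullCorner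

end Corner

end DoubleBurnside

namespace DoubleBurnside

/-! ## The corner is full -/

section CornerModThree

variable {S : Type} [Ring S] {e : S} (he : IsIdempotentElem e)

lemma corner_mul (a : he.Corner) : e * a.1 = a.1 := by
  obtain ⟨x, hx⟩ := a.2
  rw [← hx, ← mul_assoc, ← mul_assoc, he.eq]

lemma mul_corner (a : he.Corner) : a.1 * e = a.1 := by
  obtain ⟨x, hx⟩ := a.2
  rw [← hx, mul_assoc, he.eq]

/-- The projection `s ↦ e s e` onto the corner. -/
def toCorner (s : S) : he.Corner := ⟨e * s * e, s, rfl⟩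

lemma toCorner_coe (a : he.Corner) : toCorner he a.1 = a :=
  Subtype.ext (by
    change e * a.1 * e = a.1
    rw [corner_mul, mul_corner])

/-- 3S ∩ eSe = 3(eSe): if a = 3b lies in the corner, then a = eae = 3(ebe). This makes the map from
the corner modulo 3 to S/3 both well defined and injective. -/
lemma mk_coe_eq_zero_iff (a : he.Corner) :
    Ideal.Quotient.mk (threeIdeal S) a.1 = 0 ↔ Ideal.Quotient.mk (threeIdeal he.Corner) a = 0 := by
  have h3 (x : S) : 3 * x = x + x + x := by
    rw [← two_add_one_eq_three, add_mul, two_mul, one_mul]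
  have h3' (x : he.Corner) : 3 * x = x + x + x := by
    rw [← two_add_one_eq_three, add_mul, two_mul, one_mul]
  rw [mk_threeIdeal_eq_zero_iff, mk_threeIdeal_eq_zero_iff]
  constructor
  · rintro ⟨b, hb⟩
    refine ⟨toCorner he b, ?_⟩
    rw [← toCorner_coe he a, hb, h3, h3']
    refine Subtype.ext ?_
    change e * (b + b + b) * e = e * b * e + e * b * e + e * b * e
    simp only [mul_add, add_mul]
  · rintro ⟨b, rfl⟩
    refine ⟨b.1, ?_⟩
    rw [h3, h3']
    rfl

/-- The image of an element of `(e S e)/3` in `S/3`. -/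
noncomputable def cornerModThreeFun (x : ModThree he.Corner) : ModThree S :=
  Ideal.Quotient.mk (threeIdeal S) (Ideal.Quotient.mk_surjective x).choose.1

lemma cornerModThreeFun_mk (a : he.Corner) :
    cornerModThreeFun he (Ideal.Quotient.mk (threeIdeal he.Corner) a) =
      Ideal.Quotient.mk (threeIdeal S) a.1 := by
  have h := (Ideal.Quotient.mk_surjective
    (Ideal.Quotient.mk (threeIdeal he.Corner) a)).choose_spec
  rw [cornerModThreeFun, ← sub_eq_zero, ← map_sub]
  rw [← sub_eq_zero, ← map_sub] at h
  exact (mk_coe_eq_zero_iff he (_ - a)).2 h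

/-- The embedding of `(e S e)/3` into `S/3`. -/
noncomputable def cornerModThree : ModThree he.Corner →ₙ+* ModThree S where
  toFun := cornerModThreeFun he
  map_zero' := by
    rw [← map_zero (Ideal.Quotient.mk (threeIdeal he.Corner)), cornerModThreeFun_mk]
    exact map_zero (Ideal.Quotient.mk (threeIdeal S))
  map_add' x y := by
    obtain ⟨a, rfl⟩ := Ideal.Quotient.mk_surjective x
    obtain ⟨b, rfl⟩ := Ideal.Quotient.mk_surjective y
    rw [← map_add, cornerModThreeFun_mk, cornerModThreeFun_mk, cornerModThreeFun_mk, ← map_add]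
    rfl
  map_mul' x y := by
    obtain ⟨a, rfl⟩ := Ideal.Quotient.mk_surjective x
    obtain ⟨b, rfl⟩ := Ideal.Quotient.mk_surjective y
    rw [← map_mul, cornerModThreeFun_mk, cornerModThreeFun_mk, cornerModThreeFun_mk, ← map_mul]
    rfl

lemma cornerModThree_mk (a : he.Corner) :
    cornerModThree he (Ideal.Quotient.mk (threeIdeal he.Corner) a) =
      Ideal.Quotient.mk (threeIdeal S) a.1 := cornerModThreeFun_mk he a

lemma cornerModThree_one : cornerModThree he 1 = Ideal.Quotient.mk (threeIdeal S) e := by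
  rw [← map_one (Ideal.Quotient.mk (threeIdeal he.Corner)), cornerModThree_mk]
  rfl

/-- If `S e S = S`, then `(e S e)/3` is a full corner of `S/3`. -/
noncomputable def fullCornerModThree {κ : Type} [Fintype κ] (l r : κ → S)
    (h : ∑ k, l k * e * r k = 1) : FullCorner (ModThree S) (ModThree he.Corner) where
  ι := cornerModThree he
  injective := by
    rw [injective_iff_map_eq_zero]
    intro x hx
    obtain ⟨a, rfl⟩ := Ideal.Quotient.mk_surjective x
    rw [cornerModThree_mk] at hx
    exact (mk_coe_eq_zero_iff he a).1 hx
  exists_eq s := by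
    obtain ⟨b, rfl⟩ := Ideal.Quotient.mk_surjective s
    refine ⟨Ideal.Quotient.mk _ (toCorner he b), ?_⟩
    rw [cornerModThree_mk, cornerModThree_one, ← map_mul, ← map_mul]
    rfl
  κ := κ
  left k := Ideal.Quotient.mk _ (l k)
  right k := Ideal.Quotient.mk _ (r k)
  sum_eq := by
    simp only [cornerModThree_one, ← map_mul, ← map_sum, h, map_one]

lemma isMoritaEquivalent_corner_modThree {κ : Type} [Fintype κ] (l r : κ → S)
    (h : ∑ k, l k * e * r k = 1) :
    IsMoritaEquivalent (ZMod 3) (ModThree S) (ModThree he.Corner) :=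
  (fullCornerModThree he l r h).isMoritaEquivalent (ZMod 3) fun c x =>
    ZMod.map_smul (cornerModThree he) c x

end CornerModThree

/-- The element of `Λ₍₃₎` whose only nonzero entry is a `1` in the matrix `s`. -/
def sUnit (i j : Fin 3) : Lambda3 :=
  ⟨⟨Matrix.single i j 1, 0, 0, 0, 0, 0, 0, 0, 0, 0⟩, by
    refine ⟨fun k l => ?_, fun i => zero_mem _, zero_mem _, zero_mem _, zero_mem _,
      fun i => zero_mem _, zero_mem _, zero_mem _, zero_mem _, zero_mem _⟩
    change Matrix.single i j (1 : ℚ) k l ∈ Z3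
    rw [Matrix.single_apply]
    split_ifs
    exacts [one_mem _, zero_mem _]⟩

/-- With matrix units of the 3 × 3 block, e₁ = E₁₃ e E₃₁ and e₂ = E₂₃ e E₃₂, and 1 = e₁ + e₂ + e. -/
lemma sum_mul_idem_mul :
    ∑ k : Fin 3, (![sUnit 0 2, sUnit 1 2, idem] k) * idem * (![sUnit 2 0, sUnit 2 1, idem] k) =
      1 := by
  rw [Fin.sum_univ_three]
  refine Subtype.ext (A.ext ?_ ?_ ?_ ?_ ?_ ?_ ?_ ?_ ?_ ?_)
  · ext i j
    fin_cases i <;> fin_cases j <;>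
      simp [sUnit, idem, Matrix.single, Matrix.mul_apply, Matrix.diagonal]
  all_goals simp [sUnit, idem]

lemma isMoritaEquivalent_LambdaPrime3 :
    IsMoritaEquivalent (ZMod 3) (ModThree Lambda3) (ModThree LambdaPrime3) :=
  isMoritaEquivalent_corner_modThree idem_isIdempotentElem _ _ sum_mul_idem_mul

end DoubleBurnside

namespace DoubleBurnside

/-! ## Homomorphisms out of path algebras -/

namespace PathAlgebra

section PathLift

variable {R V X : Type} [CommRing R] [Quiver.{0} V] [Ring X] [Algebra R X]

/-- The value of a path, given those of the vertices and of the arrows. -/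
def pathValue (E : V → X) (F : ∀ a b : V, (a ⟶ b) → X) {a : V} :
    ∀ {b : V}, Quiver.Path a b → X
  | _, .nil => E a
  | _, .cons p f => pathValue E F p * F _ _ f

variable {E : V → X} {F : ∀ a b : V, (a ⟶ b) → X}

lemma vertex_mul_pathValue (hE : ∀ a, E a * E a = E a) {a b : V} (p : Quiver.Path a b) :
    E a * pathValue E F p = pathValue E F p := by
  induction p with
  | nil => exact hE a
  | cons p f ih => rw [pathValue, ← mul_assoc, ih]

lemma pathValue_mul_vertex (hE : ∀ a, E a * E a = E a)
    (hF : ∀ a b (f : a ⟶ b), F a b f * E b = F a b f) {a b : V} (p : Quiver.Path a b) :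
    pathValue E F p * E b = pathValue E F p := by
  induction p with
  | nil => exact hE a
  | cons p f ih => rw [pathValue, mul_assoc, hF]

lemma pathValue_comp (hE : ∀ a, E a * E a = E a)
    (hF : ∀ a b (f : a ⟶ b), F a b f * E b = F a b f) {a b c : V} (p : Quiver.Path a b)
    (q : Quiver.Path b c) :
    pathValue E F (p.comp q) = pathValue E F p * pathValue E F q := by
  induction q with
  | nil => exact (pathValue_mul_vertex hE hF p).symm
  | cons q f ih => rw [Quiver.Path.comp_cons, pathValue, pathValue, ih, mul_assoc]

lemma lift_pathValue_mul (hE : ∀ a, E a * E a = E a) (hEE : ∀ a b, a ≠ b → E a * E b = 0)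
    (hF : ∀ a b (f : a ⟶ b), F a b f * E b = F a b f) (x y : PathAlgebra R V) :
    lift R (fun p => pathValue E F p.2.2) (mulHom R x y) =
      lift R (fun p => pathValue E F p.2.2) x * lift R (fun p => pathValue E F p.2.2) y := by
  induction x using ofPath_induction with
  | h0 => simp
  | hadd x x' hx hx' => simp only [map_add, LinearMap.add_apply, hx, hx', add_mul]
  | @hsmul r a b p =>
    induction y using ofPath_induction with
    | h0 => simp
    | hadd y y' hy hy' => simp only [map_add, hy, hy', mul_add]
    | @hsmul r' c d q =>
      simp only [map_smul, LinearMap.smul_apply, mulHom_ofPath, lift_ofPath, smul_mul_assoc,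
        mul_smul_comm]
      congr 2
      by_cases h : b = c
      · subst h
        rw [pathMul_comp, lift_ofPath, pathValue_comp hE hF]
      -- Non-composable paths: the value of p ends in E b, that of q begins with E c, and these are
      -- orthogonal.
      · rw [pathMul_of_ne _ _ _ h, map_zero, ← vertex_mul_pathValue hE q,
          ← pathValue_mul_vertex hE hF p, mul_assoc, ← mul_assoc (E b), hEE b c h, zero_mul,
          mul_zero]

variable [Fintype V]

/-- The homomorphism out of the path algebra with given values on the vertices, which form a
complete system of orthogonal idempotents, and on the arrows. -/
noncomputable def pathLift (hE : ∀ a, E a * E a = E a) (hEE : ∀ a b, a ≠ b → E a * E b = 0)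
    (hF : ∀ a b (f : a ⟶ b), F a b f * E b = F a b f) (h1 : ∑ a, E a = 1) :
    PathAlgebra R V →ₐ[R] X :=
  AlgHom.ofLinearMap (lift R fun p => pathValue E F p.2.2)
    (by
      change lift R _ (unit R) = 1
      rw [unit, map_sum, ← h1]
      exact Finset.sum_congr rfl fun a _ => lift_ofPath R _ _)
    (lift_pathValue_mul hE hEE hF)

lemma pathLift_ofPath (hE : ∀ a, E a * E a = E a) (hEE : ∀ a b, a ≠ b → E a * E b = 0)
    (hF : ∀ a b (f : a ⟶ b), F a b f * E b = F a b f) (h1 : ∑ a, E a = 1) {a b : V}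
    (p : Quiver.Path a b) : pathLift hE hEE hF h1 (ofPath R p) = pathValue E F p :=
  lift_ofPath R _ p

lemma ofPath_cons {a b c : V} (p : Quiver.Path a b) (f : b ⟶ c) :
    ofPath R (p.cons f) = ofPath R p * ofArrow R f :=
  ((mulHom_ofPath R p f.toPath).trans (pathMul_comp R p f.toPath)).symm

end PathLift

end PathAlgebra

/-! ### Ten paths that span the quiver algebra -/

section QuiverBasis

variable (R : Type) [CommRing R]

/-- A path, as an element of the quotient of the path algebra by the relations. -/
noncomputable def pathClass {a b : Vertex} (p : Quiver.Path a b) : QuiverAlgebra R :=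
  RingQuot.mkAlgHom R (QuiverRel R) (PathAlgebra.ofPath R p)

/-- The path of length zero at a vertex. -/
def vertexPath (a : Vertex) : Quiver.Path a a := .nil

/-- The path consisting of one arrow. -/
def arrowPath {a b : Vertex} (f : Arrow a b) : Quiver.Path a b :=
  (Quiver.Path.nil : Quiver.Path a a).cons f

/-- The path consisting of two arrows. -/
def twoPath {a b c : Vertex} (f : Arrow a b) (g : Arrow b c) : Quiver.Path a c :=
  (arrowPath f).cons g

/-- The paths which form a basis modulo the relations. -/
noncomputable def pathBasis : Fin 10 → QuiverAlgebra R :=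
  ![pathClass R (vertexPath .e3), pathClass R (vertexPath .e4), pathClass R (vertexPath .e5),
    pathClass R (vertexPath .e6), pathClass R (arrowPath .τ₁), pathClass R (arrowPath .τ₂),
    pathClass R (arrowPath .τ₃), pathClass R (arrowPath .τ₄), pathClass R (twoPath .τ₁ .τ₂),
    pathClass R (twoPath .τ₃ .τ₄)]

lemma pathClass_cons {a b c : Vertex} (p : Quiver.Path a b) (f : Arrow b c) :
    pathClass R (p.cons f) = pathClass R p * pathClass R (arrowPath f) := by
  rw [pathClass, PathAlgebra.ofPath_cons, map_mul]
  rfl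

lemma mkAlgHom_eq_zero {x : PathAlgebra R Vertex} (h : QuiverRel R x 0) :
    RingQuot.mkAlgHom R (QuiverRel R) x = 0 :=
  (RingQuot.mkAlgHom_rel R h).trans (map_zero _)

/-- A path which ends with an arrow from `e3` or `e4` to `e6`, followed by an arrow from `e6`, is
zero. -/
lemma pathClass_mul_eq_zero {a b : Vertex} (f : Arrow a .e6) (g : Arrow .e6 b) :
    pathClass R (arrowPath f) * pathClass R (arrowPath g) = 0 := by
  refine (map_mul (RingQuot.mkAlgHom R (QuiverRel R)) _ _).symm.trans (mkAlgHom_eq_zero R ?_)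
  cases f <;> cases g
  exacts [.τ₂τ₁, .τ₂τ₃, .τ₄τ₁, .τ₄τ₃]

/-- Every arrow starts or ends at e6 and none is a loop, so of two consecutive inner vertices one is
e6. A path of length at least 3 therefore vanishes, and in length 2 only the two paths from e6 to e6
survive. -/
lemma pathClass_mem_span {a b : Vertex} (p : Quiver.Path a b) :
    pathClass R p ∈ Submodule.span R (Set.range (pathBasis R)) := by
  have hb (i : Fin 10) : pathBasis R i ∈ Submodule.span R (Set.range (pathBasis R)) :=
    Submodule.subset_span ⟨i, rfl⟩
  have hz {a b c d : Vertex} (p : Quiver.Path a b) (f : Arrow b c) (g : Arrow c d) (hc : c = .e6) :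
      pathClass R ((p.cons f).cons g) = 0 := by
    subst hc
    rw [pathClass_cons, pathClass_cons, mul_assoc, pathClass_mul_eq_zero R f g, mul_zero]
  have hz' {a b c d e : Vertex} (p : Quiver.Path a b) (f : Arrow b c) (g : Arrow c d)
      (h : Arrow d e) (hc : c = .e6) : pathClass R (((p.cons f).cons g).cons h) = 0 := by
    rw [pathClass_cons, hz p f g hc, zero_mul]
  rcases p with _ | ⟨p, f⟩
  · cases a
    exacts [hb 0, hb 1, hb 2, hb 3]
  · rcases p with _ | ⟨p, g⟩
    · change Arrow _ _ at f
      cases f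
      exacts [hb 4, hb 5, hb 6, hb 7]
    · rename_i d _
      by_cases hd : d = .e6
      · rw [hz p g f hd]
        exact zero_mem _
      rcases p with _ | ⟨p, h⟩
      · change Arrow _ _ at f
        change Arrow _ _ at g
        cases g
        · cases f
          exact hb 8
        · exact absurd rfl hd
        · cases f
          exact hb 9
        · exact absurd rfl hd
      -- The last arrow does not start at e6, so the arrow g before it does, and already the product
      -- of h and g is zero.
      · rw [hz' p h g f (by
          change Arrow _ _ at g
          cases g
          exacts [rfl, absurd rfl hd, rfl, absurd rfl hd])]
        exact zero_mem _

lemma exists_eq_sum_pathBasis (x : QuiverAlgebra R) :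
    ∃ c : Fin 10 → R, x = ∑ i, c i • pathBasis R i := by
  have h : x ∈ Submodule.span R (Set.range (pathBasis R)) := by
    obtain ⟨x, rfl⟩ := RingQuot.mkAlgHom_surjective R (QuiverRel R) x
    induction x using PathAlgebra.ofPath_induction with
    | h0 => rw [map_zero]; exact zero_mem _
    | hadd x y hx hy => rw [map_add]; exact add_mem hx hy
    | hsmul r p => rw [map_smul]; exact Submodule.smul_mem _ _ (pathClass_mem_span R p)
  obtain ⟨c, hc⟩ := (Submodule.mem_span_range_iff_exists_fun R).1 h
  exact ⟨c, hc.symm⟩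

end QuiverBasis

end DoubleBurnside

namespace DoubleBurnside

/-! ## The corner modulo `3` as a quotient of a path algebra -/

/-- The coordinates of the idempotent `e`. -/
def IntA.idem : IntA := ⟨0, 0, 0, 0, 0, 0, 0, 0, 1, 0, 0, 0, 1, 0, 1, 0, 0, 0, 0, 1, 0, 0⟩

lemma IntA.toA_idem : IntA.idem.toA = DoubleBurnside.idem.1 := by
  refine A.ext ?_ ?_ ?_ ?_ ?_ ?_ ?_ ?_ ?_ ?_
  · ext i j
    fin_cases i <;> fin_cases j <;> simp [IntA.idem, toA, DoubleBurnside.idem, Matrix.diagonal]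
  · ext i
    fin_cases i <;> simp [IntA.idem, toA, DoubleBurnside.idem]
  all_goals simp [IntA.idem, toA, DoubleBurnside.idem]

lemma IntA.toA_mem (a : IntA) : a.toA ∈ Lambda3 := by
  rw [mem_Lambda3_iff]
  intro k
  rw [A.coord_toA]
  exact intCast_mem Z3 _

/-- The coordinates of `e a e`. -/
def IntA.corner (a : IntA) : IntA := (IntA.idem.mul a).mul IntA.idem

/-- The element `e a e` of `Λ'₍₃₎`. -/
noncomputable def primeOf (a : IntA) : LambdaPrime3 :=
  toCorner idem_isIdempotentElem ⟨a.toA, a.toA_mem⟩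

lemma primeOf_coe (a : IntA) : (primeOf a).1.1 = a.corner.toA := by
  rw [IntA.corner, IntA.toA_mul, IntA.toA_mul, IntA.toA_idem]
  rfl

/-- The element `e a e` of `Λ'₍₃₎`, modulo `3`. -/
noncomputable def primeMod (a : IntA) : ModThree LambdaPrime3 :=
  Ideal.Quotient.mk (threeIdeal LambdaPrime3) (primeOf a)

/-- Turns identities in Λ'₍₃₎/3Λ'₍₃₎ into decidable identities between integer coordinates. -/
lemma primeMod_mul {a b c : IntA} (h : a.corner.mul b.corner = c.corner) :
    primeMod a * primeMod b = primeMod c := by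
  rw [primeMod, primeMod, ← map_mul, primeMod]
  refine congrArg _ (Subtype.ext (Subtype.ext ?_))
  rw [primeOf_coe, ← h, IntA.toA_mul, ← primeOf_coe, ← primeOf_coe]
  rfl

lemma primeMod_zero : primeMod IntA.zero = 0 := by
  rw [primeMod, ← map_zero (Ideal.Quotient.mk (threeIdeal LambdaPrime3))]
  refine congrArg _ (Subtype.ext (Subtype.ext ?_))
  rw [primeOf_coe]
  exact IntA.toA_zero

lemma primeMod_idem : primeMod IntA.idem = 1 := by
  rw [primeMod, ← map_one (Ideal.Quotient.mk (threeIdeal LambdaPrime3))]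
  refine congrArg _ (Subtype.ext (Subtype.ext ?_))
  rw [primeOf_coe]
  exact IntA.toA_idem

lemma primeMod_add {a b c : IntA} (h : a.corner.addSMul 1 b.corner = c.corner) :
    primeMod a + primeMod b = primeMod c := by
  rw [primeMod, primeMod, ← map_add, primeMod]
  refine congrArg _ (Subtype.ext (Subtype.ext ?_))
  rw [primeOf_coe, ← h, IntA.toA_addSMul, one_smul, ← primeOf_coe, ← primeOf_coe]
  rfl

/-- The idempotents `e₃`, `e₄`, `e₅`, `e₆`. -/
def vertexInt : Vertex → IntA
  | .e3 => { IntA.zero with s22 := 1 }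
  | .e4 => { IntA.zero with u := 1 }
  | .e5 => { IntA.zero with w := 1 }
  | .e6 => { IntA.zero with z1 := 1 }

/-- The elements of `Λ'₍₃₎` which correspond to the arrows. -/
def arrowInt : ∀ {a b : Vertex}, Arrow a b → IntA
  -- The coordinate x2 is divided by 3: the matrix has the entry 3 at position (6, 3).
  | _, _, .τ₁ => { IntA.zero with x2 := 1 }
  | _, _, .τ₂ => { IntA.zero with t2 := 1 }
  | _, _, .τ₃ => { IntA.zero with y := 1 }
  | _, _, .τ₄ => { IntA.zero with v := 1 }

lemma vertex_mul_self (a : Vertex) :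
    primeMod (vertexInt a) * primeMod (vertexInt a) = primeMod (vertexInt a) := by
  cases a <;> exact primeMod_mul (by decide)

lemma vertex_mul_of_ne (a b : Vertex) (h : a ≠ b) :
    primeMod (vertexInt a) * primeMod (vertexInt b) = 0 := by
  rw [← primeMod_zero]
  cases a <;> cases b <;> first | exact absurd rfl h | exact primeMod_mul (by decide)

lemma arrow_mul_vertex (a b : Vertex) (f : a ⟶ b) :
    primeMod (arrowInt (a := a) (b := b) f) * primeMod (vertexInt b) =
      primeMod (arrowInt (a := a) (b := b) f) := by
  change Arrow a b at f
  cases f <;> exact primeMod_mul (by decide)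

lemma vertex_mul_arrow {a b : Vertex} (f : Arrow a b) :
    primeMod (vertexInt a) * primeMod (arrowInt f) = primeMod (arrowInt f) := by
  cases f <;> exact primeMod_mul (by decide)

lemma sum_vertex : ∑ a, primeMod (vertexInt a) = 1 := by
  have h : ∑ a, primeMod (vertexInt a) = primeMod (vertexInt .e3) + (primeMod (vertexInt .e4) +
      (primeMod (vertexInt .e5) + primeMod (vertexInt .e6))) := by
    have hu : (Finset.univ : Finset Vertex) = {.e3, .e4, .e5, .e6} := rfl
    rw [hu, Finset.sum_insert (by decide), Finset.sum_insert (by decide),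
      Finset.sum_insert (by decide), Finset.sum_singleton]
  rw [h, primeMod_add (c := { vertexInt .e5 with z1 := 1 }) (by decide),
    primeMod_add (c := { vertexInt .e5 with z1 := 1, u := 1 }) (by decide),
    primeMod_add (c := IntA.idem) (by decide), primeMod_idem]

/-- The value of a vertex. -/
noncomputable def vertexVal (a : Vertex) : ModThree LambdaPrime3 := primeMod (vertexInt a)

/-- The value of an arrow. -/
noncomputable def arrowVal (a b : Vertex) (f : a ⟶ b) : ModThree LambdaPrime3 :=
  primeMod (arrowInt (a := a) (b := b) f)

/-- The homomorphism from the path algebra to `Λ'₍₃₎/3Λ'₍₃₎`. -/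
noncomputable def pathToPrime : PathAlgebra (ZMod 3) Vertex →ₐ[ZMod 3] ModThree LambdaPrime3 :=
  PathAlgebra.pathLift (E := vertexVal) (F := arrowVal) vertex_mul_self vertex_mul_of_ne
    arrow_mul_vertex sum_vertex

lemma pathToPrime_ofPath {a b : Vertex} (p : Quiver.Path a b) :
    pathToPrime (PathAlgebra.ofPath (ZMod 3) p) =
      PathAlgebra.pathValue vertexVal arrowVal p :=
  PathAlgebra.pathLift_ofPath _ _ _ _ p

lemma pathToPrime_arrowPath {a b : Vertex} (f : Arrow a b) :
    pathToPrime (PathAlgebra.ofPath (ZMod 3) (arrowPath f)) = primeMod (arrowInt f) := by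
  rw [pathToPrime_ofPath]
  exact vertex_mul_arrow f

/-- The four products vanish in Λ'₍₃₎ already before reduction: t · x and v · y are 0 by definition
of A, and the two mixed products fall into zero blocks. -/
lemma pathToPrime_rel {x y : PathAlgebra (ZMod 3) Vertex} (h : QuiverRel (ZMod 3) x y) :
    pathToPrime x = pathToPrime y := by
  have h0 {a b c d : Vertex} (f : Arrow a b) (g : Arrow c d)
      (hfg : (arrowInt f).corner.mul (arrowInt g).corner = IntA.zero.corner) :
      pathToPrime (PathAlgebra.ofPath (ZMod 3) (arrowPath f) *
        PathAlgebra.ofPath (ZMod 3) (arrowPath g)) = pathToPrime 0 := by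
    rw [map_mul, pathToPrime_arrowPath, pathToPrime_arrowPath, primeMod_mul hfg, primeMod_zero,
      map_zero]
  cases h
  exacts [h0 .τ₄ .τ₃ (by decide), h0 .τ₄ .τ₁ (by decide), h0 .τ₂ .τ₁ (by decide),
    h0 .τ₂ .τ₃ (by decide)]

/-- The homomorphism from the quotient of the path algebra to `Λ'₍₃₎/3Λ'₍₃₎`. -/
noncomputable def quiverToPrime : QuiverAlgebra (ZMod 3) →ₐ[ZMod 3] ModThree LambdaPrime3 :=
  RingQuot.liftAlgHom (ZMod 3) ⟨pathToPrime, fun {_ _} => pathToPrime_rel⟩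

lemma quiverToPrime_pathClass {a b : Vertex} (p : Quiver.Path a b) :
    quiverToPrime (pathClass (ZMod 3) p) = pathToPrime (PathAlgebra.ofPath (ZMod 3) p) :=
  RingQuot.liftAlgHom_mkAlgHom_apply (ZMod 3) pathToPrime _ _

/-- The elements of `Λ'₍₃₎` which correspond to the basis of paths. -/
def basisInt : Fin 10 → IntA :=
  ![vertexInt .e3, vertexInt .e4, vertexInt .e5, vertexInt .e6, arrowInt .τ₁, arrowInt .τ₂,
    -- The last two entries are the images 3η of τ₁τ₂ and ξ − 12η of τ₃τ₄, with the coefficient of η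
    -- divided by 3.
    arrowInt .τ₃, arrowInt .τ₄, { IntA.zero with z2 := 1 }, { IntA.zero with z2 := -4, z3 := 1 }]

lemma quiverToPrime_twoPath {a b c : Vertex} (f : Arrow a b) (g : Arrow b c) {z : IntA}
    (h : (arrowInt f).corner.mul (arrowInt g).corner = z.corner) :
    quiverToPrime (pathClass (ZMod 3) (twoPath f g)) = primeMod z := by
  rw [twoPath, pathClass_cons, map_mul, quiverToPrime_pathClass, quiverToPrime_pathClass,
    pathToPrime_arrowPath, pathToPrime_arrowPath, primeMod_mul h]

lemma quiverToPrime_pathBasis (i : Fin 10) :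
    quiverToPrime (pathBasis (ZMod 3) i) = primeMod (basisInt i) := by
  have hv (a : Vertex) : quiverToPrime (pathClass (ZMod 3) (vertexPath a)) =
      primeMod (vertexInt a) := by
    rw [quiverToPrime_pathClass, pathToPrime_ofPath]
    rfl
  have ha {a b : Vertex} (f : Arrow a b) : quiverToPrime (pathClass (ZMod 3) (arrowPath f)) =
      primeMod (arrowInt f) := by
    rw [quiverToPrime_pathClass, pathToPrime_arrowPath]
  fin_cases i
  exacts [hv _, hv _, hv _, hv _, ha _, ha _, ha _, ha _,
    quiverToPrime_twoPath _ _ (by decide), quiverToPrime_twoPath _ _ (by decide)]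

/-- The coordinates of `e a e` with respect to the basis which corresponds to the paths. -/
noncomputable def pathCoord : A →ₗ[ℚ] Fin 10 → ℚ where
  -- The summand 4z₃ compensates the −12η in the basis element ξ − 12η.
  toFun a := ![a.s 2 2, a.u, a.w, a.z₁, a.x 2 / 3, a.t 2, a.y, a.v, a.z₂ / 3 + 4 * a.z₃, a.z₃]
  map_add' a b := by
    ext k
    fin_cases k <;> simp [add_div, mul_add]
    ring
  map_smul' q a := by
    ext k
    fin_cases k <;> simp [mul_div_assoc, mul_add]
    ring

lemma corner_basisInt (i : Fin 10) : (basisInt i).corner = basisInt i := by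
  decide +revert

lemma pathCoord_basis (i k : Fin 10) :
    pathCoord (basisInt i).corner.toA k = if i = k then 1 else 0 := by
  rw [corner_basisInt]
  fin_cases i <;> fin_cases k <;>
    simp [pathCoord, basisInt, vertexInt, arrowInt, IntA.toA, IntA.zero]
  norm_num

lemma pathCoord_sum (c : Fin 10 → ℚ) :
    pathCoord (∑ i, c i • (basisInt i).corner.toA) = c := by
  ext k
  rw [map_sum, Finset.sum_apply]
  simp only [map_smul, Pi.smul_apply, pathCoord_basis, smul_eq_mul, mul_ite, mul_one, mul_zero]
  simp

lemma pathCoord_mem {a : A} (ha : a ∈ Lambda3) (k : Fin 10) : pathCoord a k ∈ Z3 := by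
  obtain ⟨h1, h2, h3, h4, h5, h6, h7, h8, h9, h10⟩ := ha
  fin_cases k
  exacts [h1 2 2, h3, h5, h8, mem_threeZ3_iff.1 (h6 2), h2 2, h7, h4,
    add_mem (mem_threeZ3_iff.1 h9) (mul_mem (ofNat_mem Z3 4) h10), h10]

lemma coord_corner (a : A) : A.coord (idem.1 * a * idem.1) =
    ![0, 0, 0, 0, 0, 0, 0, 0, a.s 2 2, 0, 0, a.t 2, a.u, a.v, a.w, 0, 0, a.x 2 / 3, a.y, a.z₁,
      a.z₂ / 3, a.z₃] := by
  simp only [A.coord, LinearMap.coe_mk, AddHom.coe_mk]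
  simp [idem, Matrix.mul_diagonal, Matrix.diagonal_mul, Matrix.mulVec_diagonal,
    Matrix.vecMul_diagonal]

/-- The ten elements span eAe over ℚ, and the coordinates of a only involve the entries that survive
in eae. -/
lemma sum_pathCoord (a : A) :
    ∑ i, pathCoord a i • (basisInt i).corner.toA = idem.1 * a * idem.1 := by
  refine A.coord_injective (funext fun k => ?_)
  rw [coord_corner, map_sum, Finset.sum_apply]
  simp only [map_smul, Pi.smul_apply, A.coord_toA, smul_eq_mul, corner_basisInt]
  simp only [Fin.sum_univ_succ, pathCoord, LinearMap.coe_mk, AddHom.coe_mk, basisInt, vertexInt,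
    arrowInt, IntA.zero, IntA.coord]
  fin_cases k <;> simp
  ring

/-- An integral linear combination of basis elements of `Λ'₍₃₎`. -/
noncomputable def primeSum (n : Fin 10 → ℤ) : LambdaPrime3 := ∑ i, n i • primeOf (basisInt i)

/-- The inclusion of `Λ'₍₃₎` into `A`. -/
def primeToA : LambdaPrime3 →+ A where
  toFun a := a.1.1
  map_zero' := rfl
  map_add' _ _ := rfl

lemma primeToA_injective : Function.Injective primeToA :=
  Subtype.val_injective.comp Subtype.val_injective

lemma primeToA_primeSum (n : Fin 10 → ℤ) :
    primeToA (primeSum n) = ∑ i, (n i : ℚ) • (basisInt i).corner.toA := by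
  rw [primeSum, map_sum]
  refine Finset.sum_congr rfl fun i _ => ?_
  rw [map_zsmul, Int.cast_smul_eq_zsmul]
  exact congrArg _ (primeOf_coe _)

lemma primeToA_three_mul (a : LambdaPrime3) : primeToA (3 * a) = (3 : ℚ) • primeToA a := by
  rw [← two_add_one_eq_three, add_mul, two_mul, one_mul, map_add, map_add]
  module

lemma sum_pathCoord_prime (a : LambdaPrime3) :
    ∑ i, pathCoord (primeToA a) i • (basisInt i).corner.toA = primeToA a := by
  rw [sum_pathCoord]
  exact congrArg Subtype.val (congrArg Subtype.val (toCorner_coe idem_isIdempotentElem a))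

lemma quiverToPrime_sum (n : Fin 10 → ℤ) :
    quiverToPrime (∑ i, (n i : ZMod 3) • pathBasis (ZMod 3) i) =
      Ideal.Quotient.mk (threeIdeal LambdaPrime3) (primeSum n) := by
  rw [map_sum, primeSum, map_sum]
  refine Finset.sum_congr rfl fun i _ => ?_
  rw [map_smul, quiverToPrime_pathBasis, Int.cast_smul_eq_zsmul, map_zsmul]
  rfl

/-- Ten classes that span the quiver algebra go to the reduction of a ℤ₍₃₎-basis of Λ'₍₃₎; as
before, coefficients are compared through integer lifts. -/
lemma quiverToPrime_bijective : Function.Bijective quiverToPrime := by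
  constructor
  · rw [injective_iff_map_eq_zero]
    intro x hx
    obtain ⟨c, rfl⟩ := exists_eq_sum_pathBasis (ZMod 3) x
    choose n hn using fun i => ZMod.intCast_surjective (c i)
    simp only [← hn] at hx ⊢
    rw [quiverToPrime_sum, mk_threeIdeal_eq_zero_iff] at hx
    obtain ⟨b, hb⟩ := hx
    have hc := pathCoord_sum fun i => (n i : ℚ)
    rw [← primeToA_primeSum, hb, primeToA_three_mul, map_smul] at hc
    refine Finset.sum_eq_zero fun i _ => ?_
    have h3 : (n i : ℚ) = 3 * pathCoord (primeToA b) i := (congrFun hc i).symm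
    rw [(ZMod.intCast_zmod_eq_zero_iff_dvd (n i) 3).2
      (three_dvd_of_div_mem (pathCoord_mem b.1.2 i) h3), zero_smul]
  · intro y
    obtain ⟨a, rfl⟩ := Ideal.Quotient.mk_surjective y
    choose n r hr hn using fun i => exists_int_of_mem_Z3 (pathCoord_mem a.1.2 i)
    refine ⟨∑ i, (n i : ZMod 3) • pathBasis (ZMod 3) i, ?_⟩
    rw [quiverToPrime_sum, eq_comm, ← sub_eq_zero, ← map_sub, mk_threeIdeal_eq_zero_iff]
    let b : Lambda3 := ∑ i, (⟨r i, hr i⟩ : Z3) • (primeOf (basisInt i)).1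
    have hb : b.1 = ∑ i, r i • (basisInt i).corner.toA := by
      refine (AddSubmonoidClass.coe_finsetSum _ _).trans (Finset.sum_congr rfl fun i _ => ?_)
      exact congrArg (r i • ·) (primeOf_coe (basisInt i))
    -- The element b is a combination of corner elements, so projecting it to the corner does not
    -- change it.
    have hbe : primeToA (toCorner idem_isIdempotentElem b) =
        ∑ i, r i • (basisInt i).corner.toA := by
      rw [← hb]
      refine (sum_pathCoord b.1).symm.trans ?_
      rw [hb, pathCoord_sum]
    refine ⟨toCorner idem_isIdempotentElem b, primeToA_injective ?_⟩
    rw [primeToA_three_mul, hbe, map_sub, primeToA_primeSum, ← sum_pathCoord_prime a,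
      Finset.smul_sum, ← Finset.sum_sub_distrib]
    refine Finset.sum_congr rfl fun i _ => ?_
    rw [← sub_smul, smul_smul]
    congr 1
    exact sub_eq_iff_eq_add'.2 (hn i)

/-- `Λ'₍₃₎/3Λ'₍₃₎` is the path algebra of the quiver modulo the relations. -/
noncomputable def primeQuiverEquiv : ModThree LambdaPrime3 ≃ₐ[ZMod 3] QuiverAlgebra (ZMod 3) :=
  (AlgEquiv.ofBijective quiverToPrime quiverToPrime_bijective).symm

end DoubleBurnside

theorem corollary5p11 :
    Nonempty (DoubleBurnside.BurnsideAlgebra DoubleBurnside.Z3 (Equiv.Perm (Fin 3))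
      ≃ₐ[DoubleBurnside.Z3] DoubleBurnside.Lambda3) ∧
    Nonempty (DoubleBurnside.ModThree DoubleBurnside.LambdaPrime3
      ≃ₐ[ZMod 3] DoubleBurnside.QuiverAlgebra (ZMod 3)) ∧
    IsMoritaEquivalent (ZMod 3)
      (DoubleBurnside.BurnsideAlgebra (ZMod 3) (Equiv.Perm (Fin 3)))
      (DoubleBurnside.ModThree DoubleBurnside.LambdaPrime3) ∧
    IsMoritaEquivalent (ZMod 3)
      (DoubleBurnside.BurnsideAlgebra (ZMod 3) (Equiv.Perm (Fin 3)))
      (DoubleBurnside.QuiverAlgebra (ZMod 3)) := by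
  have h : IsMoritaEquivalent (ZMod 3)
      (DoubleBurnside.BurnsideAlgebra (ZMod 3) (Equiv.Perm (Fin 3)))
      (DoubleBurnside.ModThree DoubleBurnside.LambdaPrime3) :=
    (IsMoritaEquivalent.of_algEquiv (ZMod 3)
      DoubleBurnside.SymThree.burnsideModThreeEquiv).trans (ZMod 3)
      DoubleBurnside.isMoritaEquivalent_LambdaPrime3
  exact ⟨⟨DoubleBurnside.SymThree.burnsideEquiv⟩, ⟨DoubleBurnside.primeQuiverEquiv⟩, h,
    h.trans (ZMod 3) (IsMoritaEquivalent.of_algEquiv (ZMod 3) DoubleBurnside.primeQuiverEquiv)⟩
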